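/- Let $k$ be a field, $r\ge 1$ an integer, and $\mathcal A$ a $k$-linear abelian category. **Conventions.** $(\mathrm{Art}_r)$ is the category of associative $k$-algebras $R$ with $\dim_kR<\infty$, endowed with $k$-algebra homomorphisms $k^r\to R\to k^r$ whose composite is the identity and such that $M=\ker(R\to k^r)$ is nilpotent; morphisms are the $k$-algebra homomorphisms commuting with these structure maps. Put $M_i=\ker(R\to k^r\to k)$, the last map being the $i$-th projection. If $R$ acts from the left on an object $X$ of $\mathcal A$ (by a $k$-algebra homomorphism $R\to\mathrm{End}(X)$) and $N$ is a finitely presented right $R$-module with presentation $R^m\to R^n\to N\to 0$, then $N\otimes_RX=\mathrm{Coker}(X^m\to X^n)$; $X$ is flat over $R$ if $-\otimes_RX$ takes short exact sequences of finitely presented right $R$-modules to short exact sequences. For objects $F_1,\dots,F_r$ and $F=\bigoplus_iF_i$, an $r$-pointed NC deformation of $\{F_i\}$ over $R\in(\mathrm{Art}_r)$ is a pair $(F_R,\phi)$, where $F_R$ is an object with a flat left $R$-module structure and $\phi:R/M\otimes_RF_R\cong F$ is an isomorphism inducing isomorphisms $R/M_i\otimes_RF_R\cong F_i$ for all $i$;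 isomorphisms of deformations over $R$ are $R$-linear and compatible with the $\phi$'s. A sequence of deformations $(F^{(n)},\phi^{(n)})$ over $(R^{(n)},M^{(n)})\in(\mathrm{Art}_r)$, $n\ge 0$, with surjective morphisms $R^{(n+1)}\to R^{(n)}$ such that $(F^{(n)},\phi^{(n)})\cong R^{(n)}\otimes_{R^{(n+1)}}(F^{(n+1)},\phi^{(n+1)})$ is a *versal deformation* if 1. for every deformation $(F_{R'},\phi')$ of $\{F_i\}$ over any $R'\in(\mathrm{Art}_r)$ there are $n>0$ and a morphism $g:R^{(n)}\to R'$ with $(F_{R'},\phi')\cong R'\otimes_{R^{(n)}}(F^{(n)},\phi^{(n)})$; and 2. there is $n_0>0$ such that the natural maps $M^{(n)}/(M^{(n)})^2\to M^{(n_0)}/(M^{(n_0)})^2$ are bijective for all $n\ge n_0$, and such that for every $n\ge n_0$, every $R'$ and every deformation over $R'$, any two morphisms $g,g':R^{(n)}\to R'$ as in (1) induce the same map $dg=dg':M^{(n)}/(M^{(n)})^2\to M_{R'}/M_{R'}^2$. **Theorem.** Let $\{F_i\}_{i=1}^r$ be a simple collection in $\mathcal A$, i.e. $\dim_k\mathrm{Hom}(F_i,F_j)=\delta_{ij}$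 for all $i,j$, and assume $\dim_k\mathrm{Ext}^1(F,F)<\infty$. Then there exists a tower of universal extensions of $\{F_i\}$, i.e. objects $F_i^{(n)}$ ($n\ge0$, $1\le i\le r$) with $F_i^{(0)}=F_i$ and extensions $$0\to\bigoplus_j\mathrm{Ext}^1(F_i^{(n)},F_j)^*\otimes F_j\to F_i^{(n+1)}\to F_i^{(n)}\to0$$ in which the spaces $\mathrm{Ext}^1(F_i^{(n)},F_j)$ are finite-dimensional and whose class is the canonical element of $\bigoplus_j\mathrm{Ext}^1(F_i^{(n)},F_j)\otimes\mathrm{Ext}^1(F_i^{(n)},F_j)^*$. For every such tower put $F^{(n)}=\bigoplus_iF_i^{(n)}$ and $R^{(n)}=\mathrm{End}(F^{(n)})$. Then: (1) For every $n\ge 0$ the ring $R^{(n)}$ lies in $(\mathrm{Art}_r)$, where $k^r\to R^{(n)}$ sends the $i$-th basis vector to the idempotent $F^{(n)}\to F_i^{(n)}\to F^{(n)}$, and $R^{(n)}\to k^r$ sends $x$ to the $(c_i)$ for which $x$ and $\bigoplus_i c_i\,\mathrm{id}_{F_i}$ are compatible with the projection $F^{(n)}\to F$. The projection $F^{(n)}\to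 F$ induces an isomorphism $\phi^{(n)}:R^{(n)}/M^{(n)}\otimes_{R^{(n)}}F^{(n)}\cong F$, and $(F^{(n)},\phi^{(n)})$, with the tautological action of $R^{(n)}$, is an $r$-pointed NC deformation of $\{F_i\}$ over $R^{(n)}$; in particular $F^{(n)}$ is flat over $R^{(n)}$. (2) Every $x\in R^{(n+1)}$ induces an endomorphism of $F^{(n)}$ through the projection $F^{(n+1)}\to F^{(n)}$, and with the resulting homomorphisms $R^{(n+1)}\to R^{(n)}$ the sequence $\{(F^{(n)},\phi^{(n)})\}$ over $\{(R^{(n)},M^{(n)})\}$ is a versal deformation of $\{F_i\}$. -/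

import Mathlib

open CategoryTheory CategoryTheory.Limits MulOpposite

universe w v u uk t t'

attribute [local instance] CategoryTheory.Abelian.hasFiniteBiproducts

noncomputable section

namespace NCDef

/-! ### Finite-dimensional `r`-pointed algebras -/

/-- The structure of an object of `(Art_r)` on a `k`-algebra `R`: algebra homomorphisms
`k^r → R → k^r` whose composition is the identity, with `dim_k R < ∞` and with
`M = Ker (R → k^r)` nilpotent. -/
structure ArtStr (k : Type uk) [Field k] (r : ℕ) (R : Type t) [Ring R] [Algebra k R] where
  incl : (Fin r → k) →ₐ[k] R
  proj : R →ₐ[k] (Fin r → k)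
  proj_incl : proj.comp incl = AlgHom.id k (Fin r → k)
  finite : Module.Finite k R
  nilp : ∃ m : ℕ, RingHom.ker proj ^ m = ⊥

/-- Objects of the category `(Art_r)`. -/
structure Art (k : Type uk) [Field k] (r : ℕ) where
  carrier : Type t
  [ring : Ring carrier]
  [algebra : Algebra k carrier]
  str : ArtStr k r carrier

namespace Art

variable {k : Type uk} [Field k] {r : ℕ}

instance : CoeSort (Art.{uk, t} k r) (Type t) := ⟨Art.carrier⟩

instance (R : Art.{uk, t} k r) : Ring R := R.ring
instance (R : Art.{uk, t} k r) : Algebra k R := R.algebra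
instance (R : Art.{uk, t} k r) : Module.Finite k R := R.str.finite

/-- A `k`-algebra with an `(Art_r)`-structure, as an object of `(Art_r)`. -/
def of {R : Type t} [Ring R] [Algebra k R] (S : ArtStr k r R) : Art.{uk, t} k r := ⟨R, S⟩

/-- The ideal `M = Ker (R → k^r)`. -/
def M (R : Art.{uk, t} k r) : Ideal R := RingHom.ker R.str.proj

/-- The maximal ideals `M_i = Ker (R → k^r → k)`. -/
def Mi (R : Art.{uk, t} k r) (i : Fin r) : Ideal R :=
  RingHom.ker ((Pi.evalAlgHom k (fun _ : Fin r => k) i).comp R.str.proj)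

instance (R : Art.{uk, t} k r) : R.M.IsTwoSided := by unfold M; infer_instance
instance (R : Art.{uk, t} k r) (i : Fin r) : (R.Mi i).IsTwoSided := by unfold Mi; infer_instance

lemma M_le_Mi (R : Art.{uk, t} k r) (i : Fin r) : R.M ≤ R.Mi i := by
  intro x hx
  have hx' : R.str.proj x = 0 := hx
  change R.str.proj x i = 0
  rw [hx']; rfl

/-- Morphisms of `(Art_r)`: the `k`-algebra homomorphisms commuting with the structure maps
`k^r → R → k^r`. -/
structure Hom (R : Art.{uk, t} k r) (S : Art.{uk, t'} k r) where
  toAlgHom : R →ₐ[k] S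
  comp_incl : toAlgHom.comp R.str.incl = S.str.incl
  proj_comp : S.str.proj.comp toAlgHom = R.str.proj

namespace Hom

def id (R : Art.{uk, t} k r) : Hom R R := ⟨AlgHom.id k R, rfl, rfl⟩

/-- The composition `R → S → T`. -/
def comp {R S T : Art.{uk, t} k r} (f : Hom R S) (g : Hom S T) : Hom R T where
  toAlgHom := g.toAlgHom.comp f.toAlgHom
  comp_incl := by rw [AlgHom.comp_assoc, f.comp_incl, g.comp_incl]
  proj_comp := by rw [← AlgHom.comp_assoc, g.proj_comp, f.proj_comp]

variable {R : Art.{uk, t} k r} {S : Art.{uk, t'} k r}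

lemma map_M (g : Hom R S) {x : R} (hx : x ∈ R.M) : g.toAlgHom x ∈ S.M := by
  have hx' : R.str.proj x = 0 := hx
  change S.str.proj (g.toAlgHom x) = 0
  rw [← hx', ← g.proj_comp]; rfl

lemma map_M_mul_M (g : Hom R S) {x : R} (hx : x ∈ R.M * R.M) : g.toAlgHom x ∈ S.M * S.M := by
  refine Submodule.smul_induction_on (p := fun y => g.toAlgHom y ∈ S.M * S.M) hx ?_ ?_
  · intro a ha b hb
    simp only [smul_eq_mul, map_mul]
    exact Ideal.mul_mem_mul (g.map_M ha) (g.map_M hb)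
  · intro a b ha hb
    rw [map_add]
    exact add_mem ha hb

end Hom

/-- The `k`-vector space `M / M ^ 2`. -/
abbrev Cotangent (R : Art.{uk, t} k r) : Type t :=
  (R.M.restrictScalars k) ⧸ ((R.M * R.M).restrictScalars k).submoduleOf (R.M.restrictScalars k)

/-- The map `dg : M_R / M_R ^ 2 → M_S / M_S ^ 2` induced by a morphism `g : R → S`. -/
def Hom.cotangentMap {R : Art.{uk, t} k r} {S : Art.{uk, t'} k r} (g : Hom R S) :
    Cotangent R →ₗ[k] Cotangent S :=
  Submodule.mapQ _ _
    (g.toAlgHom.toLinearMap.restrict (p := R.M.restrictScalars k) (q := S.M.restrictScalars k)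
      (fun _ hx => g.map_M hx))
    (fun _ hx => g.map_M_mul_M hx)

end Art

/-! ### Right modules obtained from algebra homomorphisms -/

/-- For a homomorphism `g : R → S`, the ring `S` regarded as a right `R`-module. -/
def RightRes {k : Type uk} [Field k] {R : Type t} {S : Type t'} [Ring R] [Ring S]
    [Algebra k R] [Algebra k S] (_g : R →ₐ[k] S) : Type t' := S

namespace RightRes

variable {k : Type uk} [Field k] {R : Type t} {S S' : Type t'} [Ring R] [Ring S] [Ring S']
    [Algebra k R] [Algebra k S] [Algebra k S'] (g : R →ₐ[k] S)

instance : AddCommGroup (RightRes g) := inferInstanceAs (AddCommGroup S)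

instance : Module k (RightRes g) := inferInstanceAs (Module k S)

instance : Module Rᵐᵒᵖ (RightRes g) := Module.compHom S (RingHom.op g.toRingHom)

def mk (s : S) : RightRes g := s

def val {g : R →ₐ[k] S} (s : RightRes g) : S := s

lemma op_smul_mk (x : R) (s : S) : op x • mk g s = mk g (s * g x) := rfl

instance : IsScalarTower k Rᵐᵒᵖ (RightRes g) where
  smul_assoc c x s := by
    change s.val * g (c • x.unop) = c • (s.val * g x.unop)
    rw [map_smul, mul_smul_comm]

instance [Module.Finite k R] [Module.Finite k S] :
    Module.FinitePresentation Rᵐᵒᵖ (RightRes g) := by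
  have h1 : Module.Finite k Rᵐᵒᵖ :=
    Module.Finite.equiv (MulOpposite.opLinearEquiv k : R ≃ₗ[k] Rᵐᵒᵖ)
  have h2 : IsNoetherianRing Rᵐᵒᵖ := isNoetherian_of_tower k inferInstance
  have h3 : Module.Finite k (RightRes g) := inferInstanceAs (Module.Finite k S)
  have h4 : Module.Finite Rᵐᵒᵖ (RightRes g) := Module.Finite.of_restrictScalars_finite k _ _
  exact Module.finitePresentation_of_finite _ _

/-- An algebra homomorphism `h : S → S'` under `R` is a homomorphism of right `R`-modules. -/
def map {g : R →ₐ[k] S} {g' : R →ₐ[k] S'} (h : S →ₐ[k] S') (hg : h.comp g = g') :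
    RightRes g →ₗ[Rᵐᵒᵖ] RightRes g' where
  toFun s := mk g' (h s.val)
  map_add' a b := map_add h a.val b.val
  map_smul' x s := by
    subst hg
    exact map_mul h s.val (g x.unop)

/-- Left multiplication by `s : S` is an endomorphism of the right `R`-module `S`. -/
def mulLeft (s : S) : RightRes g →ₗ[Rᵐᵒᵖ] RightRes g where
  toFun a := mk g (s * a.val)
  map_add' a b := mul_add s a.val b.val
  map_smul' x a := (mul_assoc s a.val (g x.unop)).symm

end RightRes

/-! ### Tensor products `N ⊗_R F` with an object of an abelian category -/

section Tensor

variable {k : Type uk} [Field k] {A : Type u} [Category.{v} A] [Abelian A] [Linear k A]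
  {R : Type t} [Ring R] [Algebra k R] {F : A} (ρ : R →ₐ[k] End F)

section Obj

variable (N : Type t') [AddCommGroup N] [Module Rᵐᵒᵖ N]

/-- A finite presentation `R^m → R^n → N → 0` of a right `R`-module. -/
structure Pres (R : Type t) [Ring R] (N : Type t') [AddCommGroup N] [Module Rᵐᵒᵖ N] where
  n : ℕ
  m : ℕ
  f : (Fin n → Rᵐᵒᵖ) →ₗ[Rᵐᵒᵖ] N
  g : (Fin m → Rᵐᵒᵖ) →ₗ[Rᵐᵒᵖ] (Fin n → Rᵐᵒᵖ)
  surj : Function.Surjective f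
  exact : Function.Exact g f

variable [Module.FinitePresentation Rᵐᵒᵖ N]

instance : Nonempty (Pres R N) := by
  obtain ⟨n, m, f, g, h1, h2⟩ := Module.FinitePresentation.exists_fin' Rᵐᵒᵖ N
  exact ⟨⟨n, m, f, g, h1, h2⟩⟩

/-- A chosen finite presentation. -/
def pres : Pres R N := Classical.arbitrary _

variable {N}

/-- The morphism `F → F^n` defined by an element of `R^n`. -/
def freeMk {n : ℕ} : (Fin n → Rᵐᵒᵖ) →+ (F ⟶ ⨁ fun _ : Fin n => F) where
  toFun x := biproduct.lift fun j => (ρ (unop (x j)) : F ⟶ F)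
  map_zero' := by ext j; simp
  map_add' x y := by ext j; simp

lemma freeMk_smul {n : ℕ} (a : R) (x : Fin n → Rᵐᵒᵖ) :
    freeMk ρ (op a • x) = (ρ a : F ⟶ F) ≫ freeMk ρ x := by
  apply biproduct.hom_ext; intro j
  simp [freeMk]

lemma freeMk_single {n : ℕ} (j : Fin n) :
    freeMk ρ (Pi.single j 1) = biproduct.ι (fun _ : Fin n => F) j := by
  apply biproduct.hom_ext; intro j'
  by_cases h : j = j'
  · subst h
    simp [freeMk]
  · simp [freeMk, biproduct.ι_π_ne _ h, Pi.single_eq_of_ne (Ne.symm h)]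

/-- The morphism `F^m → F^n` defined by the matrix of `R^m → R^n`. -/
def presMap (P : Pres R N) : (⨁ fun _ : Fin P.m => F) ⟶ (⨁ fun _ : Fin P.n => F) :=
  biproduct.matrix fun i j => (ρ (unop (P.g (Pi.single i 1) j)) : F ⟶ F)

variable (N) in
/-- The tensor product `N ⊗_R F` of a right `R`-module `N` (finitely presented) with an object
`F` on which `R` acts from the left: the cokernel of `F^m → F^n` for a presentation
`R^m → R^n → N → 0`. -/
def tensor : A := cokernel (presMap ρ (pres N))

variable (N) in
/-- The projection `F^n → N ⊗_R F`. -/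
def tensorπ : (⨁ fun _ : Fin (pres (R := R) N).n => F) ⟶ tensor ρ N :=
  cokernel.π (presMap ρ (pres N))

instance : Epi (tensorπ ρ N) := inferInstanceAs (Epi (cokernel.π (presMap ρ (pres N))))

lemma freeMk_rel (x : Fin (pres (R := R) N).n → Rᵐᵒᵖ) (hx : (pres (R := R) N).f x = 0) :
    freeMk ρ x ≫ tensorπ ρ N = 0 := by
  obtain ⟨y, rfl⟩ := ((pres (R := R) N).exact x).1 hx
  rw [pi_eq_sum_univ' y, map_sum, map_sum, Preadditive.sum_comp]
  refine Finset.sum_eq_zero fun i _ => ?_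
  have h : freeMk ρ ((pres (R := R) N).g (Pi.single i 1)) =
      biproduct.ι (fun _ : Fin (pres (R := R) N).m => F) i ≫ presMap ρ (pres N) := by
    rw [presMap, biproduct.ι_matrix]; rfl
  have h' : presMap ρ (pres N) ≫ tensorπ ρ N = 0 := cokernel.condition _
  rw [map_smul, ← op_unop (y i), freeMk_smul, Category.assoc, h, Category.assoc, h',
    comp_zero, comp_zero]

variable (N) in
/-- The morphism `n ⊗ - : F → N ⊗_R F` defined by an element `n` of `N`. -/
def tensorMk : N →+ (F ⟶ tensor ρ N) :=
  AddMonoidHom.mk'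
    (fun n => freeMk ρ (Function.surjInv (pres (R := R) N).surj n) ≫ tensorπ ρ N) (by
    intro a b
    rw [← Preadditive.add_comp, ← map_add, ← sub_eq_zero, ← Preadditive.sub_comp, ← map_sub]
    apply freeMk_rel
    simp only [map_sub, map_add, Function.surjInv_eq, sub_self])

lemma tensorMk_f (x : Fin (pres (R := R) N).n → Rᵐᵒᵖ) :
    tensorMk ρ N ((pres (R := R) N).f x) = freeMk ρ x ≫ tensorπ ρ N := by
  change freeMk ρ (Function.surjInv (pres (R := R) N).surj _) ≫ tensorπ ρ N = _
  rw [← sub_eq_zero, ← Preadditive.sub_comp, ← map_sub]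
  apply freeMk_rel
  simp only [map_sub, Function.surjInv_eq, sub_self]

/-- `(n a) ⊗ - = n ⊗ (a -)`. -/
lemma tensorMk_smul (a : R) (n : N) :
    tensorMk ρ N (op a • n) = (ρ a : F ⟶ F) ≫ tensorMk ρ N n := by
  obtain ⟨x, rfl⟩ := (pres (R := R) N).surj n
  rw [← map_smul, tensorMk_f, tensorMk_f, freeMk_smul, Category.assoc]

lemma tensor_hom_ext {X : A} {f g : tensor ρ N ⟶ X}
    (h : ∀ n, tensorMk ρ N n ≫ f = tensorMk ρ N n ≫ g) : f = g := by
  rw [← cancel_epi (tensorπ ρ N)]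
  apply biproduct.hom_ext'
  intro j
  have := h ((pres (R := R) N).f (Pi.single j 1))
  rwa [tensorMk_f, freeMk_single, Category.assoc, Category.assoc] at this

set_option linter.unusedSectionVars false in
lemma freeMk_desc (P : Pres R N) {X : A} (α : N →+ (F ⟶ X))
    (hα : ∀ (a : R) (n : N), α (op a • n) = (ρ a : F ⟶ F) ≫ α n) (x : Fin P.n → Rᵐᵒᵖ) :
    freeMk ρ x ≫ biproduct.desc (fun j : Fin P.n => α (P.f (Pi.single j 1))) = α (P.f x) := by
  change biproduct.lift _ ≫ _ = _
  rw [biproduct.lift_desc]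
  conv_rhs => rw [pi_eq_sum_univ' x, map_sum, map_sum]
  refine Finset.sum_congr rfl fun j _ => ?_
  rw [map_smul, ← hα, op_unop]

/-- The universal property of `N ⊗_R F`: a family of morphisms `α n : F → X`, additive in `n` and
with `α (n a) = α n ∘ a`, factors through `N ⊗_R F`. -/
def tensorDesc {X : A} (α : N →+ (F ⟶ X))
    (hα : ∀ (a : R) (n : N), α (op a • n) = (ρ a : F ⟶ F) ≫ α n) : tensor ρ N ⟶ X :=
  cokernel.desc (presMap ρ (pres N))
    (biproduct.desc fun j => α ((pres (R := R) N).f (Pi.single j 1))) (by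
    apply biproduct.hom_ext'
    intro i
    have h : freeMk ρ ((pres (R := R) N).g (Pi.single i 1)) =
        biproduct.ι (fun _ : Fin (pres (R := R) N).m => F) i ≫ presMap ρ (pres N) := by
      rw [presMap, biproduct.ι_matrix]; rfl
    rw [← Category.assoc, ← h, freeMk_desc ρ (pres N) α hα,
      (pres (R := R) N).exact.apply_apply_eq_zero, map_zero, comp_zero])

lemma tensorMk_desc {X : A} (α : N →+ (F ⟶ X))
    (hα : ∀ (a : R) (n : N), α (op a • n) = (ρ a : F ⟶ F) ≫ α n) (n : N) :
    tensorMk ρ N n ≫ tensorDesc ρ α hα = α n := by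
  obtain ⟨x, rfl⟩ := (pres (R := R) N).surj n
  have h : tensorπ ρ N ≫ tensorDesc ρ α hα =
      biproduct.desc fun j => α ((pres (R := R) N).f (Pi.single j 1)) := cokernel.π_desc _ _ _
  rw [tensorMk_f, Category.assoc, h, freeMk_desc ρ _ α hα]

end Obj

variable {N₁ : Type t'} [AddCommGroup N₁] [Module Rᵐᵒᵖ N₁] [Module.FinitePresentation Rᵐᵒᵖ N₁]
  {N₂ : Type t'} [AddCommGroup N₂] [Module Rᵐᵒᵖ N₂] [Module.FinitePresentation Rᵐᵒᵖ N₂]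

/-- The morphism `N₁ ⊗_R F → N₂ ⊗_R F` induced by a homomorphism of right modules: the unique
morphism carrying `n ⊗ -` to `f n ⊗ -`. -/
def tensorMap (f : N₁ →ₗ[Rᵐᵒᵖ] N₂) : tensor ρ N₁ ⟶ tensor ρ N₂ :=
  tensorDesc ρ ((tensorMk ρ N₂).comp f.toAddMonoidHom) (fun a n => by
    change tensorMk ρ N₂ (f (op a • n)) = ρ a ≫ tensorMk ρ N₂ (f n)
    rw [map_smul, tensorMk_smul])

lemma tensorMk_map (f : N₁ →ₗ[Rᵐᵒᵖ] N₂) (n : N₁) :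
    tensorMk ρ N₁ n ≫ tensorMap ρ f = tensorMk ρ N₂ (f n) := tensorMk_desc ρ _ _ n

lemma tensorMap_comp_zero {N₃ : Type t'} [AddCommGroup N₃] [Module Rᵐᵒᵖ N₃]
    [Module.FinitePresentation Rᵐᵒᵖ N₃] (f : N₁ →ₗ[Rᵐᵒᵖ] N₂) (g : N₂ →ₗ[Rᵐᵒᵖ] N₃)
    (h : Function.Exact f g) : tensorMap ρ f ≫ tensorMap ρ g = 0 := by
  apply tensor_hom_ext
  intro n
  rw [← Category.assoc, tensorMk_map, tensorMk_map, h.apply_apply_eq_zero, map_zero, comp_zero]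

/-- `F` is flat over `R`: `- ⊗_R F` carries short exact sequences of (finitely presented) right
`R`-modules to short exact sequences in `A`. -/
def IsFlat : Prop :=
  ∀ (N₁ N₂ N₃ : Type t) [AddCommGroup N₁] [AddCommGroup N₂] [AddCommGroup N₃]
    [Module Rᵐᵒᵖ N₁] [Module Rᵐᵒᵖ N₂] [Module Rᵐᵒᵖ N₃]
    [Module.FinitePresentation Rᵐᵒᵖ N₁] [Module.FinitePresentation Rᵐᵒᵖ N₂]
    [Module.FinitePresentation Rᵐᵒᵖ N₃]
    (f : N₁ →ₗ[Rᵐᵒᵖ] N₂) (g : N₂ →ₗ[Rᵐᵒᵖ] N₃) (_ : Function.Injective f)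
    (h : Function.Exact f g) (_ : Function.Surjective g),
    (ShortComplex.mk (tensorMap ρ f) (tensorMap ρ g)
      (tensorMap_comp_zero ρ f g h)).ShortExact

end Tensor

/-! ### Deformations -/

/-- The tautological left action of the endomorphism ring of `X` on `X`. -/
def Art.taut {k : Type uk} [Field k] {A : Type u} [Category.{v} A] [Abelian A] [Linear k A] {r : ℕ}
    {X : A} (S : ArtStr k r (End X)) : Art.of S →ₐ[k] End X := AlgHom.id k (End X)

section Deformations

variable {k : Type uk} [Field k] {A : Type u} [Category.{v} A] [Abelian A] [Linear k A] {r : ℕ}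

/-- `R / M` as a right `R`-module. -/
abbrev ResM (R : Art.{uk, t} k r) : Type t := RightRes (Ideal.Quotient.mkₐ k R.M)

/-- `R / M_i` as a right `R`-module. -/
abbrev ResMi (R : Art.{uk, t} k r) (i : Fin r) : Type t := RightRes (Ideal.Quotient.mkₐ k (R.Mi i))

/-- The projection `R / M → R / M_i`. -/
def resProj (R : Art.{uk, t} k r) (i : Fin r) : ResM R →ₗ[(R : Type t)ᵐᵒᵖ] ResMi R i :=
  RightRes.map (Ideal.Quotient.factorₐ k (R.M_le_Mi i)) rfl

/-- `(X, φ)` is an `r`-pointed NC deformation of `{F_i}` over `R`: the left `R`-module structure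
`ρ` on `X` is flat, and `φ : R / M ⊗_R X ≅ ⨁ F_i` induces isomorphisms
`R / M_i ⊗_R X ≅ F_i` for all `i`. -/
structure IsDeformation (R : Art.{uk, t} k r) (F : Fin r → A) (X : A) (ρ : R →ₐ[k] End X)
    (φ : tensor ρ (ResM R) ≅ ⨁ F) : Prop where
  flat : IsFlat ρ
  induces : ∀ i, ∃ φi : tensor ρ (ResMi R i) ≅ F i,
    φ.hom ≫ biproduct.π F i = tensorMap ρ (resProj R i) ≫ φi.hom

/-- An `r`-pointed NC deformation of the collection `{F_i}` over `R`. -/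
structure Deformation (R : Art.{uk, t} k r) (F : Fin r → A) where
  X : A
  ρ : R →ₐ[k] End X
  φ : tensor ρ (ResM R) ≅ ⨁ F
  isDeformation : IsDeformation R F X ρ φ

/-- The composite `X = R ⊗_R X → R / M ⊗_R X ≅ ⨁ F_i`. -/
def Deformation.toSum {R : Art.{uk, t} k r} {F : Fin r → A} (D : Deformation R F) :
    D.X ⟶ ⨁ F :=
  tensorMk D.ρ (ResM R) (RightRes.mk _ 1) ≫ D.φ.hom

/-- `D' ≅ S ⊗_R D` as deformations over `S`, for a morphism `g : R → S` of `(Art_r)`: there is an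
isomorphism `S ⊗_R X ≅ X'` which is linear over `S` and compatible with the isomorphisms `φ`
(as `R / M → S / M` is an isomorphism, the isomorphism
`S / M ⊗_S (S ⊗_R X) ≅ R / M ⊗_R X ≅ ⨁ F_i` defining `S ⊗_R D` is the one for which the
composite `X → S ⊗_R X → S / M ⊗_S (S ⊗_R X) ≅ ⨁ F_i` is `D.toSum`). -/
def IsBaseChange {R : Art.{uk, t} k r} {S : Art.{uk, t'} k r} {F : Fin r → A} (g : Art.Hom R S)
    (D : Deformation R F) (D' : Deformation S F) : Prop :=
  ∃ θ : tensor D.ρ (RightRes g.toAlgHom) ≅ D'.X,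
    (∀ s : S, tensorMap D.ρ (RightRes.mulLeft g.toAlgHom s) ≫ θ.hom =
      θ.hom ≫ (show D'.X ⟶ D'.X from D'.ρ s)) ∧
    tensorMk D.ρ (RightRes g.toAlgHom) (RightRes.mk _ 1) ≫ θ.hom ≫ D'.toSum = D.toSum

/-- The composite `R (n + d) → R n` of the transition homomorphisms. -/
def transition {R : ℕ → Art.{uk, t} k r} (f : ∀ n, Art.Hom (R (n + 1)) (R n)) (n : ℕ) :
    ∀ d, Art.Hom (R (n + d)) (R n)
  | 0 => Art.Hom.id (R n)
  | d + 1 => (f (n + d)).comp (transition f n d)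

/-- A sequence of deformations `D n` over `R n`, with transition homomorphisms
`f n : R (n + 1) → R n`, is a versal deformation of `{F_i}`: every deformation is induced from some `D n`, and from some
`n` on the spaces `M_n / M_n ^ 2` are constant and the map `dg` is the same for all morphisms `g`
inducing a given deformation. The test rings live in the universe `t'`. -/
structure IsVersal (F : Fin r → A) (R : ℕ → Art.{uk, t} k r) (D : ∀ n, Deformation (R n) F)
    (f : ∀ n, Art.Hom (R (n + 1)) (R n)) : Prop where
  surjective : ∀ n, Function.Surjective (f n).toAlgHom
  baseChange : ∀ n, IsBaseChange (f n) (D (n + 1)) (D n)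
  exists_hom : ∀ (S : Art.{uk, t'} k r) (D' : Deformation S F),
    ∃ n : ℕ, 0 < n ∧ ∃ g : Art.Hom (R n) S, IsBaseChange g (D n) D'
  tangent : ∃ n : ℕ, 0 < n ∧
    (∀ d, Function.Bijective (transition f n d).cotangentMap) ∧
    ∀ (d : ℕ) (S : Art.{uk, t'} k r) (D' : Deformation S F) (g g' : Art.Hom (R (n + d)) S),
      IsBaseChange g (D (n + d)) D' → IsBaseChange g' (D (n + d)) D' →
      g.cotangentMap = g'.cotangentMap

end Deformations

/-! ### Simple collections and universal extensions -/

section Universal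

variable (k : Type uk) [Field k] {A : Type u} [Category.{v} A] [Abelian A] [Linear k A] {r : ℕ}

/-- `{F_i}` is a simple collection: `dim Hom(F_i, F_j) = δ_{ij}`. -/
def IsSimpleCollection (F : Fin r → A) : Prop :=
  ∀ i j, Module.rank k (F i ⟶ F j) = if i = j then 1 else 0

variable [HasExt.{w} A]

/-- `p : E → G` is the universal extension
`0 → ⨁_j Ext¹(G, F_j)^* ⊗ F_j → E → G → 0` of `G` by `{F_i}`. The kernel is written in terms of
bases `b j` of the (finite-dimensional) spaces `Ext¹(G, F_j)`: for every `j` it has one copy of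
`F_j` for each element of the dual basis. That the class of the extension is the canonical element
of `⨁_j Ext¹(G, F_j) ⊗ Ext¹(G, F_j)^*` means that its component at the `l`-th copy of `F_j`
is `b j l`. -/
def IsUniversalExtension (F : Fin r → A) {E G : A} (p : E ⟶ G) : Prop :=
  ∃ (m : Fin r → ℕ) (b : ∀ j, Module.Basis (Fin (m j)) k (Abelian.Ext.{w} G (F j) 1))
    (ι : (⨁ fun a : (Σ j : Fin r, Fin (m j)) => F a.1) ⟶ E) (zero : ι ≫ p = 0)
    (h : (ShortComplex.mk ι p zero).ShortExact),
    ∀ (j : Fin r) (l : Fin (m j)),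
      h.extClass.comp (Abelian.Ext.mk₀
        (biproduct.π (fun a : (Σ j : Fin r, Fin (m j)) => F a.1) ⟨j, l⟩)) (add_zero 1) = b j l

/-- A tower of universal extensions of the collection `{F_i}`: `F_i^{(0)} = F_i`, and
`F_i^{(n+1)}` is the universal extension of `F_i^{(n)}` by the collection. -/
structure UniversalTower (F : Fin r → A) where
  /-- the object `F_i^{(n)}` -/
  obj : ℕ → Fin r → A
  base : ∀ i, obj 0 i ≅ F i
  p : ∀ n i, obj (n + 1) i ⟶ obj n i
  universal : ∀ n i, IsUniversalExtension.{w} k F (p n i)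

namespace UniversalTower

variable {k} {F : Fin r → A} (T : UniversalTower.{w} k F)

/-- The object `F^{(n)} = ⨁ F_i^{(n)}`. -/
def sum (n : ℕ) : A := ⨁ T.obj n

/-- The idempotent endomorphism `F^{(n)} → F_i^{(n)} → F^{(n)}`. -/
def idem (n : ℕ) (i : Fin r) : End (T.sum n) :=
  End.of (biproduct.π (T.obj n) i ≫ biproduct.ι (T.obj n) i)

/-- The projection `F^{(n+1)} → F^{(n)}`. -/
def proj (n : ℕ) : T.sum (n + 1) ⟶ T.sum n := biproduct.map (T.p n)

/-- The composite projection `F^{(n)} → F^{(0)} ≅ F`. -/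
def toBase : ∀ n, T.sum n ⟶ ⨁ F
  | 0 => biproduct.map fun i => (T.base i).hom
  | n + 1 => T.proj n ≫ toBase n

end UniversalTower

end Universal

end NCDef

end

noncomputable section

/-! ### Realization of classes in `Ext¹` by extensions -/

section Realization

open Pretriangulated DerivedCategory Triangulated

variable {A : Type u} [Category.{v} A] [Abelian A]

/-! Write `Y = ⨁ F` and `P n` for the n-th object of the tower. Two properties of a universal
extension `p : E ⟶ G` carry everything: every map from `E` to some `F j` factors through `p`, and
`p` kills `Ext¹(G, F j)`. They come from the linear independence and from the spanning of the
components of the canonical class. Summed over the collection they make the tower an `IsProjTower`.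
Such towers exist because long exact sequences keep the `Ext¹` spaces finite-dimensional and every
class in `Ext¹` is realized by an extension.

Consider objects with a filtration whose quotients are summands of powers of `Y` (`Filt`). By
dévissage `P n`, itself of length `n + 1`, behaves like a projective generator among those of length
at most `n + 1` (`exists_fac_of_filt`, `exists_lift`). Hence, as in Morita theory, with `R = End (P
n)` the evaluation `Hom(P n, X) ⊗_R P n ⟶ X` is an isomorphism for all such `X`
(`IsProjTower.isIso_ev`). The simple right `R`-modules are the `R / M_i`, and `R / M_i` is presented
by `Hom(P n, K_i) → R`, where `K_i` is the kernel of `P n ⟶ F i`. Tensoring with `P n` gives back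
the monomorphism `K_i ⟶ P n`, so `Tor₁` vanishes on simple modules and `P n` is flat. The same
evaluation gives `R / M ⊗ P n ≅ ⨁ F`.

For versality, let `X` be a deformation over `S` with `M ^ (n + 1) = 0`. By flatness `X` is filtered
by its `M`-adic quotients, so `P n ⟶ ⨁ F` lifts to some `f : P n ⟶ X`, and `s ↦ s f` is a bijection
from `S` to `Hom(P n, X)` (`action_bijective`). The equation `f x = g(x) f` then defines `g : R →
S`, and evaluation gives `S ⊗_R P n ≅ X`. Two lifts differ by some `s ∈ 1 + M`, whence `s g(x) =
g'(x) s` and `g ≡ g'` modulo `M²` on `M`. Finally, `P (n + 1) / M² P (n + 1)` has length 2, so for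
`n ≥ 1` the projection to it factors through `P n`. The kernel of the transition map therefore lies
in `M²`, and the tangent spaces are constant from stage 1 on. -/

lemma shortExact_of_distinguished [HasDerivedCategory.{w} A] {K E G : A} (f : K ⟶ E) (g : E ⟶ G)
    (δ : (singleFunctor A 0).obj G ⟶ ((singleFunctor A 0).obj K)⟦(1 : ℤ)⟧)
    (hT : Triangle.mk ((singleFunctor A 0).map f) ((singleFunctor A 0).map g) δ ∈
      distTriang (DerivedCategory A)) :
    ∃ (zero : f ≫ g = 0) (h : (ShortComplex.mk f g zero).ShortExact), h.singleδ = δ := by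
  have zero : f ≫ g = 0 := (singleFunctor A 0).map_injective (by
    rw [Functor.map_comp, Functor.map_zero]
    exact comp_distTriang_mor_zero₁₂ _ hT)
  -- A map into `K` killed by `f` factors through `G[-1]`, which lies in degrees at least 1 and
  -- receives no nonzero map from an object of the heart. The epimorphism below is dual, with `K[1]`
  -- in degrees at most -1.
  have hmono : Mono f := Preadditive.mono_of_cancel_zero _ fun {W} q hq => by
    obtain ⟨a, ha⟩ := Triangle.coyoneda_exact₂ _ (inv_rot_of_distTriang _ hT)
      ((singleFunctor A 0).map q) (by
        change (singleFunctor A 0).map q ≫ (singleFunctor A 0).map f = 0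
        rw [← Functor.map_comp, hq, Functor.map_zero])
    have h1 : TStructure.t.IsGE (((singleFunctor A 0).obj G)⟦(-1 : ℤ)⟧) 1 :=
      TStructure.t.isGE_shift _ 0 (-1) 1
    have h0 : a = 0 := TStructure.t.zero_of_isLE_of_isGE a 0 1 (by lia) inferInstance h1
    apply (singleFunctor A 0).map_injective
    rw [ha, h0, zero_comp, Functor.map_zero]; rfl
  have hepi : Epi g := Preadditive.epi_of_cancel_zero _ fun {W} q hq => by
    obtain ⟨a, ha⟩ := Triangle.yoneda_exact₃ _ hT ((singleFunctor A 0).map q) (by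
        change (singleFunctor A 0).map g ≫ (singleFunctor A 0).map q = 0
        rw [← Functor.map_comp, hq, Functor.map_zero])
    have h1 : TStructure.t.IsLE (((singleFunctor A 0).obj K)⟦(1 : ℤ)⟧) (-1) :=
      TStructure.t.isLE_shift _ 0 1 (-1)
    have h0 : a = 0 := TStructure.t.zero_of_isLE_of_isGE a (-1) 0 (by lia) h1 inferInstance
    apply (singleFunctor A 0).map_injective
    rw [ha, h0, comp_zero, Functor.map_zero]; rfl
  have hlift : ∀ {W : A} (q : W ⟶ E), q ≫ g = 0 → ∃ l : W ⟶ K, l ≫ f = q := fun {W} q hq => by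
    obtain ⟨a, ha⟩ := Triangle.coyoneda_exact₂ _ hT ((singleFunctor A 0).map q) (by
        change (singleFunctor A 0).map q ≫ (singleFunctor A 0).map g = 0
        rw [← Functor.map_comp, hq, Functor.map_zero])
    obtain ⟨l, rfl⟩ := (singleFunctor A 0).map_surjective a
    exact ⟨l, (singleFunctor A 0).map_injective (by rw [Functor.map_comp]; exact ha.symm)⟩
  have hex : (ShortComplex.mk f g zero).ShortExact :=
    { exact := ShortComplex.exact_of_f_is_kernel _ (KernelFork.IsLimit.ofι _ _
        (fun q hq => (hlift q hq).choose) (fun q hq => (hlift q hq).choose_spec)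
        (fun q hq m hm => by rw [← cancel_mono f, hm, (hlift q hq).choose_spec]))
      mono_f := hmono
      epi_g := hepi }
  refine ⟨zero, hex, ?_⟩
  -- The identities of `K` and `E` extend to a morphism between the two triangles. Its third
  -- component fixes the epimorphism `g`, hence is the identity, and so the connecting maps agree.
  obtain ⟨c, hc₁, hc₂⟩ := complete_distinguished_triangle_morphism _ _
    hex.singleTriangle_distinguished hT (𝟙 _) (𝟙 _) (by
      change (singleFunctor A 0).map f ≫ 𝟙 _ = 𝟙 _ ≫ (singleFunctor A 0).map f
      simp)
  obtain ⟨c', rfl⟩ := (singleFunctor A 0).map_surjective c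
  have h1 : g ≫ c' = g := (singleFunctor A 0).map_injective (by
    rw [Functor.map_comp]
    exact hc₁.trans (Category.id_comp _))
  have h2 : c' = 𝟙 _ := by rw [← cancel_epi g, h1]; simp
  subst h2
  have h3 : hex.singleδ ≫ (𝟙 ((singleFunctor A 0).obj K))⟦(1 : ℤ)⟧' =
    (singleFunctor A 0).map (𝟙 G) ≫ δ := hc₂
  simpa using h3

/-- The class is a morphism `G ⟶ K[1]` of the derived category. In the triangle it completes to, the
middle term is an extension of objects of the heart, so it lies in the heart. -/
lemma exists_shortExact_extClass [HasExt.{w} A] {G K : A} (α : Abelian.Ext.{w} G K 1) :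
    ∃ (E : A) (f : K ⟶ E) (g : E ⟶ G) (zero : f ≫ g = 0)
      (h : (ShortComplex.mk f g zero).ShortExact), h.extClass = α := by
  let := HasDerivedCategory.standard A
  obtain ⟨Y, a, b, hT⟩ := distinguished_cocone_triangle₂ (C := DerivedCategory A)
    (X := (singleFunctor A 0).obj K) (Z := (singleFunctor A 0).obj G) α.hom
  have h1 : TStructure.t.IsLE Y 0 := TStructure.t.isLE₂ _ hT 0
    (inferInstanceAs (((singleFunctor A 0).obj K).IsLE 0))
    (inferInstanceAs (((singleFunctor A 0).obj G).IsLE 0))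
  have h2 : TStructure.t.IsGE Y 0 := TStructure.t.isGE₂ _ hT 0
    (inferInstanceAs (((singleFunctor A 0).obj K).IsGE 0))
    (inferInstanceAs (((singleFunctor A 0).obj G).IsGE 0))
  obtain ⟨E, ⟨e⟩⟩ := exists_iso_singleFunctor_obj_of_isGE_of_isLE Y 0
  obtain ⟨f, hf⟩ := (singleFunctor A 0).map_surjective (a ≫ e.hom)
  obtain ⟨g, hg⟩ := (singleFunctor A 0).map_surjective (e.inv ≫ b)
  have hT' : Triangle.mk ((singleFunctor A 0).map f) ((singleFunctor A 0).map g) α.hom ∈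
      distTriang (DerivedCategory A) := by
    refine isomorphic_distinguished _ hT _
      (Triangle.isoMk _ _ (Iso.refl _) e.symm (Iso.refl _) ?_ ?_ ?_)
    · change (singleFunctor A 0).map f ≫ e.inv = 𝟙 _ ≫ a
      simp [hf]
    · change (singleFunctor A 0).map g ≫ 𝟙 _ = e.inv ≫ b
      simp [hg]
    · change α.hom ≫ (𝟙 ((singleFunctor A 0).obj K))⟦(1 : ℤ)⟧' = 𝟙 _ ≫ α.hom
      simp
  obtain ⟨zero, h, hδ⟩ := shortExact_of_distinguished f g _ hT'
  exact ⟨E, f, g, zero, h, by ext; rw [h.extClass_hom, hδ]⟩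

end Realization

/-! ### Simple collections and universal extensions -/

namespace NCDef

variable {k : Type uk} [Field k] {A : Type u} [Category.{v} A] [Abelian A] [Linear k A] {r : ℕ}
  {F : Fin r → A}

namespace IsSimpleCollection

lemma id_ne_zero (hF : IsSimpleCollection k F) (i : Fin r) : 𝟙 (F i) ≠ 0 := by
  intro h
  have h1 := hF i i
  have : Subsingleton (F i ⟶ F i) :=
    ⟨fun f g => by rw [← Category.comp_id f, ← Category.comp_id g, h, comp_zero, comp_zero]⟩
  rw [if_pos rfl, rank_subsingleton'] at h1
  exact zero_ne_one h1

lemma eq_zero (hF : IsSimpleCollection k F) {i j : Fin r} (h : i ≠ j) (f : F i ⟶ F j) :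
    f = 0 := by
  have h1 := hF i j
  rw [if_neg h, rank_zero_iff] at h1
  exact Subsingleton.elim _ _

lemma exists_smul (hF : IsSimpleCollection k F) (i : Fin r) (f : F i ⟶ F i) :
    ∃ c : k, f = c • 𝟙 (F i) := by
  have h1 := hF i i
  rw [if_pos rfl] at h1
  have h2 : Module.finrank k (F i ⟶ F i) = 1 := by
    rw [Module.finrank, h1, Cardinal.one_toNat]
  obtain ⟨c, hc⟩ := (finrank_eq_one_iff_of_nonzero' _ (hF.id_ne_zero i)).1 h2 f
  exact ⟨c, hc.symm⟩

lemma smul_injective (hF : IsSimpleCollection k F) (i : Fin r) {c d : k}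
    (h : c • 𝟙 (F i) = d • 𝟙 (F i)) : c = d :=
  smul_left_injective k (hF.id_ne_zero i) h

lemma exists_eq_map (hF : IsSimpleCollection k F) (f : ⨁ F ⟶ ⨁ F) :
    ∃ c : Fin r → k, f = biproduct.map fun i => c i • 𝟙 (F i) := by
  choose c hc using fun i => hF.exists_smul i (biproduct.ι F i ≫ f ≫ biproduct.π F i)
  refine ⟨c, ?_⟩
  apply biproduct.hom_ext
  intro j
  apply biproduct.hom_ext'
  intro i
  rw [biproduct.map_π, biproduct.ι_π_assoc]
  by_cases h : i = j
  · subst h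
    simp [hc]
  · rw [dif_neg h, zero_comp]
    exact hF.eq_zero h _

end IsSimpleCollection

/-! ### Finiteness of `Ext¹` and the two key properties of universal extensions -/

section Ext

variable [HasExt.{w} A]

lemma finite_ext_of_retract {X X' Y Y' : A} (n : ℕ) (s : X' ⟶ X) (u : X ⟶ X') (hsu : s ≫ u = 𝟙 X')
    (s' : Y' ⟶ Y) (u' : Y ⟶ Y') (hsu' : s' ≫ u' = 𝟙 Y')
    [Module.Finite k (Abelian.Ext.{w} X Y n)] : Module.Finite k (Abelian.Ext.{w} X' Y' n) := by
  let f : Abelian.Ext.{w} X Y n →ₗ[k] Abelian.Ext.{w} X' Y' n :=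
    (Abelian.Ext.precompOfLinear (Abelian.Ext.mk₀ s) k Y' (zero_add n)).comp
      (Abelian.Ext.postcompOfLinear (Abelian.Ext.mk₀ u') k X (add_zero n))
  refine Module.Finite.of_surjective f fun e => ?_
  refine ⟨(Abelian.Ext.mk₀ u).comp (e.comp (Abelian.Ext.mk₀ s') (add_zero n)) (zero_add n), ?_⟩
  change (Abelian.Ext.mk₀ s).comp (((Abelian.Ext.mk₀ u).comp
    (e.comp (Abelian.Ext.mk₀ s') (add_zero n)) (zero_add n)).comp
      (Abelian.Ext.mk₀ u') (add_zero n)) (zero_add n) = e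
  rw [Abelian.Ext.comp_assoc_of_third_deg_zero, Abelian.Ext.comp_assoc_of_third_deg_zero,
    Abelian.Ext.mk₀_comp_mk₀, hsu', Abelian.Ext.comp_mk₀_id, Abelian.Ext.mk₀_comp_mk₀_assoc,
    hsu, Abelian.Ext.mk₀_id_comp]

lemma finite_ext_biproduct {J : Type} [Fintype J] (X : J → A) (Y : A) (n : ℕ)
    [∀ a, Module.Finite k (Abelian.Ext.{w} (X a) Y n)] :
    Module.Finite k (Abelian.Ext.{w} (⨁ X) Y n) := by
  let f : Abelian.Ext.{w} (⨁ X) Y n →ₗ[k] ∀ a, Abelian.Ext.{w} (X a) Y n :=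
    LinearMap.pi fun a => Abelian.Ext.precompOfLinear (Abelian.Ext.mk₀ (biproduct.ι X a)) k Y
      (zero_add n)
  refine Module.Finite.of_injective f ?_
  rw [injective_iff_map_eq_zero]
  intro e he
  have h1 : ∀ a, (Abelian.Ext.mk₀ (biproduct.ι X a)).comp e (zero_add n) = 0 :=
    fun a => congr_fun he a
  rw [← Abelian.Ext.mk₀_id_comp e, ← biproduct.total, Abelian.Ext.mk₀_sum, Abelian.Ext.sum_comp]
  refine Finset.sum_eq_zero fun a _ => ?_
  rw [← Abelian.Ext.mk₀_comp_mk₀_assoc, h1, Abelian.Ext.comp_zero]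

lemma finite_ext_of_shortExact {S : ShortComplex A} (hS : S.ShortExact) (Y : A) (n : ℕ)
    [Module.Finite k (Abelian.Ext.{w} S.X₁ Y n)] [Module.Finite k (Abelian.Ext.{w} S.X₃ Y n)] :
    Module.Finite k (Abelian.Ext.{w} S.X₂ Y n) := by
  let f := Abelian.Ext.precompOfLinear (Abelian.Ext.mk₀ S.f) k Y (zero_add n)
  let g := Abelian.Ext.precompOfLinear (Abelian.Ext.mk₀ S.g) k Y (zero_add n)
  have hker : LinearMap.ker f ≤ LinearMap.range g := fun e he =>
    Abelian.Ext.contravariant_sequence_exact₂ hS Y e he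
  have h1 : Module.Finite k (LinearMap.ker f) := by
    have : Module.Finite k (LinearMap.range g) := inferInstance
    exact Module.Finite.of_injective (Submodule.inclusion hker) (Submodule.inclusion_injective _)
  have h2 : Module.Finite k (_ ⧸ LinearMap.ker f) :=
    Module.Finite.equiv (LinearMap.quotKerEquivRange f).symm
  exact Module.Finite.of_submodule_quotient (LinearMap.ker f)

variable {E G : A} {p : E ⟶ G}

lemma IsUniversalExtension.epi (hp : IsUniversalExtension.{w} k F p) : Epi p := by
  obtain ⟨m, b, ι, zero, h, hb⟩ := hp
  exact h.epi_g

/-- By simplicity, `f` restricts to the kernel as a vector of scalars `c l` on the copies of `F j`.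
Since this restriction extends to `E`, the extension class pushed forward along it vanishes. That
pushforward is `∑ c l • b j l`, so independence of the basis gives `c = 0`. -/
lemma IsUniversalExtension.exists_fac (hF : IsSimpleCollection k F)
    (hp : IsUniversalExtension.{w} k F p) (j : Fin r) (f : E ⟶ F j) : ∃ g, f = p ≫ g := by
  obtain ⟨m, b, ι, zero, h, hb⟩ := hp
  let K : (Σ j : Fin r, Fin (m j)) → A := fun a => F a.1
  choose c hc using fun l : Fin (m j) =>
    hF.exists_smul j (biproduct.ι K ⟨j, l⟩ ≫ ι ≫ f)
  have h1 : ι ≫ f = ∑ l, c l • biproduct.π K ⟨j, l⟩ := by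
    apply biproduct.hom_ext'
    rintro ⟨i, l⟩
    rw [Preadditive.comp_sum]
    by_cases hij : i = j
    · subst hij
      rw [Finset.sum_eq_single l, Linear.comp_smul, biproduct.ι_π_self]
      · exact hc l
      · intro l' _ hl'
        rw [Linear.comp_smul, biproduct.ι_π_ne, smul_zero]
        intro h'
        exact hl' (eq_of_heq (Sigma.mk.inj h').2).symm
      · simp
    · rw [Finset.sum_eq_zero, hF.eq_zero hij (biproduct.ι K ⟨i, l⟩ ≫ ι ≫ f)]
      intro l' _
      rw [Linear.comp_smul, biproduct.ι_π_ne, smul_zero]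
      intro h'
      exact hij (Sigma.mk.inj h').1
  have h2 : ∑ l, c l • b j l = 0 := by
    have h3 : h.extClass.comp (Abelian.Ext.mk₀ (ι ≫ f)) (add_zero 1) = 0 := by
      rw [← Abelian.Ext.mk₀_comp_mk₀, ← Abelian.Ext.comp_assoc_of_third_deg_zero]
      have := h.extClass_comp
      dsimp only at this
      rw [this, Abelian.Ext.zero_comp]
    rw [h1, Abelian.Ext.mk₀_sum, Abelian.Ext.comp_sum] at h3
    rw [← h3]
    refine Finset.sum_congr rfl fun l _ => ?_
    rw [Abelian.Ext.mk₀_smul, Abelian.Ext.comp_smul]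
    exact congrArg _ (hb j l).symm
  have h3 : ι ≫ f = 0 := by
    rw [h1]
    refine Finset.sum_eq_zero fun l _ => ?_
    rw [Fintype.linearIndependent_iff.1 (b j).linearIndependent c h2 l, zero_smul]
  have := h.epi_g
  exact ⟨h.exact.desc f h3, (h.exact.g_desc f h3).symm⟩

/-- The `b j l` span, each is a pushforward of the extension class, and the extension class vanishes
after pullback along `p`. -/
lemma IsUniversalExtension.comp_ext (hp : IsUniversalExtension.{w} k F p) (j : Fin r)
    (e : Abelian.Ext.{w} G (F j) 1) : (Abelian.Ext.mk₀ p).comp e (zero_add 1) = 0 := by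
  obtain ⟨m, b, ι, zero, h, hb⟩ := hp
  rw [← (b j).sum_repr e, Abelian.Ext.comp_sum]
  refine Finset.sum_eq_zero fun l _ => ?_
  rw [Abelian.Ext.comp_smul, ← hb j l]
  have := h.comp_extClass_assoc (Abelian.Ext.mk₀
    (biproduct.π (fun a : (Σ j : Fin r, Fin (m j)) => F a.1) ⟨j, l⟩)) (add_zero 1)
  dsimp only at this
  rw [this, smul_zero]

variable (k F) in
lemma exists_isUniversalExtension (G : A)
    (hG : ∀ j, Module.Finite k (Abelian.Ext.{w} G (F j) 1)) :
    ∃ (E : A) (p : E ⟶ G), IsUniversalExtension.{w} k F p := by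
  let m : Fin r → ℕ := fun j => Module.finrank k (Abelian.Ext.{w} G (F j) 1)
  let b : ∀ j, Module.Basis (Fin (m j)) k (Abelian.Ext.{w} G (F j) 1) :=
    fun j => Module.finBasis k _
  let K : (Σ j : Fin r, Fin (m j)) → A := fun a => F a.1
  -- The canonical element, written in bases; its projection to the copy `a` is `b a.1 a.2`.
  let α : Abelian.Ext.{w} G (⨁ K) 1 :=
    ∑ a, (b a.1 a.2).comp (Abelian.Ext.mk₀ (biproduct.ι K a)) (add_zero 1)
  obtain ⟨E, f, g, zero, h, hα⟩ := exists_shortExact_extClass α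
  refine ⟨E, g, m, b, f, zero, h, fun j l => ?_⟩
  rw [hα]
  change α.comp (Abelian.Ext.mk₀ (biproduct.π K ⟨j, l⟩)) (add_zero 1) = _
  rw [Abelian.Ext.sum_comp, Finset.sum_eq_single ⟨j, l⟩]
  · rw [Abelian.Ext.comp_assoc_of_third_deg_zero, Abelian.Ext.mk₀_comp_mk₀,
      biproduct.ι_π_self, Abelian.Ext.comp_mk₀_id]
  · intro a _ ha
    rw [Abelian.Ext.comp_assoc_of_third_deg_zero, Abelian.Ext.mk₀_comp_mk₀,
      biproduct.ι_π_ne _ ha, Abelian.Ext.mk₀_zero, Abelian.Ext.comp_zero]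
  · simp

/-- In the long exact sequence `Ext¹(E, F j)` sits between `Ext¹(G, F j)` and `Ext¹` of a finite sum
of copies of the `F i`. This allows the construction to be iterated. -/
lemma IsUniversalExtension.finite_ext (hp : IsUniversalExtension.{w} k F p)
    (hFF : ∀ i j, Module.Finite k (Abelian.Ext.{w} (F i) (F j) 1))
    (hG : ∀ j, Module.Finite k (Abelian.Ext.{w} G (F j) 1)) (j : Fin r) :
    Module.Finite k (Abelian.Ext.{w} E (F j) 1) := by
  obtain ⟨m, b, ι, zero, h, hb⟩ := hp
  have := hG j
  have : Module.Finite k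
      (Abelian.Ext.{w} (⨁ fun a : (Σ j : Fin r, Fin (m j)) => F a.1) (F j) 1) :=
    finite_ext_biproduct _ _ _
  exact finite_ext_of_shortExact h (F j) 1

lemma finite_ext_component (hExt : Module.Finite k (Abelian.Ext.{w} (⨁ F) (⨁ F) 1))
    (i j : Fin r) : Module.Finite k (Abelian.Ext.{w} (F i) (F j) 1) :=
  finite_ext_of_retract 1 (biproduct.ι F i) (biproduct.π F i) (biproduct.ι_π_self F i)
    (biproduct.ι F j) (biproduct.π F j) (biproduct.ι_π_self F j)

lemma nonempty_universalTower (hExt : Module.Finite k (Abelian.Ext.{w} (⨁ F) (⨁ F) 1)) :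
    Nonempty (UniversalTower.{w} k F) := by
  have hFF := finite_ext_component hExt
  -- Finiteness travels with the object, so that the recursion can form the next universal
  -- extension.
  let Good := {G : A // ∀ j, Module.Finite k (Abelian.Ext.{w} G (F j) 1)}
  have step : ∀ G : Good, ∃ (E : Good) (p : E.1 ⟶ G.1), IsUniversalExtension.{w} k F p := by
    intro G
    obtain ⟨E, p, hp⟩ := exists_isUniversalExtension k F G.1 G.2
    exact ⟨⟨E, hp.finite_ext hFF G.2⟩, p, hp⟩
  choose E p hp using step
  let obj : ℕ → Fin r → Good := fun n i => Nat.rec ⟨F i, hFF i⟩ (fun _ G => E G) n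
  exact ⟨⟨fun n i => (obj n i).1, fun i => Iso.refl _, fun n i => p (obj n i),
    fun n i => hp (obj n i)⟩⟩

end Ext

end NCDef

/-! ### Filtered objects and relatively projective towers -/

namespace NCDef

variable {A : Type u} [Category.{v} A] [Abelian A]

/-- `X` is a direct summand of a finite power of `Y`. -/
def IsSummand (Y X : A) : Prop :=
  ∃ (J : Type) (_ : Fintype J) (s : J → (X ⟶ Y)) (t : J → (Y ⟶ X)), ∑ a, s a ≫ t a = 𝟙 X

namespace IsSummand

variable {Y : A}

lemma self (Y : A) : IsSummand Y Y :=
  ⟨Unit, inferInstance, fun _ => 𝟙 Y, fun _ => 𝟙 Y, by simp⟩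

lemma of_sum {X : A} {J : Type} [Fintype J] (Z : J → A) (hZ : ∀ a, IsSummand Y (Z a))
    (p : ∀ a, X ⟶ Z a) (i : ∀ a, Z a ⟶ X) (h : ∑ a, p a ≫ i a = 𝟙 X) : IsSummand Y X := by
  choose I hI s t hst using hZ
  refine ⟨Σ a, I a, inferInstance, fun b => p b.1 ≫ s b.1 b.2, fun b => t b.1 b.2 ≫ i b.1, ?_⟩
  rw [Fintype.sum_sigma, ← h]
  refine Finset.sum_congr rfl fun a _ => ?_
  rw [← Category.id_comp (i a), ← hst a, Preadditive.sum_comp, Preadditive.comp_sum]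
  simp

lemma of_retract {X Z : A} (hZ : IsSummand Y Z) (p : X ⟶ Z) (i : Z ⟶ X) (h : p ≫ i = 𝟙 X) :
    IsSummand Y X :=
  of_sum (J := Unit) (fun _ => Z) (fun _ => hZ) (fun _ => p) (fun _ => i) (by simpa using h)

lemma of_iso {X Z : A} (hZ : IsSummand Y Z) (e : X ≅ Z) : IsSummand Y X :=
  hZ.of_retract e.hom e.inv e.hom_inv_id

lemma biproduct {J : Type} [Fintype J] (Z : J → A) (hZ : ∀ a, IsSummand Y (Z a)) :
    IsSummand Y (⨁ Z) :=
  of_sum Z hZ (biproduct.π Z) (biproduct.ι Z) biproduct.total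

lemma component {r : ℕ} (F : Fin r → A) (i : Fin r) : IsSummand (⨁ F) (F i) :=
  (self _).of_retract (biproduct.ι F i) (biproduct.π F i) (biproduct.ι_π_self F i)

lemma kernel_biproduct_map {J : Type} [Fintype J] {X Z : J → A} (p : ∀ a, X a ⟶ Z a)
    (h : ∀ a, IsSummand Y (kernel (p a))) : IsSummand Y (kernel (biproduct.map p)) := by
  refine of_sum (fun a => kernel (p a)) h
    (fun a => kernel.lift (p a) (kernel.ι (biproduct.map p) ≫ biproduct.π X a) (by
      rw [Category.assoc, ← biproduct.map_π, kernel.condition_assoc, zero_comp]))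
    (fun a => kernel.lift _ (kernel.ι (p a) ≫ biproduct.ι X a) (by
      rw [Category.assoc, biproduct.ι_map, kernel.condition_assoc, zero_comp])) ?_
  rw [← cancel_mono (kernel.ι (biproduct.map p)), Preadditive.sum_comp, Category.id_comp]
  simp only [Category.assoc, kernel.lift_ι, kernel.lift_ι_assoc]
  rw [← Preadditive.comp_sum, biproduct.total, Category.comp_id]

/-- A property of morphisms into `Y` that is stable under composition and sums passes to
summands of powers of `Y`. -/
lemma exists_fac {X : A} (hX : IsSummand Y X) {W W' : A} (p : W ⟶ W')
    (h : ∀ f : W ⟶ Y, ∃ g : W' ⟶ Y, f = p ≫ g) (f : W ⟶ X) : ∃ g : W' ⟶ X, f = p ≫ g := by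
  obtain ⟨J, _, s, t, hst⟩ := hX
  choose g hg using fun a => h (f ≫ s a)
  refine ⟨∑ a, g a ≫ t a, ?_⟩
  rw [Preadditive.comp_sum]
  simp_rw [← Category.assoc, ← hg, Category.assoc]
  rw [← Preadditive.comp_sum, hst, Category.comp_id]

lemma comp_ext_eq_zero [HasExt.{w} A] {X : A} (hX : IsSummand Y X) {W W' : A} (p : W ⟶ W')
    (h : ∀ e : Abelian.Ext.{w} W' Y 1, (Abelian.Ext.mk₀ p).comp e (zero_add 1) = 0)
    (e : Abelian.Ext.{w} W' X 1) : (Abelian.Ext.mk₀ p).comp e (zero_add 1) = 0 := by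
  obtain ⟨J, _, s, t, hst⟩ := hX
  rw [← Abelian.Ext.comp_mk₀_id e, ← hst, Abelian.Ext.mk₀_sum, Abelian.Ext.comp_sum,
    Abelian.Ext.comp_sum]
  refine Finset.sum_eq_zero fun a _ => ?_
  rw [← Abelian.Ext.mk₀_comp_mk₀, ← Abelian.Ext.comp_assoc_of_third_deg_zero,
    ← Abelian.Ext.comp_assoc_of_third_deg_zero,
    Abelian.Ext.comp_assoc_of_third_deg_zero (Abelian.Ext.mk₀ p), h, Abelian.Ext.zero_comp]

lemma finite_hom {k : Type uk} [Field k] [Linear k A] {X : A} (hX : IsSummand Y X) {W : A}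
    [Module.Finite k (W ⟶ Y)] : Module.Finite k (W ⟶ X) := by
  obtain ⟨J, _, s, t, hst⟩ := hX
  let f : (W ⟶ X) →ₗ[k] J → (W ⟶ Y) := LinearMap.pi fun a => Linear.rightComp k W (s a)
  refine Module.Finite.of_injective f ?_
  rw [injective_iff_map_eq_zero]
  intro g hg
  have h1 : ∀ a, g ≫ s a = 0 := fun a => congr_fun hg a
  rw [← Category.comp_id g, ← hst, Preadditive.comp_sum]
  refine Finset.sum_eq_zero fun a _ => ?_
  rw [← Category.assoc, h1, zero_comp]

end IsSummand

/-- `X` has a filtration of length `m` whose successive quotients are direct summands of finite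
powers of `Y`. -/
inductive Filt (Y : A) : ℕ → A → Prop
  | zero {X : A} : IsZero X → Filt Y 0 X
  | succ {m : ℕ} {S : ShortComplex A} : S.ShortExact → IsSummand Y S.X₁ → Filt Y m S.X₃ →
      Filt Y (m + 1) S.X₂

namespace Filt

variable {Y : A}

lemma isZero {X : A} (h : Filt Y 0 X) : IsZero X := by
  cases h; assumption

lemma of_iso {m : ℕ} {X X' : A} (h : Filt Y m X) (e : X ≅ X') : Filt Y m X' := by
  cases h with
  | zero h => exact .zero (h.of_iso e.symm)
  | @succ m S hS h₁ h₃ =>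
    let S' : ShortComplex A := ShortComplex.mk (S.f ≫ e.hom) (e.inv ≫ S.g) (by simp)
    have e' : S ≅ S' := ShortComplex.isoMk (Iso.refl _) e (Iso.refl _)
    exact Filt.succ (S := S') (ShortComplex.shortExact_of_iso e' hS) h₁ h₃

lemma of_epi {m : ℕ} {X Z : A} (g : X ⟶ Z) [Epi g] (hg : IsSummand Y (kernel g))
    (h : Filt Y m Z) : Filt Y (m + 1) X :=
  Filt.succ (S := ShortComplex.mk (kernel.ι g) g (kernel.condition g))
    { exact := ShortComplex.exact_kernel g } hg h

open scoped ZeroObject in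
lemma of_isSummand {X : A} (h : IsSummand Y X) : Filt Y 1 X :=
  Filt.succ (S := ShortComplex.mk (𝟙 X) (0 : X ⟶ (0 : A)) comp_zero)
    { exact := ShortComplex.exact_of_f_is_kernel _
        (KernelFork.IsLimit.ofι _ _ (fun f _ => f) (by simp) (by simp))
      epi_g := ⟨fun _ _ _ => (isZero_zero A).eq_of_src _ _⟩ } h (.zero (isZero_zero A))

lemma finite_hom {k : Type uk} [Field k] [Linear k A] {m : ℕ} {X : A} (hX : Filt Y m X) {W : A}
    [Module.Finite k (W ⟶ Y)] : Module.Finite k (W ⟶ X) := by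
  induction hX with
  | zero h =>
    have : Subsingleton (W ⟶ _) := ⟨fun f g => h.eq_of_tgt f g⟩
    infer_instance
  | @succ m S hS h₁ h₃ ih =>
    have := h₁.finite_hom (k := k) (W := W)
    let f : (W ⟶ S.X₁) →ₗ[k] (W ⟶ S.X₂) := Linear.rightComp k W S.f
    let g : (W ⟶ S.X₂) →ₗ[k] (W ⟶ S.X₃) := Linear.rightComp k W S.g
    have hker : LinearMap.ker g ≤ LinearMap.range f := fun e he => by
      have := hS.mono_f
      exact ⟨hS.exact.lift e he, hS.exact.lift_f e he⟩
    have h1 : Module.Finite k (LinearMap.ker g) := by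
      have : Module.Finite k (LinearMap.range f) := inferInstance
      exact Module.Finite.of_injective (Submodule.inclusion hker) (Submodule.inclusion_injective _)
    have h2 : Module.Finite k (_ ⧸ LinearMap.ker g) :=
      Module.Finite.equiv (LinearMap.quotKerEquivRange g).symm
    exact Module.Finite.of_submodule_quotient (LinearMap.ker g)

end Filt

/-- An element of `kernel q` lifts along `p` after a refinement, and the lift lies in `kernel (p ≫
q)`. This serves to filter the kernels of the maps from the tower to the `F i`. -/
lemma shortExact_kernel_comp {X Z V : A} (p : X ⟶ Z) [Epi p] (q : Z ⟶ V) :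
    ∃ (f : kernel p ⟶ kernel (p ≫ q)) (g : kernel (p ≫ q) ⟶ kernel q) (w : f ≫ g = 0),
      (ShortComplex.mk f g w).ShortExact := by
  let f : kernel p ⟶ kernel (p ≫ q) := kernel.lift _ (kernel.ι p) (by simp)
  let g : kernel (p ≫ q) ⟶ kernel q := kernel.lift _ (kernel.ι (p ≫ q) ≫ p) (by
    rw [Category.assoc, kernel.condition])
  have w : f ≫ g = 0 := by
    rw [← cancel_mono (kernel.ι q)]; simp [f, g]
  have hf : Mono f := by
    have : Mono (f ≫ kernel.ι (p ≫ q)) := by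
      rw [kernel.lift_ι]; infer_instance
    exact mono_of_mono f (kernel.ι (p ≫ q))
  refine ⟨f, g, w, { exact := ?_, mono_f := hf, epi_g := ?_ }⟩
  · refine ShortComplex.exact_of_f_is_kernel _ (KernelFork.IsLimit.ofι' f w fun {W} a ha => ?_)
    have h1 : (a ≫ kernel.ι (p ≫ q)) ≫ p = 0 := by
      have := ha =≫ kernel.ι q
      simpa [g] using this
    refine ⟨kernel.lift p _ h1, ?_⟩
    rw [← cancel_mono (kernel.ι (p ≫ q))]
    simp [f]
  · change Epi g
    rw [epi_iff_surjective_up_to_refinements]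
    intro W a
    obtain ⟨W', π, hπ, x, hx⟩ := surjective_up_to_refinements_of_epi p (a ≫ kernel.ι q)
    refine ⟨W', π, hπ, kernel.lift _ x ?_, ?_⟩
    · rw [← Category.assoc, ← hx, Category.assoc, Category.assoc, kernel.condition, comp_zero,
        comp_zero]
    · rw [← cancel_mono (kernel.ι q)]
      simp [g, hx]

/-- A tower of objects over `Y` that is relatively projective for extensions by summands of
powers of `Y`. -/
structure IsProjTower [HasExt.{w} A] (Y : A) (P : ℕ → A) (pr : ∀ n, P (n + 1) ⟶ P n)
    (b : ∀ n, P n ⟶ Y) : Prop where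
  isIso_base : IsIso (b 0)
  base_succ : ∀ n, b (n + 1) = pr n ≫ b n
  epi : ∀ n, Epi (pr n)
  ker : ∀ n, IsSummand Y (kernel (pr n))
  fac : ∀ n (f : P (n + 1) ⟶ Y), ∃ g, f = pr n ≫ g
  ext : ∀ n (e : Abelian.Ext.{w} (P n) Y 1), (Abelian.Ext.mk₀ (pr n)).comp e (zero_add 1) = 0

/-! ### Relative projectivity of the tower -/

namespace IsProjTower

variable [HasExt.{w} A] {Y : A} {P : ℕ → A} {pr : ∀ n, P (n + 1) ⟶ P n} {b : ∀ n, P n ⟶ Y}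
  (h : IsProjTower.{w} Y P pr b)

include h

lemma epi_base (n : ℕ) : Epi (b n) := by
  induction n with
  | zero => have := h.isIso_base; infer_instance
  | succ n ih => rw [h.base_succ]; have := h.epi n; exact epi_comp _ _

lemma fac_base {X : A} (hX : IsSummand Y X) (n : ℕ) (f : P n ⟶ X) : ∃ g, f = b n ≫ g := by
  induction n with
  | zero =>
    have := h.isIso_base
    exact ⟨inv (b 0) ≫ f, by simp⟩
  | succ n ih =>
    obtain ⟨g, rfl⟩ := hX.exists_fac (pr n) (h.fac n) f
    obtain ⟨g', rfl⟩ := ih g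
    exact ⟨g', by rw [h.base_succ, Category.assoc]⟩

/-- The obstruction to lifting `f` lies in `Ext¹(P n, S.X₁)` and dies after pullback along `pr n`.
-/
lemma exists_lift_succ {S : ShortComplex A} (hS : S.ShortExact) (h₁ : IsSummand Y S.X₁) (n : ℕ)
    (f : P n ⟶ S.X₃) : ∃ g : P (n + 1) ⟶ S.X₂, g ≫ S.g = pr n ≫ f := by
  obtain ⟨x, hx⟩ := Abelian.Ext.covariant_sequence_exact₃ (P (n + 1)) hS
    (Abelian.Ext.mk₀ (pr n ≫ f)) (zero_add 1) (by
      rw [← Abelian.Ext.mk₀_comp_mk₀, Abelian.Ext.comp_assoc_of_second_deg_zero]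
      exact h₁.comp_ext_eq_zero (pr n) (h.ext n) _)
  obtain ⟨g, rfl⟩ := Abelian.Ext.mk₀_bijective _ _ |>.surjective x
  refine ⟨g, (Abelian.Ext.mk₀_bijective _ _).injective ?_⟩
  rw [← hx, Abelian.Ext.mk₀_comp_mk₀]

/-- Induction on the filtration. Modulo `S.X₁` the map descends to some `f'`. Once `f'` is lifted to
`S.X₂`, the remaining difference takes values in `S.X₁`, where `fac` applies. -/
lemma exists_fac_of_filt {m : ℕ} {X : A} (hX : Filt Y m X) (n : ℕ) (hm : m ≤ n + 1)
    (f : P (n + 1) ⟶ X) : ∃ g, f = pr n ≫ g := by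
  induction hX generalizing n with
  | zero hX => exact ⟨0, hX.eq_of_tgt _ _⟩
  | @succ m S hS h₁ h₃ ih =>
    obtain ⟨f', hf'⟩ := ih n (by lia) (f ≫ S.g)
    -- Lifting `f'` costs one stage of the tower, so `f'` is first pushed one stage further down,
    -- which the length `m ≤ n` of the quotient permits. At stage 0 the quotient is zero.
    have key : ∃ g : P n ⟶ S.X₂, g ≫ S.g = f' := by
      match n, hm, f, f', hf' with
      | 0, hm, f, f', _ =>
        obtain rfl : m = 0 := by lia
        exact ⟨0, h₃.isZero.eq_of_tgt _ _⟩
      | n + 1, hm, f, f', _ =>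
        obtain ⟨f'', rfl⟩ := ih n (by lia) f'
        exact h.exists_lift_succ hS h₁ n f''
    obtain ⟨g, rfl⟩ := key
    have h1 : (f - pr n ≫ g) ≫ S.g = 0 := by
      rw [Preadditive.sub_comp, hf', Category.assoc, sub_self]
    have := hS.mono_f
    obtain ⟨l, hl⟩ : ∃ l, l ≫ S.f = f - pr n ≫ g := ⟨hS.exact.lift _ h1, hS.exact.lift_f _ h1⟩
    obtain ⟨l', rfl⟩ := h₁.exists_fac (pr n) (h.fac n) l
    exact ⟨g + l' ≫ S.f, by rw [Preadditive.comp_add, ← Category.assoc, hl]; abel⟩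

/-- As `S.X₃` has length at most `n`, the map `f` descends one stage, and the obstruction to lifting
dies on the way back up to `P n`. -/
lemma exists_lift {S : ShortComplex A} (hS : S.ShortExact) (h₁ : IsSummand Y S.X₁) {m : ℕ}
    (h₃ : Filt Y m S.X₃) (n : ℕ) (hm : m ≤ n) (f : P n ⟶ S.X₃) :
    ∃ g : P n ⟶ S.X₂, g ≫ S.g = f := by
  match n, hm, f with
  | 0, hm, f =>
    obtain rfl : m = 0 := by lia
    exact ⟨0, h₃.isZero.eq_of_tgt _ _⟩
  | n + 1, hm, f =>
    obtain ⟨f', rfl⟩ := h.exists_fac_of_filt h₃ n hm f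
    exact h.exists_lift_succ hS h₁ n f'

lemma filt (n : ℕ) : Filt Y (n + 1) (P n) := by
  induction n with
  | zero =>
    have := h.isIso_base
    exact Filt.of_isSummand ((IsSummand.self Y).of_iso (asIso (b 0)))
  | succ n ih =>
    have := h.epi n
    exact Filt.of_epi (pr n) (h.ker n) ih

/-- The kernel of `P n ⟶ Z` is built from `kernel q` and the kernels of the tower maps. Its length
`n + 1` stays within the range where `P n` controls objects. -/
lemma filt_kernel {Z : A} (q : Y ⟶ Z) (hq : IsSummand Y (kernel q)) (n : ℕ) :
    Filt Y (n + 1) (kernel (b n ≫ q)) := by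
  induction n with
  | zero =>
    have := h.isIso_base
    exact Filt.of_isSummand (hq.of_iso (kernelIsIsoComp (b 0) q))
  | succ n ih =>
    have := h.epi n
    obtain ⟨f, g, w, hS⟩ := shortExact_kernel_comp (pr n) (b n ≫ q)
    have h1 : Filt Y (n + 1 + 1) (kernel (pr n ≫ b n ≫ q)) := Filt.succ hS (h.ker n) ih
    rwa [← Category.assoc, ← h.base_succ] at h1

lemma finite_hom_base (k : Type uk) [Field k] [Linear k A] [Module.Finite k (Y ⟶ Y)] (n : ℕ) :
    Module.Finite k (P n ⟶ Y) := by
  let f : (Y ⟶ Y) →ₗ[k] (P n ⟶ Y) := Linear.leftComp k Y (b n)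
  refine Module.Finite.of_surjective f fun g => ?_
  obtain ⟨g', hg'⟩ := h.fac_base (IsSummand.self Y) n g
  exact ⟨g', hg'.symm⟩

lemma finite_hom (k : Type uk) [Field k] [Linear k A] [Module.Finite k (Y ⟶ Y)] (n : ℕ) {m : ℕ}
    {X : A} (hX : Filt Y m X) : Module.Finite k (P n ⟶ X) := by
  have := h.finite_hom_base k n
  exact hX.finite_hom

end IsProjTower

/-! ### From the components of a tower to their direct sum -/

section BiproductMap

variable {I J : Type} [Fintype I] [Fintype J] {X Z : I → A} (p : ∀ i, X i ⟶ Z i) {Y : J → A}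

lemma epi_biproduct_map [∀ i, Epi (p i)] : Epi (biproduct.map p) :=
  Preadditive.epi_of_cancel_zero _ fun {W} q hq => by
    apply biproduct.hom_ext'
    intro i
    rw [← cancel_epi (p i), comp_zero, comp_zero, ← biproduct.ι_map_assoc, hq, comp_zero]

lemma exists_fac_biproduct_map (h : ∀ i j (f : X i ⟶ Y j), ∃ g, f = p i ≫ g) (f : ⨁ X ⟶ ⨁ Y) :
    ∃ g, f = biproduct.map p ≫ g := by
  choose g hg using fun i j => h i j (biproduct.ι X i ≫ f ≫ biproduct.π Y j)
  refine ⟨biproduct.matrix g, ?_⟩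
  apply biproduct.hom_ext'
  intro i
  apply biproduct.hom_ext
  intro j
  rw [Category.assoc, hg]
  simp

lemma biproduct_map_comp_ext_eq_zero [HasExt.{w} A] (h : ∀ i j (e : Abelian.Ext.{w} (Z i) (Y j) 1),
    (Abelian.Ext.mk₀ (p i)).comp e (zero_add 1) = 0) (e : Abelian.Ext.{w} (⨁ Z) (⨁ Y) 1) :
    (Abelian.Ext.mk₀ (biproduct.map p)).comp e (zero_add 1) = 0 := by
  classical
  have h1 : ∀ i, (Abelian.Ext.mk₀ (p i)).comp
      ((Abelian.Ext.mk₀ (biproduct.ι Z i)).comp e (zero_add 1)) (zero_add 1) = 0 := by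
    intro i
    generalize (Abelian.Ext.mk₀ (biproduct.ι Z i)).comp e (zero_add 1) = e'
    rw [← Abelian.Ext.comp_mk₀_id e', ← biproduct.total, Abelian.Ext.mk₀_sum,
      Abelian.Ext.comp_sum, Abelian.Ext.comp_sum]
    refine Finset.sum_eq_zero fun j _ => ?_
    rw [← Abelian.Ext.mk₀_comp_mk₀, ← Abelian.Ext.comp_assoc_of_third_deg_zero,
      ← Abelian.Ext.comp_assoc_of_third_deg_zero,
      Abelian.Ext.comp_assoc_of_third_deg_zero (Abelian.Ext.mk₀ (p i)), h,
      Abelian.Ext.zero_comp]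
  have h2 : biproduct.map p = ∑ i, biproduct.π X i ≫ p i ≫ biproduct.ι Z i := by
    apply biproduct.hom_ext'
    intro i
    rw [Preadditive.comp_sum, Finset.sum_eq_single i]
    · simp
    · intro j _ hj
      rw [biproduct.ι_π_ne_assoc _ hj.symm, zero_comp]
    · simp
  rw [h2, Abelian.Ext.mk₀_sum, Abelian.Ext.sum_comp]
  refine Finset.sum_eq_zero fun i _ => ?_
  rw [← Abelian.Ext.mk₀_comp_mk₀_assoc, ← Abelian.Ext.mk₀_comp_mk₀_assoc, h1,
    Abelian.Ext.comp_zero]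

end BiproductMap

variable {k : Type uk} [Field k] [Linear k A] [HasExt.{w} A] {r : ℕ} {F : Fin r → A}

lemma UniversalTower.isSummand_kernel (T : UniversalTower.{w} k F) (n : ℕ) (i : Fin r) :
    IsSummand (⨁ F) (kernel (T.p n i)) := by
  obtain ⟨m, b, ι, zero, h, hb⟩ := T.universal n i
  have := h.mono_f
  have hS : IsSummand (⨁ F) (⨁ fun a : (Σ j : Fin r, Fin (m j)) => F a.1) :=
    IsSummand.biproduct _ fun a => IsSummand.component F a.1
  have hker := h.fIsKernel
  exact hS.of_iso ((kernelIsKernel (T.p n i)).conePointUniqueUpToIso hker)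

/-- Universality of the extensions is used only here and in `isSummand_kernel`; the later arguments
see it through `IsProjTower`. -/
lemma UniversalTower.isProjTower (hF : IsSimpleCollection k F) (T : UniversalTower.{w} k F) :
    IsProjTower.{w} (⨁ F) T.sum T.proj T.toBase where
  isIso_base := inferInstanceAs (IsIso (biproduct.mapIso T.base).hom)
  base_succ _ := rfl
  epi n := by
    have := fun i => (T.universal n i).epi
    exact epi_biproduct_map (T.p n)
  ker n := IsSummand.kernel_biproduct_map _ (T.isSummand_kernel n)
  fac n f := exists_fac_biproduct_map (T.p n)
    (fun i j f => (T.universal n i).exists_fac hF j f) f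
  ext n e := biproduct_map_comp_ext_eq_zero (T.p n) (fun i j e => (T.universal n i).comp_ext j e) e

end NCDef

/-! ### The functor `- ⊗_R P` and the evaluation `Hom(P, X) ⊗_R P ⟶ X` -/

namespace NCDef

section TensorFunctor

variable {k : Type uk} [Field k] {A : Type u} [Category.{v} A] [Abelian A] [Linear k A]
  {R : Type t} [Ring R] [Algebra k R] {P : A} (ρ : R →ₐ[k] End P)
  {N₁ : Type t'} [AddCommGroup N₁] [Module Rᵐᵒᵖ N₁] [Module.FinitePresentation Rᵐᵒᵖ N₁]
  {N₂ : Type t'} [AddCommGroup N₂] [Module Rᵐᵒᵖ N₂] [Module.FinitePresentation Rᵐᵒᵖ N₂]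
  {N₃ : Type t'} [AddCommGroup N₃] [Module Rᵐᵒᵖ N₃] [Module.FinitePresentation Rᵐᵒᵖ N₃]

lemma tensorMap_id : tensorMap ρ (LinearMap.id : N₁ →ₗ[Rᵐᵒᵖ] N₁) = 𝟙 _ :=
  tensor_hom_ext ρ fun n => by rw [tensorMk_map, Category.comp_id]; rfl

lemma tensorMap_comp (f : N₁ →ₗ[Rᵐᵒᵖ] N₂) (g : N₂ →ₗ[Rᵐᵒᵖ] N₃) :
    tensorMap ρ f ≫ tensorMap ρ g = tensorMap ρ (g.comp f) :=
  tensor_hom_ext ρ fun n => by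
    rw [← Category.assoc, tensorMk_map, tensorMk_map, tensorMk_map]; rfl

lemma tensorMap_sum {J : Type*} [Fintype J] (f : J → (N₁ →ₗ[Rᵐᵒᵖ] N₂)) :
    tensorMap ρ (∑ a, f a) = ∑ a, tensorMap ρ (f a) :=
  tensor_hom_ext ρ fun n => by
    rw [tensorMk_map, Preadditive.comp_sum, LinearMap.sum_apply, map_sum]
    exact Finset.sum_congr rfl fun a _ => (tensorMk_map ρ _ _).symm

instance isIso_tensorMap (e : N₁ ≃ₗ[Rᵐᵒᵖ] N₂) : IsIso (tensorMap ρ (e : N₁ →ₗ[Rᵐᵒᵖ] N₂)) :=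
  ⟨tensorMap ρ (e.symm : N₂ →ₗ[Rᵐᵒᵖ] N₁),
    by rw [tensorMap_comp, ← tensorMap_id]; congr 1; ext; simp,
    by rw [tensorMap_comp, ← tensorMap_id]; congr 1; ext; simp⟩

lemma epi_tensorMap (g : N₂ →ₗ[Rᵐᵒᵖ] N₃) (hg : Function.Surjective g) :
    Epi (tensorMap ρ g) :=
  Preadditive.epi_of_cancel_zero _ fun {X} q hq => tensor_hom_ext ρ fun n => by
    obtain ⟨n, rfl⟩ := hg n
    rw [← tensorMk_map, Category.assoc, hq, comp_zero, comp_zero]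

/-- Right exactness from the universal property: lift an element of `N₃` to `N₂` and apply `q`. Two
lifts differ by an element from `N₁`, which `q` kills. -/
lemma tensorMap_exists_desc (f : N₁ →ₗ[Rᵐᵒᵖ] N₂) (g : N₂ →ₗ[Rᵐᵒᵖ] N₃)
    (h : Function.Exact f g) (hg : Function.Surjective g) {X : A} (q : tensor ρ N₂ ⟶ X)
    (hq : tensorMap ρ f ≫ q = 0) : ∃ l : tensor ρ N₃ ⟶ X, tensorMap ρ g ≫ l = q := by
  have key : ∀ a b, g a = g b → tensorMk ρ N₂ a ≫ q = tensorMk ρ N₂ b ≫ q := by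
    intro a b hab
    obtain ⟨c, hc⟩ := (h (a - b)).1 (by rw [map_sub, hab, sub_self])
    rw [← sub_eq_zero, ← Preadditive.sub_comp, ← map_sub, ← hc, ← tensorMk_map, Category.assoc,
      hq, comp_zero]
  let α : N₃ →+ (P ⟶ X) := AddMonoidHom.mk'
    (fun n => tensorMk ρ N₂ (Function.surjInv hg n) ≫ q) (fun a b => by
      rw [← Preadditive.add_comp, ← map_add]
      apply key
      simp only [map_add, Function.surjInv_eq])
  have hα' : ∀ n, α (g n) = tensorMk ρ N₂ n ≫ q := fun n => key _ _ (Function.surjInv_eq hg _)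
  have hα : ∀ (a : R) (n : N₃), α (op a • n) = (ρ a : P ⟶ P) ≫ α n := by
    intro a n
    obtain ⟨n, rfl⟩ := hg n
    rw [← map_smul, hα', hα', tensorMk_smul, Category.assoc]
  refine ⟨tensorDesc ρ α hα, tensor_hom_ext ρ fun n => ?_⟩
  rw [← Category.assoc, tensorMk_map, tensorMk_desc, hα']

lemma tensorMap_exact (f : N₁ →ₗ[Rᵐᵒᵖ] N₂) (g : N₂ →ₗ[Rᵐᵒᵖ] N₃)
    (h : Function.Exact f g) (hg : Function.Surjective g) :
    (ShortComplex.mk (tensorMap ρ f) (tensorMap ρ g) (tensorMap_comp_zero ρ f g h)).Exact := by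
  have := epi_tensorMap ρ g hg
  exact ShortComplex.exact_of_g_is_cokernel _ (CokernelCofork.IsColimit.ofπ' _ _ fun q hq =>
    ⟨(tensorMap_exists_desc ρ f g h hg q hq).choose,
      (tensorMap_exists_desc ρ f g h hg q hq).choose_spec⟩)

end TensorFunctor

/-! ### The morphisms `n ⊗ -` and cyclic modules -/

section TensorMk

variable {k : Type uk} [Field k] {A : Type u} [Category.{v} A] [Abelian A] [Linear k A]
  {R : Type t} [Ring R] [Algebra k R] {P : A} (ρ : R →ₐ[k] End P)
  {N : Type t'} [AddCommGroup N] [Module Rᵐᵒᵖ N] [Module.FinitePresentation Rᵐᵒᵖ N]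

lemma epi_tensorMk (n₀ : N) (h : ∀ n : N, ∃ a : R, op a • n₀ = n) : Epi (tensorMk ρ N n₀) :=
  Preadditive.epi_of_cancel_zero _ fun {X} q hq => tensor_hom_ext ρ fun n => by
    obtain ⟨a, rfl⟩ := h n
    rw [tensorMk_smul, Category.assoc, hq, comp_zero, comp_zero]

/-- Here `N` is free on `n₀`, and the inverse `d` lets `n₀ a` act as `a`: this is `R ⊗ P ≅ P`. -/
lemma isIso_tensorMk (n₀ : N) (h : Function.Bijective fun a : R => op a • n₀) :
    IsIso (tensorMk ρ N n₀) := by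
  let e : R ≃+ N := AddEquiv.ofBijective
    (AddMonoidHom.mk' (fun a : R => op a • n₀) fun a b => by rw [MulOpposite.op_add, add_smul]) h
  have he : ∀ a, e a = op a • n₀ := fun a => rfl
  let ρ' : R →+ (P ⟶ P) := ρ.toRingHom.toAddMonoidHom
  let d : tensor ρ N ⟶ P := tensorDesc ρ (ρ'.comp e.symm.toAddMonoidHom) fun a n => by
    obtain ⟨b, rfl⟩ := e.surjective n
    have h1 : op a • e b = e (b * a) := by rw [he, he, smul_smul, MulOpposite.op_mul]
    rw [h1]
    change ρ (e.symm (e (b * a))) = (ρ a : P ⟶ P) ≫ ρ (e.symm (e b))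
    rw [e.symm_apply_apply, e.symm_apply_apply, map_mul]
    rfl
  have hd : ∀ a, tensorMk ρ N (e a) ≫ d = ρ a := fun a => by
    rw [tensorMk_desc]
    exact congrArg ρ (e.symm_apply_apply a)
  have h1 : e 1 = n₀ := by rw [he, MulOpposite.op_one, one_smul]
  have h2 : tensorMk ρ N n₀ ≫ d = 𝟙 P := by
    rw [← h1, hd, map_one]; rfl
  refine ⟨d, h2, tensor_hom_ext ρ fun n => ?_⟩
  obtain ⟨a, rfl⟩ := e.surjective n
  rw [← Category.assoc, hd, he, ← tensorMk_smul, Category.comp_id]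

lemma tensorMk_smul_of_isScalarTower [Module k N] [IsScalarTower k Rᵐᵒᵖ N] (c : k) (n : N) :
    tensorMk ρ N (c • n) = c • tensorMk ρ N n := by
  have h1 : c • n = op (algebraMap k R c) • n := by
    rw [← MulOpposite.algebraMap_apply, algebraMap_smul]
  have h2 : ρ (algebraMap k R c) = c • 𝟙 P := by
    rw [AlgHom.commutes, Algebra.algebraMap_eq_smul_one]; rfl
  rw [h1, tensorMk_smul, h2, Linear.smul_comp, Category.id_comp]

end TensorMk

/-- The right `R`-module `Hom(P, X)` for an object `P` with a left action of `R`. -/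
def HomMod {k : Type uk} [Field k] {A : Type u} [Category.{v} A] [Abelian A] [Linear k A]
    {R : Type t} [Ring R] [Algebra k R] {P : A} (_ρ : R →ₐ[k] End P) (X : A) : Type v := P ⟶ X

namespace HomMod

variable {k : Type uk} [Field k] {A : Type u} [Category.{v} A] [Abelian A] [Linear k A]
  {R : Type t} [Ring R] [Algebra k R] {P : A} (ρ : R →ₐ[k] End P) {X Y : A}

instance : AddCommGroup (HomMod ρ X) := inferInstanceAs (AddCommGroup (P ⟶ X))

instance : Module k (HomMod ρ X) := inferInstanceAs (Module k (P ⟶ X))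

instance : Module Rᵐᵒᵖ (HomMod ρ X) where
  smul a h := (ρ a.unop : P ⟶ P) ≫ (h : P ⟶ X)
  one_smul h := by
    change (ρ 1 : P ⟶ P) ≫ (h : P ⟶ X) = h
    rw [map_one]; exact Category.id_comp _
  mul_smul a b h := by
    change (ρ (b.unop * a.unop) : P ⟶ P) ≫ (h : P ⟶ X) = ρ a.unop ≫ ρ b.unop ≫ h
    rw [map_mul]; exact Category.assoc _ _ _
  smul_zero a := comp_zero
  smul_add a f g := Preadditive.comp_add _ _ _ _ _ _
  add_smul a b h := by
    change (ρ (a.unop + b.unop) : P ⟶ P) ≫ (h : P ⟶ X) = ρ a.unop ≫ h + ρ b.unop ≫ h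
    rw [map_add]; exact Preadditive.add_comp _ _ _ _ _ _
  zero_smul h := by
    change (ρ 0 : P ⟶ P) ≫ (h : P ⟶ X) = 0
    rw [map_zero]; exact zero_comp

def mk (h : P ⟶ X) : HomMod ρ X := h

def val {ρ : R →ₐ[k] End P} (h : HomMod ρ X) : P ⟶ X := h

lemma op_smul_mk (a : R) (h : P ⟶ X) : op a • mk ρ h = mk ρ ((ρ a : P ⟶ P) ≫ h) := rfl

instance : IsScalarTower k Rᵐᵒᵖ (HomMod ρ X) where
  smul_assoc c a h := by
    change (ρ (c • a.unop) : P ⟶ P) ≫ (h : P ⟶ X) = c • ρ a.unop ≫ h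
    rw [map_smul]; exact Linear.smul_comp _ _ _ _ _ _

lemma finitePresentation [Module.Finite k R] [Module.Finite k (P ⟶ X)] :
    Module.FinitePresentation Rᵐᵒᵖ (HomMod ρ X) := by
  have h1 : Module.Finite k Rᵐᵒᵖ :=
    Module.Finite.equiv (MulOpposite.opLinearEquiv k : R ≃ₗ[k] Rᵐᵒᵖ)
  have h2 : IsNoetherianRing Rᵐᵒᵖ := isNoetherian_of_tower k inferInstance
  have h3 : Module.Finite k (HomMod ρ X) := inferInstanceAs (Module.Finite k (P ⟶ X))
  have h4 : Module.Finite Rᵐᵒᵖ (HomMod ρ X) := Module.Finite.of_restrictScalars_finite k _ _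
  exact Module.finitePresentation_of_finite _ _

/-- Composition with `f : X ⟶ Y`. -/
def map (f : X ⟶ Y) : HomMod ρ X →ₗ[Rᵐᵒᵖ] HomMod ρ Y where
  toFun h := mk ρ (h.val ≫ f)
  map_add' a b := Preadditive.add_comp _ _ _ a.val b.val f
  map_smul' a h := Category.assoc (ρ a.unop : P ⟶ P) h.val f

lemma map_id : map ρ (𝟙 X) = LinearMap.id := LinearMap.ext fun h => Category.comp_id h.val

lemma map_comp {Z : A} (f : X ⟶ Y) (g : Y ⟶ Z) : map ρ (f ≫ g) = (map ρ g).comp (map ρ f) :=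
  LinearMap.ext fun h => (Category.assoc h.val f g).symm

lemma map_sum {J : Type*} [Fintype J] (f : J → (X ⟶ Y)) :
    map ρ (∑ a, f a) = ∑ a, map ρ (f a) := LinearMap.ext fun h => by
  rw [LinearMap.sum_apply]
  exact Preadditive.comp_sum _ h.val f

lemma map_exact {S : ShortComplex A} (hS : S.Exact) [Mono S.f] :
    Function.Exact (map ρ S.f) (map ρ S.g) := fun h =>
  ⟨fun hh => ⟨hS.lift h.val hh, hS.lift_f h.val hh⟩, by
    rintro ⟨h, rfl⟩
    change (h.val ≫ S.f) ≫ S.g = 0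
    rw [Category.assoc, S.zero, comp_zero]⟩

/-- The evaluation `Hom(P, X) ⊗_R P ⟶ X`. -/
def ev [Module.FinitePresentation Rᵐᵒᵖ (HomMod ρ X)] : tensor ρ (HomMod ρ X) ⟶ X :=
  tensorDesc ρ (AddMonoidHom.mk' (fun h : HomMod ρ X => h.val) fun _ _ => rfl) fun _ _ => rfl

lemma tensorMk_ev [Module.FinitePresentation Rᵐᵒᵖ (HomMod ρ X)] (h : HomMod ρ X) :
    tensorMk ρ (HomMod ρ X) h ≫ ev ρ = h.val := tensorMk_desc ρ _ _ h

lemma map_ev [Module.FinitePresentation Rᵐᵒᵖ (HomMod ρ X)]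
    [Module.FinitePresentation Rᵐᵒᵖ (HomMod ρ Y)] (f : X ⟶ Y) :
    tensorMap ρ (map ρ f) ≫ ev ρ = ev ρ ≫ f := tensor_hom_ext ρ fun h => by
  rw [← Category.assoc, tensorMk_map, tensorMk_ev, ← Category.assoc, tensorMk_ev]
  rfl

/-- `Hom(P, P)` is free on the identity, so `isIso_tensorMk` applies. -/
lemma isIso_ev_self (hρ : Function.Bijective ρ) [Module.FinitePresentation Rᵐᵒᵖ (HomMod ρ P)] :
    IsIso (ev ρ : tensor ρ (HomMod ρ P) ⟶ P) := by
  have h1 : IsIso (tensorMk ρ (HomMod ρ P) (mk ρ (𝟙 P))) := isIso_tensorMk ρ _ (by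
    have : (fun a : R => op a • mk ρ (𝟙 P)) = fun a => mk ρ (ρ a : P ⟶ P) := by
      funext a
      rw [op_smul_mk, Category.comp_id]
    rw [this]
    exact hρ)
  have h2 : tensorMk ρ (HomMod ρ P) (mk ρ (𝟙 P)) ≫ ev ρ = 𝟙 P := tensorMk_ev ρ _
  rw [← IsIso.inv_eq_of_hom_inv_id h2]
  infer_instance

section ShortExact

variable {S : ShortComplex A} [Module.FinitePresentation Rᵐᵒᵖ (HomMod ρ S.X₁)]
  [Module.FinitePresentation Rᵐᵒᵖ (HomMod ρ S.X₂)]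
  [Module.FinitePresentation Rᵐᵒᵖ (HomMod ρ S.X₃)]

/-- The evaluation as a morphism of short complexes. -/
def evShortComplex (hS : S.ShortExact) :
    ShortComplex.mk (tensorMap ρ (map ρ S.f)) (tensorMap ρ (map ρ S.g))
      (tensorMap_comp_zero ρ _ _ (have := hS.mono_f; map_exact ρ hS.exact)) ⟶ S where
  τ₁ := ev ρ
  τ₂ := ev ρ
  τ₃ := ev ρ
  comm₁₂ := (map_ev ρ S.f).symm
  comm₂₃ := (map_ev ρ S.g).symm

lemma epi_ev_of_shortExact (hS : S.ShortExact) (hlift : Function.Surjective (map ρ S.g))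
    (h₁ : Epi (ev ρ (X := S.X₁))) (h₃ : Epi (ev ρ (X := S.X₃))) : Epi (ev ρ (X := S.X₂)) := by
  have := hS.epi_g
  have := epi_tensorMap ρ _ hlift
  have e₁ : Epi (evShortComplex ρ hS).τ₁ := h₁
  have e₃ : Epi (evShortComplex ρ hS).τ₃ := h₃
  exact ShortComplex.epi_τ₂_of_exact_of_epi (evShortComplex ρ hS) hS.exact

/-- Tensoring is only known to be right exact. The left map is nevertheless a monomorphism, because
followed by `ev` it becomes the monomorphism `ev ≫ S.f`; then the five lemma applies. -/
lemma isIso_ev_of_shortExact (hS : S.ShortExact) (hlift : Function.Surjective (map ρ S.g))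
    (h₁ : IsIso (ev ρ (X := S.X₁))) (h₃ : IsIso (ev ρ (X := S.X₃))) :
    IsIso (ev ρ (X := S.X₂)) := by
  have := hS.mono_f
  have hm : Mono (tensorMap ρ (map ρ S.f)) := by
    have : Mono (tensorMap ρ (map ρ S.f) ≫ ev ρ) := by
      rw [map_ev]; exact mono_comp _ _
    exact mono_of_mono _ (ev ρ)
  exact ShortComplex.isIso₂_of_shortExact_of_isIso₁₃' (evShortComplex ρ hS)
    { exact := tensorMap_exact ρ _ _ (map_exact ρ hS.exact) hlift
      mono_f := hm
      epi_g := epi_tensorMap ρ _ hlift } hS h₁ h₃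

/-- If `Hom(P, X₂) ⊗ P ≅ X₂` and `Hom(P, X₁) ⊗ P ⟶ X₁` is an epimorphism then
`Hom(P, X₃) ⊗ P ≅ X₃`. -/
lemma isIso_ev_of_presentation (hS : S.ShortExact) (hlift : Function.Surjective (map ρ S.g))
    (h₁ : Epi (ev ρ (X := S.X₁))) (h₂ : IsIso (ev ρ (X := S.X₂))) :
    IsIso (ev ρ (X := S.X₃)) := by
  have := hS.mono_f
  have := hS.epi_g
  have hg := epi_tensorMap ρ _ hlift
  have hepi : Epi (ev ρ (X := S.X₃)) := by
    have : Epi (tensorMap ρ (map ρ S.g) ≫ ev ρ) := by rw [map_ev]; exact epi_comp _ _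
    exact epi_of_epi (tensorMap ρ (map ρ S.g)) _
  -- The map `X₂ ⟶ Hom(P, X₃) ⊗ P` kills `X₁`, because `Hom(P, X₁) ⊗ P` covers `X₁`. It therefore
  -- descends to `X₃`, and the descended map undoes `ev`.
  have hw : S.f ≫ inv (ev ρ (X := S.X₂)) ≫ tensorMap ρ (map ρ S.g) = 0 := by
    rw [← cancel_epi (ev ρ (X := S.X₁)), comp_zero, ← Category.assoc, ← map_ev, Category.assoc,
      IsIso.hom_inv_id_assoc]
    exact tensorMap_comp_zero ρ _ _ (map_exact ρ hS.exact)
  have hmono : Mono (ev ρ (X := S.X₃)) := by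
    have h3 : ev ρ (X := S.X₃) ≫ hS.exact.desc _ hw = 𝟙 _ := by
      rw [← cancel_epi (tensorMap ρ (map ρ S.g)), ← Category.assoc, map_ev, Category.assoc,
        hS.exact.g_desc, IsIso.hom_inv_id_assoc, Category.comp_id]
    have : Mono (ev ρ (X := S.X₃) ≫ hS.exact.desc _ hw) := by rw [h3]; infer_instance
    exact mono_of_mono _ (hS.exact.desc _ hw)
  exact isIso_of_mono_of_epi _

end ShortExact

lemma isIso_ev_of_isSummand (hX : IsSummand Y X) [Module.FinitePresentation Rᵐᵒᵖ (HomMod ρ X)]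
    [Module.FinitePresentation Rᵐᵒᵖ (HomMod ρ Y)] (hY : IsIso (ev ρ (X := Y))) :
    IsIso (ev ρ (X := X)) := by
  obtain ⟨J, _, s, t, hst⟩ := hX
  refine ⟨∑ a, s a ≫ inv (ev ρ (X := Y)) ≫ tensorMap ρ (map ρ (t a)), ?_, ?_⟩
  · rw [Preadditive.comp_sum, ← tensorMap_id, ← map_id, ← hst, map_sum, tensorMap_sum]
    refine Finset.sum_congr rfl fun a _ => ?_
    rw [← Category.assoc, ← map_ev, Category.assoc, IsIso.hom_inv_id_assoc, tensorMap_comp,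
      map_comp]
  · rw [Preadditive.sum_comp, ← hst]
    refine Finset.sum_congr rfl fun a _ => ?_
    simp only [Category.assoc]
    rw [map_ev, IsIso.inv_hom_id_assoc]

lemma isIso_ev_of_isZero (hX : IsZero X) [Module.FinitePresentation Rᵐᵒᵖ (HomMod ρ X)] :
    IsIso (ev ρ (X := X)) := by
  refine ⟨0, tensor_hom_ext ρ fun h => ?_, hX.eq_of_tgt _ _⟩
  have : h = 0 := hX.eq_of_tgt _ _
  rw [this, map_zero, zero_comp, zero_comp]

/-- A bijection `N ≃ Hom(P, X)` of right modules gives an isomorphism `N ⊗_R P ≅ X` if the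
evaluation of `X` is an isomorphism. -/
lemma isIso_tensorDesc {N : Type t'} [AddCommGroup N] [Module Rᵐᵒᵖ N]
    [Module.FinitePresentation Rᵐᵒᵖ N] [Module.FinitePresentation Rᵐᵒᵖ (HomMod ρ X)]
    (hX : IsIso (ev ρ (X := X))) (α : N →+ (P ⟶ X))
    (hα : ∀ (a : R) (n : N), α (op a • n) = (ρ a : P ⟶ P) ≫ α n)
    (hbij : Function.Bijective α) : IsIso (tensorDesc ρ α hα) := by
  let e : N ≃+ (P ⟶ X) := AddEquiv.ofBijective α hbij
  have he : ∀ n, e n = α n := fun n => rfl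
  let d : tensor ρ (HomMod ρ X) ⟶ tensor ρ N :=
    tensorDesc ρ ((tensorMk ρ N).comp e.symm.toAddMonoidHom) fun a h => by
      obtain ⟨n, hn⟩ := e.surjective h.val
      have h1 : op a • h = e (op a • n) := by
        rw [he, hα, ← he, hn]; rfl
      change tensorMk ρ N (e.symm (op a • h)) = ρ a ≫ tensorMk ρ N (e.symm h.val)
      rw [h1, ← hn, e.symm_apply_apply, e.symm_apply_apply, tensorMk_smul]
  have hd : ∀ n, tensorMk ρ (HomMod ρ X) (mk ρ (α n)) ≫ d = tensorMk ρ N n := fun n => by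
    rw [tensorMk_desc]
    exact congrArg (tensorMk ρ N) (e.symm_apply_apply n)
  have h1 : tensorDesc ρ α hα ≫ inv (ev ρ (X := X)) ≫ d = 𝟙 _ := tensor_hom_ext ρ fun n => by
    have h2 : α n = tensorMk ρ (HomMod ρ X) (mk ρ (α n)) ≫ ev ρ := (tensorMk_ev ρ _).symm
    rw [← Category.assoc, tensorMk_desc, h2, Category.assoc, IsIso.hom_inv_id_assoc, hd,
      Category.comp_id]
  have h2 : d ≫ tensorDesc ρ α hα = ev ρ := tensor_hom_ext ρ fun h => by
    obtain ⟨n, rfl⟩ := hbij.2 h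
    have h3 := hd n
    rw [← Category.assoc]
    erw [h3]
    rw [tensorMk_desc]
    exact (tensorMk_ev ρ _).symm
  exact ⟨inv (ev ρ (X := X)) ≫ d, h1, by rw [Category.assoc, h2, IsIso.inv_hom_id]⟩

end HomMod

end NCDef

/-! ### Flatness -/

namespace NCDef

namespace Art

variable {k : Type uk} [Field k] {r : ℕ} (R : Art.{uk, t} k r)

instance isNoetherianRing_op : IsNoetherianRing (R : Type t)ᵐᵒᵖ := by
  have h1 : Module.Finite k (R : Type t)ᵐᵒᵖ :=
    Module.Finite.equiv (MulOpposite.opLinearEquiv k : R ≃ₗ[k] (R : Type t)ᵐᵒᵖ)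
  exact isNoetherian_of_tower k inferInstance

instance isArtinianRing_op : IsArtinianRing (R : Type t)ᵐᵒᵖ := by
  have h1 : Module.Finite k (R : Type t)ᵐᵒᵖ :=
    Module.Finite.equiv (MulOpposite.opLinearEquiv k : R ≃ₗ[k] (R : Type t)ᵐᵒᵖ)
  exact isArtinian_of_tower k inferInstance

lemma proj_incl (c : Fin r → k) : R.str.proj (R.str.incl c) = c :=
  DFunLike.congr_fun R.str.proj_incl c

lemma mem_M {x : R} : x ∈ R.M ↔ R.str.proj x = 0 := RingHom.mem_ker

lemma mem_Mi {x : R} {i : Fin r} : x ∈ R.Mi i ↔ R.str.proj x i = 0 := RingHom.mem_ker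

lemma sub_algebraMap_mem_Mi (x : R) (i : Fin r) :
    x - algebraMap k R (R.str.proj x i) ∈ R.Mi i := by
  rw [mem_Mi, map_sub, AlgHom.commutes]
  simp

variable {N : Type t'} [AddCommGroup N] [Module (R : Type t)ᵐᵒᵖ N]

/-- Otherwise every nonzero element could be moved by `M` to a nonzero one, and iterating would give
nonzero elements of `n M ^ j` for every `j`, against nilpotency. -/
lemma exists_ne_zero_M_smul_eq_zero [Nontrivial N] :
    ∃ n : N, n ≠ 0 ∧ ∀ x ∈ R.M, op x • n = 0 := by
  by_contra! hcon
  obtain ⟨n, hn⟩ := exists_ne (0 : N)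
  have key : ∀ j : ℕ, ∃ y ∈ R.M ^ j, op y • n ≠ 0 := by
    intro j
    induction j with
    | zero => exact ⟨1, by rw [Submodule.pow_zero, Ideal.one_eq_top]; trivial, by simpa using hn⟩
    | succ j ih =>
      obtain ⟨y, hy, hyn⟩ := ih
      obtain ⟨x, hx, hxn⟩ := hcon _ hyn
      refine ⟨y * x, ?_, ?_⟩
      · rw [Submodule.pow_succ]; exact Ideal.mul_mem_mul hy hx
      · rwa [MulOpposite.op_mul, mul_smul]
  obtain ⟨m, hm⟩ := R.str.nilp
  obtain ⟨y, hy, hyn⟩ := key m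
  have : y = 0 := by
    have h1 : R.M ^ m = ⊥ := hm
    rwa [h1] at hy
  exact hyn (by rw [this, MulOpposite.op_zero, zero_smul])

lemma sum_incl_single : ∑ i, R.str.incl (Pi.single i 1) = 1 := by
  rw [← map_sum, Finset.univ_sum_single (fun _ : Fin r => (1 : k))]
  exact map_one _

/-- Cut an element killed by `M` with an idempotent `e_i` that does not annihilate it; `e_i x ∈ M`
for `x ∈ M_i`. In a simple module the result is a generator, so the module is `R / M_i`. -/
lemma exists_ne_zero_Mi_smul_eq_zero [Nontrivial N] :
    ∃ (i : Fin r) (n : N), n ≠ 0 ∧ ∀ x ∈ R.Mi i, op x • n = 0 := by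
  obtain ⟨n, hn, hM⟩ := R.exists_ne_zero_M_smul_eq_zero (N := N)
  obtain ⟨i, hi⟩ : ∃ i, op (R.str.incl (Pi.single i 1)) • n ≠ 0 := by
    by_contra! hcon
    apply hn
    rw [← one_smul (R : Type t)ᵐᵒᵖ n, ← MulOpposite.op_one, ← R.sum_incl_single,
      Finset.op_sum, Finset.sum_smul]
    exact Finset.sum_eq_zero fun i _ => hcon i
  refine ⟨i, _, hi, fun x hx => ?_⟩
  rw [smul_smul, ← MulOpposite.op_mul]
  apply hM
  rw [mem_M, map_mul, proj_incl]
  rw [mem_Mi] at hx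
  funext j
  by_cases h : j = i
  · subst h; simp [hx]
  · simp [h]

end Art

/-! ### Vanishing of `Tor₁` and reduction of flatness to simple modules -/

section Tor

variable {k : Type uk} [Field k] {A : Type u} [Category.{v} A] [Abelian A] [Linear k A]
  {R : Type t} [Ring R] [Algebra k R] {P : A} (ρ : R →ₐ[k] End P)

/-- The vanishing of `Tor₁(N, P)`: the functor `- ⊗_R P` preserves the exactness of all short
exact sequences ending in `N`. -/
def TorVanish (N : Type t) [AddCommGroup N] [Module Rᵐᵒᵖ N] : Prop :=
  ∀ (N₁ N₂ : Type t) [AddCommGroup N₁] [AddCommGroup N₂] [Module Rᵐᵒᵖ N₁] [Module Rᵐᵒᵖ N₂]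
    [Module.FinitePresentation Rᵐᵒᵖ N₁] [Module.FinitePresentation Rᵐᵒᵖ N₂]
    (f : N₁ →ₗ[Rᵐᵒᵖ] N₂) (g : N₂ →ₗ[Rᵐᵒᵖ] N), Function.Injective f → Function.Exact f g →
    Function.Surjective g → Mono (tensorMap ρ f)

variable {N : Type t} [AddCommGroup N] [Module Rᵐᵒᵖ N]

lemma torVanish_of_subsingleton [Subsingleton N] : TorVanish ρ N := by
  intro N₁ N₂ _ _ _ _ _ _ f g hf h hg
  have hbij : Function.Bijective f := ⟨hf, fun n => (h n).1 (Subsingleton.elim _ _)⟩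
  have : f = (LinearEquiv.ofBijective f hbij : N₁ →ₗ[Rᵐᵒᵖ] N₂) := rfl
  rw [this]
  infer_instance

/-- With `L` the preimage of `N'` in `N₂`, the map factors as `N₁ → L → N₂` with cokernels `N'` and
`N / N'`, and each factor stays a monomorphism. -/
lemma torVanish_of_submodule [IsNoetherianRing Rᵐᵒᵖ] (N' : Submodule Rᵐᵒᵖ N)
    (h' : TorVanish ρ N') (h'' : TorVanish ρ (N ⧸ N')) : TorVanish ρ N := by
  intro N₁ N₂ _ _ _ _ _ _ f g hf h hg
  let L : Submodule Rᵐᵒᵖ N₂ := N'.comap g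
  have : Module.FinitePresentation Rᵐᵒᵖ L := Module.finitePresentation_of_finite _ _
  have hfL : ∀ n, f n ∈ L := fun n => by
    change g (f n) ∈ N'
    rw [h.apply_apply_eq_zero]; exact zero_mem _
  let f' : N₁ →ₗ[Rᵐᵒᵖ] L := f.codRestrict L hfL
  let g' : L →ₗ[Rᵐᵒᵖ] N' := g.restrict (fun x hx => hx)
  have h1 : Mono (tensorMap ρ f') := by
    refine h' N₁ L f' g' (fun a b hab => hf (congrArg Subtype.val hab)) ?_ ?_
    · intro x
      constructor
      · intro hx
        obtain ⟨y, hy⟩ := (h x.1).1 (congrArg Subtype.val hx)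
        exact ⟨y, Subtype.ext hy⟩
      · rintro ⟨y, rfl⟩
        exact Subtype.ext (h.apply_apply_eq_zero y)
    · rintro ⟨n, hn⟩
      obtain ⟨x, rfl⟩ := hg n
      exact ⟨⟨x, hn⟩, rfl⟩
  have h2 : Mono (tensorMap ρ L.subtype) := by
    refine h'' L N₂ L.subtype (N'.mkQ.comp g) L.injective_subtype ?_
      (N'.mkQ_surjective.comp hg)
    intro x
    rw [LinearMap.comp_apply, Submodule.mkQ_apply, Submodule.Quotient.mk_eq_zero]
    exact ⟨fun hx => ⟨⟨x, hx⟩, rfl⟩, by rintro ⟨y, rfl⟩; exact y.2⟩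
  have h3 : tensorMap ρ f = tensorMap ρ f' ≫ tensorMap ρ L.subtype := by
    rw [tensorMap_comp]; rfl
  rw [h3]
  exact mono_comp _ _

/-- If `0 → N₀ → Q → N → 0` is exact with `Q` projective and `N₀ ⊗ P ⟶ Q ⊗ P` is a monomorphism
then `Tor₁(N, P)` vanishes. -/
lemma torVanish_of_presentation [IsNoetherianRing Rᵐᵒᵖ] {N₀ Q : Type t} [AddCommGroup N₀] [AddCommGroup Q]
    [Module Rᵐᵒᵖ N₀] [Module Rᵐᵒᵖ Q] [Module.FinitePresentation Rᵐᵒᵖ N₀]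
    [Module.FinitePresentation Rᵐᵒᵖ Q] [Module.Projective Rᵐᵒᵖ Q] (i : N₀ →ₗ[Rᵐᵒᵖ] Q)
    (π : Q →ₗ[Rᵐᵒᵖ] N) (hπ : Function.Surjective π) (hex : Function.Exact i π) (hmono : Mono (tensorMap ρ i)) :
    TorVanish ρ N := by
  intro N₁ N₂ _ _ _ _ _ _ f g hf h hg
  -- The lift `l` of `π` restricts to `u' : N₀ → N₁`, and `N₂` becomes the pushout of `Q` and `N₁`
  -- over `N₀`, expressed by the exactness of `N₀ → Q × N₁ → N₂ → 0`.
  obtain ⟨l, hl⟩ := Module.projective_lifting_property g π hg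
  have hl' : ∀ q, g (l q) = π q := fun q => LinearMap.congr_fun hl q
  choose u hu using fun n₀ : N₀ => (h (l (i n₀))).1 (by rw [hl', hex.apply_apply_eq_zero])
  let u' : N₀ →ₗ[Rᵐᵒᵖ] N₁ :=
    { toFun := u
      map_add' := fun a b => hf (by simp only [hu, map_add])
      map_smul' := fun a b => hf (by simp only [hu, map_smul, RingHom.id_apply]) }
  have hu' : ∀ n₀, f (u' n₀) = l (i n₀) := hu
  have : Module.FinitePresentation Rᵐᵒᵖ (Q × N₁) := Module.finitePresentation_of_finite _ _
  let f₀ : N₀ →ₗ[Rᵐᵒᵖ] Q × N₁ := i.prod (-u')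
  let g₀ : Q × N₁ →ₗ[Rᵐᵒᵖ] N₂ := l.coprod f
  have hex₀ : Function.Exact f₀ g₀ := by
    rintro ⟨q, n₁⟩
    constructor
    · intro hq
      have hq' : l q + f n₁ = 0 := hq
      obtain ⟨n₀, rfl⟩ := (hex q).1 (by
        rw [← hl', eq_neg_of_add_eq_zero_left hq', map_neg, h.apply_apply_eq_zero, neg_zero])
      refine ⟨n₀, Prod.ext rfl (hf ?_)⟩
      change f (-u' n₀) = f n₁
      rw [map_neg, hu', eq_neg_of_add_eq_zero_right hq']
    · rintro ⟨n₀, hn₀⟩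
      rw [← hn₀]
      change l (i n₀) + f (-u' n₀) = 0
      rw [map_neg, hu', add_neg_cancel]
  have hg₀ : Function.Surjective g₀ := by
    intro n
    obtain ⟨q, hq⟩ := hπ (g n)
    obtain ⟨n₁, hn₁⟩ := (h (n - l q)).1 (by rw [map_sub, hl', hq, sub_self])
    exact ⟨(q, n₁), by change l q + f n₁ = n; rw [hn₁]; abel⟩
  let inl := pushout.inl (tensorMap ρ i) (tensorMap ρ u')
  let inr := pushout.inr (tensorMap ρ i) (tensorMap ρ u')
  -- By right exactness `N₂ ⊗ P` maps to the pushout of `i ⊗ P` and `u' ⊗ P`. Preceded by `f ⊗ P`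
  -- this is `inr`, a monomorphism because it is the pushout of `i ⊗ P`.
  obtain ⟨d, hd⟩ := tensorMap_exists_desc ρ f₀ g₀ hex₀ hg₀
    (tensorMap ρ (LinearMap.fst Rᵐᵒᵖ Q N₁) ≫ inl + tensorMap ρ (LinearMap.snd Rᵐᵒᵖ Q N₁) ≫ inr) (by
      have h1 : tensorMap ρ (-u') = -tensorMap ρ u' := tensor_hom_ext ρ fun n => by
        rw [tensorMk_map, Preadditive.comp_neg, tensorMk_map, LinearMap.neg_apply, map_neg]
      rw [Preadditive.comp_add, ← Category.assoc, ← Category.assoc, tensorMap_comp,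
        tensorMap_comp, LinearMap.fst_prod, LinearMap.snd_prod, h1, Preadditive.neg_comp,
        pushout.condition, add_neg_cancel])
  have key : tensorMap ρ f ≫ d = inr := by
    have h1 : f = g₀.comp (LinearMap.inr Rᵐᵒᵖ Q N₁) := (LinearMap.coprod_inr l f).symm
    rw [h1, ← tensorMap_comp, Category.assoc, hd, Preadditive.comp_add, ← Category.assoc,
      ← Category.assoc, tensorMap_comp, tensorMap_comp, LinearMap.fst_comp_inr,
      LinearMap.snd_comp_inr, tensorMap_id, Category.id_comp]
    have h2 : tensorMap ρ (0 : N₁ →ₗ[Rᵐᵒᵖ] Q) = 0 := tensor_hom_ext ρ fun n => by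
      rw [tensorMk_map, comp_zero, LinearMap.zero_apply, map_zero]
    rw [h2, zero_comp, zero_add]
  have : Mono (tensorMap ρ f ≫ d) := by rw [key]; infer_instance
  exact mono_of_mono _ d

/-- A finitely presented module over an Artinian ring has finite length, and vanishing of `Tor₁`
passes to extensions. -/
lemma isFlat_of_simple [IsArtinianRing Rᵐᵒᵖ]
    (h : ∀ (N : Type t) [AddCommGroup N] [Module Rᵐᵒᵖ N] [IsSimpleModule Rᵐᵒᵖ N],
      TorVanish ρ N) : IsFlat ρ := by
  have key : ∀ (N : Type t) [AddCommGroup N] [Module Rᵐᵒᵖ N], IsFiniteLength Rᵐᵒᵖ N →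
      TorVanish ρ N := by
    intro N _ _ hN
    induction hN with
    | of_subsingleton => exact torVanish_of_subsingleton ρ
    | @of_simple_quotient M _ _ N' _ _ ih => exact torVanish_of_submodule ρ N' ih (h _)
  intro N₁ N₂ N₃ _ _ _ _ _ _ _ _ _ f g hf hfg hg
  have hN : IsFiniteLength Rᵐᵒᵖ N₃ :=
    isFiniteLength_iff_isNoetherian_isArtinian.2 ⟨inferInstance, inferInstance⟩
  exact
    { exact := tensorMap_exact ρ f g hfg hg
      mono_f := key N₃ hN N₁ N₂ f g hf hfg hg
      epi_g := epi_tensorMap ρ g hg }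

end Tor

end NCDef

/-! ### The objects of a relatively projective tower as deformations -/

namespace NCDef

section QuotLift

variable {k : Type uk} [Field k] {R : Type t} [Ring R] [Algebra k R] (I : Ideal R) [I.IsTwoSided]
  {G : Type t'} [AddCommGroup G] (β : R →+ G) (hβ : ∀ x ∈ I, β x = 0)

/-- The additive map on the right module `R / I` induced by an additive map on `R`. -/
def RightRes.quotLift : RightRes (Ideal.Quotient.mkₐ k I) →+ G :=
  AddMonoidHom.mk' (fun s => β (Function.surjInv Ideal.Quotient.mk_surjective s.val))
    (fun a b => by
      rw [← map_add, ← sub_eq_zero, ← map_sub]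
      apply hβ
      rw [← Ideal.Quotient.eq, map_add]
      simp only [Function.surjInv_eq]
      rfl)

lemma RightRes.quotLift_mk (x : R) :
    RightRes.quotLift (k := k) I β hβ (RightRes.mk _ (Ideal.Quotient.mk I x)) = β x := by
  change β _ = β x
  rw [← sub_eq_zero, ← map_sub]
  apply hβ
  rw [← Ideal.Quotient.eq]
  exact Function.surjInv_eq Ideal.Quotient.mk_surjective _

lemma RightRes.exists_mk (s : RightRes (Ideal.Quotient.mkₐ k I)) :
    ∃ x : R, RightRes.mk _ (Ideal.Quotient.mk I x) = s :=
  Ideal.Quotient.mk_surjective s.val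

lemma RightRes.op_smul_quot_mk (a x : R) :
    op a • RightRes.mk (Ideal.Quotient.mkₐ k I) (Ideal.Quotient.mk I x) =
      RightRes.mk (Ideal.Quotient.mkₐ k I) (Ideal.Quotient.mk I (x * a)) := by
  rw [RightRes.op_smul_mk, map_mul]; rfl

lemma RightRes.op_smul_quot_one (a : R) :
    op a • RightRes.mk (Ideal.Quotient.mkₐ k I) 1 =
      RightRes.mk (Ideal.Quotient.mkₐ k I) (Ideal.Quotient.mk I a) := by
  rw [RightRes.op_smul_mk, one_mul]; rfl

lemma RightRes.quotLift_bijective (h : ∀ x, β x = 0 → x ∈ I) (hs : Function.Surjective β) :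
    Function.Bijective (RightRes.quotLift (k := k) I β hβ) := by
  constructor
  · rw [injective_iff_map_eq_zero]
    intro s hs
    obtain ⟨x, rfl⟩ := RightRes.exists_mk I s
    rw [RightRes.quotLift_mk] at hs
    exact Ideal.Quotient.eq_zero_iff_mem.2 (h x hs)
  · intro g
    obtain ⟨x, rfl⟩ := hs g
    exact ⟨_, RightRes.quotLift_mk I β hβ x⟩

end QuotLift

variable {A : Type u} [Category.{v} A] [Abelian A] {r : ℕ} {F : Fin r → A}

section Kernel

variable [HasExt.{w} A] {P : ℕ → A} {pr : ∀ n, P (n + 1) ⟶ P n} {b : ∀ n, P n ⟶ ⨁ F}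
  (h : IsProjTower.{w} (⨁ F) P pr b) {n : ℕ}

include h

lemma IsProjTower.filt_kernel_base_π (i : Fin r) :
    Filt (⨁ F) (n + 1) (kernel (b n ≫ biproduct.π F i)) := by
  refine h.filt_kernel _ ?_ n
  refine (IsSummand.self (⨁ F)).of_retract (kernel.ι _)
    (kernel.lift _ (𝟙 _ - biproduct.π F i ≫ biproduct.ι F i) (by
      simp [Preadditive.sub_comp])) ?_
  rw [← cancel_mono (kernel.ι (biproduct.π F i)), Category.assoc, kernel.lift_ι,
    Preadditive.comp_sub, kernel.condition_assoc]
  simp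

lemma IsProjTower.filt_kernel_base : Filt (⨁ F) (n + 1) (kernel (b n)) := by
  have h1 := h.filt_kernel (𝟙 (⨁ F)) ((IsSummand.self (⨁ F)).of_retract (kernel.ι _) 0 (by
    rw [← cancel_mono (kernel.ι (𝟙 (⨁ F)))]
    simpa using (kernel.condition (𝟙 (⨁ F))).symm)) n
  rwa [Category.comp_id] at h1

end Kernel

variable {k : Type uk} [Field k] [Linear k A]

/-- The endomorphism of `⨁ F` given by the scalars `c i` on `F i`. -/
abbrev diag (F : Fin r → A) (c : Fin r → k) : ⨁ F ⟶ ⨁ F :=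
  biproduct.map fun i => c i • 𝟙 (F i)

lemma diag_π (c : Fin r → k) (i : Fin r) :
    diag F c ≫ biproduct.π F i = c i • biproduct.π F i := by
  rw [biproduct.map_π, Linear.comp_smul, Category.comp_id]

lemma diag_zero : diag F (0 : Fin r → k) = 0 := biproduct.hom_ext _ _ fun i => by
  rw [diag_π, zero_comp, Pi.zero_apply, zero_smul]

lemma IsSimpleCollection.diag_injective (hF : IsSimpleCollection k F) :
    Function.Injective (diag (k := k) F) := fun c d h => funext fun i => by
  apply hF.smul_injective i
  have := biproduct.ι F i ≫= h =≫ biproduct.π F i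
  simpa using this

lemma IsSimpleCollection.finite_end (hF : IsSimpleCollection k F) :
    Module.Finite k (⨁ F ⟶ ⨁ F) := by
  let f : (Fin r → k) →ₗ[k] (⨁ F ⟶ ⨁ F) :=
    { toFun := diag F
      map_add' := fun c d => biproduct.hom_ext _ _ fun i => by
        rw [Preadditive.add_comp, diag_π, diag_π, diag_π, Pi.add_apply, add_smul]
      map_smul' := fun c d => biproduct.hom_ext _ _ fun i => by
        rw [Linear.smul_comp, diag_π, diag_π, RingHom.id_apply, smul_smul]; rfl }
  exact Module.Finite.of_surjective f fun g => by
    obtain ⟨c, rfl⟩ := hF.exists_eq_map g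
    exact ⟨c, rfl⟩

/-- The action `ρ` of `R` on `X` is compatible with the morphism `b : X ⟶ ⨁ F`, where `R` acts on
`F i` through the `i`-th component of `R → k^r`. -/
def IsCompatible {R : Art.{uk, t} k r} {X : A} (ρ : R →ₐ[k] End X) (b : X ⟶ ⨁ F) : Prop :=
  ∀ x, (ρ x : X ⟶ X) ≫ b = b ≫ diag F (R.str.proj x)

/-! ### Evaluation on objects of bounded length -/

namespace IsProjTower

variable [HasExt.{w} A] {P : ℕ → A} {pr : ∀ n, P (n + 1) ⟶ P n} {b : ∀ n, P n ⟶ ⨁ F}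
  (h : IsProjTower.{w} (⨁ F) P pr b) (hF : IsSimpleCollection k F)
  {R : Art.{uk, t} k r} {n : ℕ} {ρ : R →ₐ[k] End (P n)} (hb : IsCompatible ρ (b n))

include h hF

lemma finitePresentation_homMod {m : ℕ} {X : A} (hX : Filt (⨁ F) m X) :
    Module.FinitePresentation (R : Type t)ᵐᵒᵖ (HomMod ρ X) := by
  have := hF.finite_end
  have := h.finite_hom k n hX
  exact HomMod.finitePresentation ρ

lemma exists_eq_base_diag (f : P n ⟶ ⨁ F) : ∃ c : Fin r → k, f = b n ≫ diag F c := by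
  obtain ⟨g, rfl⟩ := h.fac_base (IsSummand.self _) n f
  obtain ⟨c, rfl⟩ := hF.exists_eq_map g
  exact ⟨c, rfl⟩

lemma base_diag_injective {c d : Fin r → k} (hcd : b n ≫ diag F c = b n ≫ diag F d) : c = d := by
  have := h.epi_base n
  exact hF.diag_injective ((cancel_epi (b n)).1 hcd)

omit hF in
lemma epi_ev_base [Module.FinitePresentation (R : Type t)ᵐᵒᵖ (HomMod ρ (⨁ F))] :
    Epi (HomMod.ev ρ (X := ⨁ F)) := by
  have : Epi (tensorMk ρ _ (HomMod.mk ρ (b n)) ≫ HomMod.ev ρ (X := ⨁ F)) := by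
    rw [HomMod.tensorMk_ev]
    exact h.epi_base n
  exact epi_of_epi (tensorMk ρ _ (HomMod.mk ρ (b n))) _

include hb

/-- Every map `P n ⟶ ⨁ F` is `b n` followed by a diagonal matrix, and the subalgebra `k^r` of `R`
already realizes all of these. -/
lemma exists_action_comp_base (f : P n ⟶ ⨁ F) : ∃ x : R, (ρ x : P n ⟶ P n) ≫ b n = f := by
  obtain ⟨c, rfl⟩ := h.exists_eq_base_diag hF f
  exact ⟨R.str.incl c, by rw [hb, R.proj_incl]⟩

lemma action_comp_base_eq_zero_iff (x : R) : (ρ x : P n ⟶ P n) ≫ b n = 0 ↔ x ∈ R.M := by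
  rw [hb, R.mem_M]
  constructor
  · intro hx
    apply h.base_diag_injective hF
    rw [hx, diag_zero, comp_zero]
  · intro hx
    rw [hx, diag_zero, comp_zero]

lemma exists_action_comp_base_π (i : Fin r) (f : P n ⟶ F i) :
    ∃ x : R, (ρ x : P n ⟶ P n) ≫ b n ≫ biproduct.π F i = f := by
  obtain ⟨x, hx⟩ := h.exists_action_comp_base hF hb (f ≫ biproduct.ι F i)
  exact ⟨x, by rw [← Category.assoc, hx, Category.assoc, biproduct.ι_π_self, Category.comp_id]⟩

lemma action_comp_base_π_eq_zero_iff (i : Fin r) (x : R) :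
    (ρ x : P n ⟶ P n) ≫ b n ≫ biproduct.π F i = 0 ↔ x ∈ R.Mi i := by
  rw [← Category.assoc, hb, Category.assoc, diag_π, R.mem_Mi]
  constructor
  · intro hx
    have := h.epi_base n
    rw [← comp_zero (f := b n), cancel_epi] at hx
    apply hF.smul_injective i
    have := biproduct.ι F i ≫= hx
    simpa using this
  · intro hx
    rw [hx, zero_smul, comp_zero]

-- The length bound makes `Hom(P n, -)` exact along the filtration, and `⨁ F` itself is covered
-- because `b n` is an epimorphism.
omit hb in
lemma epi_ev {m : ℕ} {X : A} (hX : Filt (⨁ F) m X) (hm : m ≤ n + 1)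
    [inst : Module.FinitePresentation (R : Type t)ᵐᵒᵖ (HomMod ρ X)] : Epi (HomMod.ev ρ (X := X)) := by
  have hY : Module.FinitePresentation (R : Type t)ᵐᵒᵖ (HomMod ρ (⨁ F)) :=
    h.finitePresentation_homMod hF (Filt.of_isSummand (IsSummand.self _))
  revert inst
  induction hX with
  | zero hX =>
    intro inst
    have := HomMod.isIso_ev_of_isZero ρ hX
    infer_instance
  | @succ m S hS h₁ h₃ ih =>
    intro inst
    have i₁ : Module.FinitePresentation (R : Type t)ᵐᵒᵖ (HomMod ρ S.X₁) :=
      h.finitePresentation_homMod hF (Filt.of_isSummand h₁)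
    have i₃ : Module.FinitePresentation (R : Type t)ᵐᵒᵖ (HomMod ρ S.X₃) :=
      h.finitePresentation_homMod hF h₃
    refine HomMod.epi_ev_of_shortExact ρ hS ?_ ?_ (ih (by lia))
    · intro f
      exact h.exists_lift hS h₁ h₃ n (by lia) f
    · obtain ⟨J, _, s, t, hst⟩ := h₁
      have hepi := h.epi_ev_base (ρ := ρ)
      refine Preadditive.epi_of_cancel_zero _ fun {W} q hq => ?_
      rw [← Category.id_comp q, ← hst, Preadditive.sum_comp]
      refine Finset.sum_eq_zero fun a _ => ?_
      have : t a ≫ q = 0 := by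
        rw [← cancel_epi (HomMod.ev ρ (X := ⨁ F)), comp_zero, ← Category.assoc, ← HomMod.map_ev,
          Category.assoc, hq, comp_zero]
      rw [Category.assoc, this, comp_zero]

/-- Present `⨁ F` as a quotient of `P n`, where evaluation is an isomorphism. On the kernel, of
length `n + 1`, an epimorphism is enough, which `epi_ev` supplies. -/
lemma isIso_ev_base (hρ : Function.Bijective ρ)
    [Module.FinitePresentation (R : Type t)ᵐᵒᵖ (HomMod ρ (⨁ F))] :
    IsIso (HomMod.ev ρ (X := ⨁ F)) := by
  let S : ShortComplex A := ShortComplex.mk (kernel.ι (b n)) (b n) (kernel.condition _)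
  have := h.epi_base n
  have hS : S.ShortExact := { exact := ShortComplex.exact_kernel (b n) }
  have i₁ : Module.FinitePresentation (R : Type t)ᵐᵒᵖ (HomMod ρ S.X₁) :=
    h.finitePresentation_homMod hF (h.filt_kernel_base)
  have i₂ : Module.FinitePresentation (R : Type t)ᵐᵒᵖ (HomMod ρ S.X₂) :=
    h.finitePresentation_homMod hF (h.filt n)
  have i₃ : Module.FinitePresentation (R : Type t)ᵐᵒᵖ (HomMod ρ S.X₃) := by assumption
  refine HomMod.isIso_ev_of_presentation ρ (S := S) hS ?_ ?_ ?_
  · intro f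
    obtain ⟨x, hx⟩ := h.exists_action_comp_base hF hb f.val
    exact ⟨HomMod.mk ρ (ρ x : P n ⟶ P n), hx⟩
  · exact h.epi_ev hF (h.filt_kernel_base) le_rfl
  · exact HomMod.isIso_ev_self ρ hρ

lemma isIso_ev (hρ : Function.Bijective ρ) {m : ℕ} {X : A} (hX : Filt (⨁ F) m X) (hm : m ≤ n + 1)
    [inst : Module.FinitePresentation (R : Type t)ᵐᵒᵖ (HomMod ρ X)] : IsIso (HomMod.ev ρ (X := X)) := by
  have hY : Module.FinitePresentation (R : Type t)ᵐᵒᵖ (HomMod ρ (⨁ F)) :=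
    h.finitePresentation_homMod hF (Filt.of_isSummand (IsSummand.self _))
  revert inst
  induction hX with
  | zero hX => intro inst; exact HomMod.isIso_ev_of_isZero ρ hX
  | @succ m S hS h₁ h₃ ih =>
    intro inst
    have i₁ : Module.FinitePresentation (R : Type t)ᵐᵒᵖ (HomMod ρ S.X₁) :=
      h.finitePresentation_homMod hF (Filt.of_isSummand h₁)
    have i₃ : Module.FinitePresentation (R : Type t)ᵐᵒᵖ (HomMod ρ S.X₃) :=
      h.finitePresentation_homMod hF h₃
    refine HomMod.isIso_ev_of_shortExact ρ hS ?_ ?_ (ih (by lia))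
    · intro f
      exact h.exists_lift hS h₁ h₃ n (by lia) f
    · exact HomMod.isIso_ev_of_isSummand ρ h₁ (h.isIso_ev_base hF hb hρ)

end IsProjTower

/-! ### Flatness of `P n` over its endomorphism ring -/

section Flat

variable [HasExt.{w} A] {P : ℕ → A} {pr : ∀ n, P (n + 1) ⟶ P n} {b : ∀ n, P n ⟶ ⨁ F}
  (h : IsProjTower.{w} (⨁ F) P pr b) (hF : IsSimpleCollection k F)
  {R : Art.{uk, v} k r} {n : ℕ} {ρ : R →ₐ[k] End (P n)} (hb : IsCompatible ρ (b n))

include h hF hb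

/-- A simple module is `R / M_i`, the quotient of `R ≅ Hom(P n, P n)` by `Hom(P n, K)` with `K` the
kernel of `P n ⟶ F i`. Through evaluation, the tensored inclusion is identified with `K ⟶ P n`. -/
lemma IsProjTower.isFlat (hρ : Function.Bijective ρ) : IsFlat ρ := by
  refine isFlat_of_simple ρ fun N _ _ _ => ?_
  have := IsSimpleModule.nontrivial (R : Type v)ᵐᵒᵖ N
  obtain ⟨i, n₀, hn₀, hi⟩ := R.exists_ne_zero_Mi_smul_eq_zero (N := N)
  let S : ShortComplex A := ShortComplex.mk (kernel.ι (b n ≫ biproduct.π F i))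
    (b n ≫ biproduct.π F i) (kernel.condition _)
  have hS : S.Exact := ShortComplex.exact_kernel _
  have i₁ : Module.FinitePresentation (R : Type v)ᵐᵒᵖ (HomMod ρ S.X₁) :=
    h.finitePresentation_homMod hF (h.filt_kernel_base_π i)
  have i₂ : Module.FinitePresentation (R : Type v)ᵐᵒᵖ (HomMod ρ S.X₂) :=
    h.finitePresentation_homMod hF (h.filt n)
  have hm : Mono S.f := inferInstanceAs (Mono (kernel.ι _))
  let e : (R : Type v)ᵐᵒᵖ ≃ₗ[(R : Type v)ᵐᵒᵖ] HomMod ρ S.X₂ :=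
    LinearEquiv.ofBijective (LinearMap.toSpanSingleton _ _ (HomMod.mk ρ (𝟙 (P n)))) (by
      have h1 : ∀ a : (R : Type v)ᵐᵒᵖ, LinearMap.toSpanSingleton _ _ (HomMod.mk ρ (𝟙 (P n))) a =
          HomMod.mk ρ (ρ a.unop : P n ⟶ P n) := fun a => Category.comp_id _
      constructor
      · intro a a' haa
        rw [h1, h1] at haa
        exact unop_injective (hρ.1 haa)
      · intro f
        obtain ⟨x, hx⟩ := hρ.2 f.val
        exact ⟨op x, (h1 _).trans hx⟩)
  have he : ∀ x : R, e (op x) = HomMod.mk ρ (ρ x : P n ⟶ P n) := fun x => Category.comp_id _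
  have hproj : Module.Projective (R : Type v)ᵐᵒᵖ (HomMod ρ S.X₂) := Module.Projective.of_equiv e
  let π : HomMod ρ S.X₂ →ₗ[(R : Type v)ᵐᵒᵖ] N :=
    (LinearMap.toSpanSingleton _ _ n₀).comp e.symm.toLinearMap
  have hπ : ∀ x : R, π (HomMod.mk ρ (ρ x : P n ⟶ P n)) = op x • n₀ := fun x => by
    rw [← he]
    change LinearMap.toSpanSingleton _ _ n₀ (e.symm (e (op x))) = _
    rw [e.symm_apply_apply, LinearMap.toSpanSingleton_apply]
  refine torVanish_of_presentation ρ (HomMod.map ρ S.f) π ?_ ?_ ?_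
  · refine (LinearMap.surjective_or_eq_zero π).resolve_right fun h0 => hn₀ ?_
    rw [← one_smul (R : Type v)ᵐᵒᵖ n₀, ← MulOpposite.op_one, ← hπ, h0, LinearMap.zero_apply]
  · intro f
    rw [← HomMod.map_exact ρ hS f]
    obtain ⟨x, hx⟩ := hρ.2 f.val
    obtain rfl : HomMod.mk ρ (ρ x : P n ⟶ P n) = f := hx
    rw [hπ]
    have h2 : HomMod.map ρ S.g (HomMod.mk ρ (ρ x : P n ⟶ P n)) = 0 ↔ x ∈ R.Mi i :=
      h.action_comp_base_π_eq_zero_iff hF hb i x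
    rw [h2]
    refine ⟨fun hx0 => ?_, fun hx0 => hi x hx0⟩
    -- Modulo `R.Mi i` such an `x` would be a nonzero scalar, which cannot kill `n₀`.
    by_contra hxi
    rw [R.mem_Mi] at hxi
    have h3 := hi _ (R.sub_algebraMap_mem_Mi x i)
    rw [MulOpposite.op_sub, sub_smul, hx0, zero_sub, neg_eq_zero] at h3
    apply hn₀
    have h4 : op (algebraMap k R (R.str.proj x i)⁻¹) • op (algebraMap k R (R.str.proj x i)) • n₀ =
        n₀ := by
      rw [smul_smul, ← MulOpposite.op_mul, ← map_mul, mul_inv_cancel₀ hxi, map_one,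
        MulOpposite.op_one, one_smul]
    rw [← h4, h3, smul_zero]
  · have i₃ := h.isIso_ev hF hb hρ (h.filt_kernel_base_π i) le_rfl
    have : Mono (tensorMap ρ (HomMod.map ρ S.f) ≫ HomMod.ev ρ) := by
      rw [HomMod.map_ev]
      exact mono_comp _ _
    exact mono_of_mono _ (HomMod.ev ρ)

end Flat

end NCDef

/-! ### The deformation structure on the objects of the tower -/

namespace NCDef

variable {k : Type uk} [Field k] {A : Type u} [Category.{v} A] [Abelian A] [Linear k A] {r : ℕ}
  {F : Fin r → A}

lemma quotLift_op_smul {R : Art.{uk, t} k r} {P X : A} (ρ : R →ₐ[k] End P) (f : P ⟶ X)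
    (I : Ideal R) [I.IsTwoSided] (β : R →+ (P ⟶ X)) (hβ' : ∀ x, β x = (ρ x : P ⟶ P) ≫ f)
    (hβ : ∀ x ∈ I, β x = 0) (a : R) (s : RightRes (Ideal.Quotient.mkₐ k I)) :
    RightRes.quotLift I β hβ (op a • s) = (ρ a : P ⟶ P) ≫ RightRes.quotLift I β hβ s := by
  obtain ⟨x, rfl⟩ := RightRes.exists_mk I s
  rw [RightRes.op_smul_quot_mk, RightRes.quotLift_mk, RightRes.quotLift_mk, hβ', hβ', map_mul,
    ← Category.assoc]
  rfl

/-- The additive map `x ↦ f ∘ x`. -/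
def actionComp {R : Art.{uk, t} k r} {P X : A} (ρ : R →ₐ[k] End P) (f : P ⟶ X) : R →+ (P ⟶ X) :=
  AddMonoidHom.mk' (fun x => (ρ x : P ⟶ P) ≫ f) fun a b => by
    rw [map_add]; exact Preadditive.add_comp _ _ _ _ _ _

namespace IsProjTower

variable [HasExt.{w} A] {P : ℕ → A} {pr : ∀ n, P (n + 1) ⟶ P n} {b : ∀ n, P n ⟶ ⨁ F}
  (h : IsProjTower.{w} (⨁ F) P pr b) (hF : IsSimpleCollection k F)
  {R : Art.{uk, v} k r} {n : ℕ} {ρ : R →ₐ[k] End (P n)} (hb : IsCompatible ρ (b n))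
  (hρ : Function.Bijective ρ)

include h hF hb hρ

/-- If `f : P n ⟶ X` induces a bijection from `R / I` to `Hom(P n, X)` then it induces an
isomorphism from `R / I ⊗ P n` to `X`. -/
lemma exists_iso_quot {m : ℕ} {X : A} (hX : Filt (⨁ F) m X) (hm : m ≤ n + 1) (I : Ideal R)
    [I.IsTwoSided] (f : P n ⟶ X) (hI : ∀ x, (ρ x : P n ⟶ P n) ≫ f = 0 ↔ x ∈ I)
    (hs : ∀ g : P n ⟶ X, ∃ x, (ρ x : P n ⟶ P n) ≫ f = g) :
    ∃ φ : tensor ρ (RightRes (Ideal.Quotient.mkₐ k I)) ≅ X,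
      tensorMk ρ (RightRes (Ideal.Quotient.mkₐ k I)) (RightRes.mk _ 1) ≫ φ.hom = f := by
  have := h.finitePresentation_homMod (ρ := ρ) hF hX
  have hev := h.isIso_ev hF hb hρ hX hm
  let α := RightRes.quotLift (k := k) I (actionComp ρ f) fun x hx => (hI x).2 hx
  have hiso := HomMod.isIso_tensorDesc ρ hev α
    (quotLift_op_smul ρ f I _ (fun x => rfl) _)
    (RightRes.quotLift_bijective I _ _ (fun x hx => (hI x).1 hx) hs)
  refine ⟨asIso (tensorDesc ρ α _), ?_⟩
  rw [asIso_hom, tensorMk_desc]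
  refine (RightRes.quotLift_mk I _ _ (1 : R)).trans ?_
  change (ρ 1 : P n ⟶ P n) ≫ f = f
  rw [map_one]
  exact Category.id_comp f

/-- The isomorphisms are `exists_iso_quot` for `M` and for the `M_i`. Their compatibility is tested
on the generator 1, since `P n ⟶ R / M ⊗ P n` is an epimorphism. -/
lemma exists_isDeformation :
    ∃ φ : tensor ρ (ResM R) ≅ ⨁ F, IsDeformation R F (P n) ρ φ ∧
      tensorMk ρ (ResM R) (RightRes.mk _ 1) ≫ φ.hom = b n := by
  obtain ⟨φ, hφ⟩ := h.exists_iso_quot hF hb hρ (Filt.of_isSummand (IsSummand.self (⨁ F)))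
    (by lia) R.M (b n) (h.action_comp_base_eq_zero_iff hF hb) (h.exists_action_comp_base hF hb)
  refine ⟨φ, ⟨h.isFlat hF hb hρ, fun i => ?_⟩, hφ⟩
  obtain ⟨φi, hφi⟩ := h.exists_iso_quot hF hb hρ (Filt.of_isSummand (IsSummand.component F i))
    (by lia) (R.Mi i) (b n ≫ biproduct.π F i) (h.action_comp_base_π_eq_zero_iff hF hb i)
    (h.exists_action_comp_base_π hF hb i)
  refine ⟨φi, ?_⟩
  have hepi : Epi (tensorMk ρ (ResM R) (RightRes.mk _ 1)) := epi_tensorMk ρ _ fun s => by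
    obtain ⟨x, rfl⟩ := RightRes.exists_mk R.M s
    exact ⟨x, RightRes.op_smul_quot_one R.M x⟩
  rw [← cancel_epi (tensorMk ρ (ResM R) (RightRes.mk _ 1)), ← Category.assoc, hφ,
    ← Category.assoc, tensorMk_map]
  refine hφi.symm.trans ?_
  congr 2

end IsProjTower

end NCDef

/-! ### The endomorphism rings of a tower of universal extensions -/

namespace NCDef

variable {k : Type uk} [Field k] {A : Type u} [Category.{v} A] [Abelian A] [Linear k A]

variable (k) in
/-- If every endomorphism of `X` descends along an epimorphism `p : X ⟶ Y`, this is the resulting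
homomorphism of endomorphism algebras. -/
def endDescend {X Y : A} (p : X ⟶ Y) [Epi p]
    (h : ∀ x : X ⟶ X, ∃ y : Y ⟶ Y, x ≫ p = p ≫ y) : End X →ₐ[k] End Y where
  toFun x := (h x).choose
  map_one' := by
    rw [← cancel_epi p, ← (h _).choose_spec]
    exact (Category.id_comp p).trans (Category.comp_id p).symm
  map_mul' x y := by
    rw [← cancel_epi p, ← (h _).choose_spec]
    change (y ≫ x) ≫ p = p ≫ (h y).choose ≫ (h x).choose
    rw [← Category.assoc p, ← (h y).choose_spec, Category.assoc, Category.assoc,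
      ← (h x).choose_spec]
  map_zero' := by
    rw [← cancel_epi p, ← (h _).choose_spec]
    exact zero_comp.trans comp_zero.symm
  map_add' x y := by
    rw [← cancel_epi p, ← (h _).choose_spec]
    change (x + y) ≫ p = p ≫ ((h x).choose + (h y).choose)
    exact (Preadditive.add_comp _ _ _ _ _ _).trans ((congrArg₂ _ (h x).choose_spec
      (h y).choose_spec).trans (Preadditive.comp_add _ _ _ _ _ _).symm)
  commutes' c := by
    rw [← cancel_epi p, ← (h _).choose_spec, Algebra.algebraMap_eq_smul_one,
      Algebra.algebraMap_eq_smul_one]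
    change (c • 𝟙 X) ≫ p = p ≫ (c • 𝟙 Y)
    rw [Linear.smul_comp, Linear.comp_smul, Category.id_comp, Category.comp_id]

lemma comp_endDescend {X Y : A} (p : X ⟶ Y) [Epi p]
    (h : ∀ x : X ⟶ X, ∃ y : Y ⟶ Y, x ≫ p = p ≫ y) (x : End X) :
    x.asHom ≫ p = p ≫ (endDescend k p h x).asHom := (h x).choose_spec

variable {r : ℕ} {F : Fin r → A}

variable (k) in
/-- The homomorphism `k^r → End(⨁ X)`. -/
def diagHom (X : Fin r → A) : (Fin r → k) →ₐ[k] End (⨁ X) where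
  toFun c := diag X c
  map_one' := biproduct.hom_ext _ _ fun i => by
    rw [diag_π, Pi.one_apply, one_smul]; exact (Category.id_comp _).symm
  map_mul' c d := biproduct.hom_ext _ _ fun i => by
    change _ = (diag X d ≫ diag X c) ≫ _
    rw [Category.assoc, diag_π, diag_π, Linear.comp_smul, diag_π, smul_smul]; rfl
  map_zero' := diag_zero
  map_add' c d := biproduct.hom_ext _ _ fun i => by
    change _ = (diag X c + diag X d) ≫ _
    rw [Preadditive.add_comp, diag_π, diag_π, diag_π, Pi.add_apply, add_smul]
  commutes' c := biproduct.hom_ext _ _ fun i => by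
    rw [Algebra.algebraMap_eq_smul_one, Algebra.algebraMap_eq_smul_one, diag_π]
    change _ = (c • 𝟙 (⨁ X)) ≫ _
    rw [Linear.smul_comp, Category.id_comp, Pi.smul_apply, Pi.one_apply, smul_eq_mul, mul_one]

lemma diag_comp_map {X Z : Fin r → A} (p : ∀ i, X i ⟶ Z i) (c : Fin r → k) :
    diag X c ≫ biproduct.map p = biproduct.map p ≫ diag Z c := biproduct.hom_ext _ _ fun i => by
  simp

lemma IsSimpleCollection.diagHom_bijective (hF : IsSimpleCollection k F) :
    Function.Bijective (diagHom k F) :=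
  ⟨hF.diag_injective, fun f => by
    obtain ⟨c, hc⟩ := hF.exists_eq_map f
    exact ⟨c, hc.symm⟩⟩

variable [HasExt.{w} A]

/-- Products of `m` endomorphisms of `P n` inducing zero on `⨁ F` annihilate all morphisms to
objects with a filtration of length `m`. -/
lemma IsProjTower.comp_eq_zero_of_mem_pow {P : ℕ → A} {pr : ∀ n, P (n + 1) ⟶ P n} {Y : A}
    {b : ∀ n, P n ⟶ Y} (h : IsProjTower.{w} Y P pr b) {n : ℕ} (I : Ideal (End (P n)))
    (hI : ∀ x ∈ I, End.asHom x ≫ b n = 0) {m : ℕ} {X : A} (hX : Filt Y m X) (g : P n ⟶ X)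
    (x : End (P n)) (hx : x ∈ I ^ m) : x.asHom ≫ g = 0 := by
  induction hX generalizing x with
  | zero hX => exact hX.eq_of_tgt _ _
  | @succ m S hS h₁ h₃ ih =>
    rw [Submodule.pow_succ] at hx
    refine Submodule.smul_induction_on (p := fun y => End.asHom y ≫ g = 0) hx ?_ ?_
    · intro y hy z hz
      change (z.asHom ≫ y.asHom) ≫ g = 0
      -- By induction `y ∈ I ^ m` kills the quotient `S.X₃`, so `y ≫ g` takes values in `S.X₁`.
      -- There it factors through `b n`, which `z ∈ I` annihilates.
      have h1 : (y.asHom ≫ g) ≫ S.g = 0 := by rw [Category.assoc]; exact ih _ y hy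
      have := hS.mono_f
      obtain ⟨l, hl⟩ : ∃ l, l ≫ S.f = y.asHom ≫ g := ⟨hS.exact.lift _ h1, hS.exact.lift_f _ h1⟩
      obtain ⟨l', rfl⟩ := h.fac_base h₁ n l
      rw [Category.assoc, ← hl, ← Category.assoc, ← Category.assoc, hI z hz, zero_comp, zero_comp]
    · intro y z hy hz
      exact (Preadditive.add_comp _ _ _ _ _ _).trans (by rw [hy, hz, add_zero])

namespace UniversalTower

variable (hF : IsSimpleCollection k F) (T : UniversalTower.{w} k F)

include hF in
lemma epi_toBase (n : ℕ) : Epi (T.toBase n) := (T.isProjTower hF).epi_base n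

include hF in
lemma epi_proj (n : ℕ) : Epi (T.proj n) := (T.isProjTower hF).epi n

lemma diag_comp_toBase (n : ℕ) (c : Fin r → k) :
    (diagHom k (T.obj n) c).asHom ≫ T.toBase n = T.toBase n ≫ diag F c := by
  induction n with
  | zero => exact diag_comp_map (fun i => (T.base i).hom) c
  | succ n ih =>
    have h : (diagHom k (T.obj (n + 1)) c).asHom ≫ T.proj n ≫ T.toBase n =
        T.proj n ≫ (diagHom k (T.obj n) c).asHom ≫ T.toBase n :=
      (Category.assoc _ _ _).symm.trans
        ((congrArg (· ≫ T.toBase n) (diag_comp_map (T.p n) c)).trans (Category.assoc _ _ _))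
    exact h.trans ((congrArg (T.proj n ≫ ·) ih).trans (Category.assoc _ _ _).symm)

include hF in
lemma exists_endDescend_toBase (n : ℕ) (x : T.sum n ⟶ T.sum n) :
    ∃ y : ⨁ F ⟶ ⨁ F, x ≫ T.toBase n = T.toBase n ≫ y :=
  (T.isProjTower hF).fac_base (IsSummand.self _) n _

include hF in
lemma exists_endDescend_proj (n : ℕ) (x : T.sum (n + 1) ⟶ T.sum (n + 1)) :
    ∃ y : T.sum n ⟶ T.sum n, x ≫ T.proj n = T.proj n ≫ y :=
  (T.isProjTower hF).exists_fac_of_filt ((T.isProjTower hF).filt n) n le_rfl _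

/-- The homomorphism `End F^{(n)} → k^r`. -/
def endProj (n : ℕ) : End (T.sum n) →ₐ[k] (Fin r → k) :=
  have := T.epi_toBase hF n
  ((AlgEquiv.ofBijective (diagHom k F) hF.diagHom_bijective).symm : End (⨁ F) →ₐ[k] _).comp
    (endDescend k (T.toBase n) (T.exists_endDescend_toBase hF n))

lemma comp_toBase (n : ℕ) (x : End (T.sum n)) :
    x.asHom ≫ T.toBase n = T.toBase n ≫ diag F (T.endProj hF n x) := by
  have := T.epi_toBase hF n
  rw [comp_endDescend (k := k) (T.toBase n) (T.exists_endDescend_toBase hF n) x]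
  congr 1
  exact ((AlgEquiv.ofBijective (diagHom k F) hF.diagHom_bijective).apply_symm_apply _).symm

lemma endProj_eq_iff (n : ℕ) (x : End (T.sum n)) (c : Fin r → k) :
    T.endProj hF n x = c ↔ x.asHom ≫ T.toBase n = T.toBase n ≫ diag F c := by
  rw [T.comp_toBase hF n x]
  refine ⟨fun h => by rw [h], fun h => (T.isProjTower hF).base_diag_injective hF h⟩

/-- The structure of an object of `(Art_r)` on `End F^{(n)}`. -/
def artStr (n : ℕ) : ArtStr k r (End (T.sum n)) where
  incl := diagHom k (T.obj n)
  proj := T.endProj hF n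
  proj_incl := AlgHom.ext fun c => (T.endProj_eq_iff hF n _ c).2 (T.diag_comp_toBase n c)
  finite := by
    have := hF.finite_end
    exact (T.isProjTower hF).finite_hom k n ((T.isProjTower hF).filt n)
  -- The exponent is the filtration length of `T.sum n`, and the vanishing is applied to its
  -- identity.
  nilp := ⟨n + 1, by
    rw [eq_bot_iff]
    intro x hx
    have h1 := (T.isProjTower hF).comp_eq_zero_of_mem_pow (RingHom.ker (T.endProj hF n))
      (fun y hy => by
        rw [T.comp_toBase hF n y, (RingHom.mem_ker).1 hy, diag_zero, comp_zero])
      ((T.isProjTower hF).filt n) (𝟙 _) x hx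
    rw [Category.comp_id] at h1
    exact h1⟩

lemma artStr_incl_single (n : ℕ) (i : Fin r) :
    (T.artStr hF n).incl (Pi.single i 1) = T.idem n i := by
  apply biproduct.hom_ext
  intro j
  change diag (T.obj n) (Pi.single i 1) ≫ _ = (biproduct.π _ i ≫ biproduct.ι _ i) ≫ _
  rw [diag_π, Category.assoc]
  by_cases h : i = j
  · subst h; simp
  · rw [biproduct.ι_π_ne _ h, comp_zero, Pi.single_eq_of_ne (Ne.symm h), zero_smul]

/-- The homomorphism `End F^{(n+1)} → End F^{(n)}`. -/
def endTransition (n : ℕ) : Art.Hom (Art.of (T.artStr hF (n + 1))) (Art.of (T.artStr hF n)) where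
  toAlgHom :=
    have := T.epi_proj hF n
    endDescend k (T.proj n) (T.exists_endDescend_proj hF n)
  comp_incl := AlgHom.ext fun c => by
    have := T.epi_proj hF n
    change endDescend k (T.proj n) _ (diagHom k (T.obj (n + 1)) c) = diagHom k (T.obj n) c
    apply (cancel_epi (T.proj n)).1
    refine (comp_endDescend (k := k) (T.proj n) (T.exists_endDescend_proj hF n) _).symm.trans ?_
    exact diag_comp_map (T.p n) c
  proj_comp := AlgHom.ext fun x => by
    have := T.epi_proj hF n
    refine (T.endProj_eq_iff hF n _ _).2 ?_
    rw [← cancel_epi (T.proj n), ← Category.assoc, ← Category.assoc]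
    erw [← comp_endDescend (k := k) (T.proj n) (T.exists_endDescend_proj hF n) x]
    exact (Category.assoc _ _ _).trans (T.comp_toBase hF (n + 1) x)

lemma comp_proj (n : ℕ) (x : End (T.sum (n + 1))) :
    x.asHom ≫ T.proj n = T.proj n ≫ End.asHom ((T.endTransition hF n).toAlgHom x : End (T.sum n)) :=
  have := T.epi_proj hF n
  comp_endDescend (T.proj n) (T.exists_endDescend_proj hF n) x

/-- The obstruction to lifting an endomorphism of stage `n` to stage `n + 1` dies after pullback
along the projection. -/
lemma endTransition_surjective (n : ℕ) :
    Function.Surjective (T.endTransition hF n).toAlgHom := by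
  intro y
  have := T.epi_proj hF n
  obtain ⟨x, hx⟩ := (T.isProjTower hF).exists_lift_succ
    (S := ShortComplex.mk (kernel.ι (T.proj n)) (T.proj n) (kernel.condition _))
    { exact := ShortComplex.exact_kernel _ } ((T.isProjTower hF).ker n) n
    (End.asHom (X := T.sum n) y)
  refine ⟨(x : End (T.sum (n + 1))), ?_⟩
  apply (cancel_epi (T.proj n)).1
  exact (T.comp_proj hF n x).symm.trans hx

lemma isCompatible (n : ℕ) :
    IsCompatible (R := Art.of (T.artStr hF n)) (Art.taut (T.artStr hF n)) (T.toBase n) :=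
  T.comp_toBase hF n

lemma taut_bijective (n : ℕ) : Function.Bijective (Art.taut (T.artStr hF n)) :=
  Function.bijective_id

end UniversalTower

end NCDef

/-! ### Right modules annihilated by `M` -/

namespace NCDef

section Retract

variable {k : Type uk} [Field k] {r : ℕ} (S : Art.{uk, t} k r)
  {N : Type t'} [AddCommGroup N] [Module (S : Type t)ᵐᵒᵖ N]

/-- The additive map `x ↦ n x`. -/
def opSmulHom (n : N) : S →+ N :=
  AddMonoidHom.mk' (fun x : S => op x • n) fun a b => by rw [MulOpposite.op_add, add_smul]

lemma opSmulHom_apply (n : N) (x : S) : opSmulHom S n x = op x • n := rfl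

/-- The homomorphism `S / M → N` of right modules given by an element of a module annihilated
by `M`. -/
def ResM.toSpan (hN : ∀ x ∈ S.M, ∀ n : N, op x • n = 0) (n : N) :
    ResM S →ₗ[(S : Type t)ᵐᵒᵖ] N where
  toFun := RightRes.quotLift (k := k) S.M (opSmulHom S n)
    fun x hx => (opSmulHom_apply S n x).trans (hN x hx n)
  map_add' := map_add _
  map_smul' a s := by
    obtain ⟨x, rfl⟩ := RightRes.exists_mk S.M s
    rw [← op_unop a, RightRes.op_smul_quot_mk, RightRes.quotLift_mk, RightRes.quotLift_mk,
      RingHom.id_apply, opSmulHom_apply, opSmulHom_apply, smul_smul, MulOpposite.op_mul]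

lemma ResM.toSpan_mk (hN : ∀ x ∈ S.M, ∀ n : N, op x • n = 0) (n : N) (x : S) :
    ResM.toSpan S hN n (RightRes.mk _ (Ideal.Quotient.mk S.M x)) = op x • n :=
  RightRes.quotLift_mk S.M (opSmulHom S n) (fun x hx => hN x hx n) x

variable [Module k N] [IsScalarTower k (S : Type t)ᵐᵒᵖ N]

lemma op_incl_smul (c : Fin r → k) (n : N) :
    op (S.str.incl c) • n = ∑ i, c i • op (S.str.incl (Pi.single i 1)) • n := by
  have h : c = ∑ i, c i • (Pi.single i 1 : Fin r → k) := by
    conv_lhs => rw [pi_eq_sum_univ' c]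
  rw [← opSmulHom_apply]
  conv_lhs => rw [h, map_sum, map_sum]
  refine Finset.sum_congr rfl fun i _ => ?_
  rw [opSmulHom_apply, map_smul, MulOpposite.op_smul, smul_assoc]

/-- A module annihilated by `M` is a direct summand of a power of `S / M`. -/
lemma exists_retract_resM (hN : ∀ x ∈ S.M, ∀ n : N, op x • n = 0)
    [Module.Finite (S : Type t)ᵐᵒᵖ N] :
    ∃ (d : ℕ) (s : Fin d → (N →ₗ[(S : Type t)ᵐᵒᵖ] ResM S))
      (p : Fin d → (ResM S →ₗ[(S : Type t)ᵐᵒᵖ] N)), ∑ a, (p a).comp (s a) = LinearMap.id := by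
  have h1 : Module.Finite k (S : Type t)ᵐᵒᵖ :=
    Module.Finite.equiv (MulOpposite.opLinearEquiv k : S ≃ₗ[k] (S : Type t)ᵐᵒᵖ)
  have h2 : Module.Finite k N := Module.Finite.trans (S : Type t)ᵐᵒᵖ N
  let b := Module.finBasis k N
  -- `l a n i` is the `a`-th coordinate of `n e_i`. The `a`-th pair sends `n` to the class of `∑ i,
  -- l a n i • e_i`, then 1 to `b a`. Summing over `a` gives `∑ i, (n e_i) e_i = n`.
  let l (a) (n : N) : Fin r → k := fun i => b.repr (op (S.str.incl (Pi.single i 1)) • n) a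
  have hl : ∀ a (x : S) (n : N), l a (op x • n) = l a n * S.str.proj x := by
    intro a x n
    funext i
    have h3 : op (S.str.incl (Pi.single i 1)) • op x • n =
        S.str.proj x i • op (S.str.incl (Pi.single i 1)) • n := by
      rw [smul_smul, ← MulOpposite.op_mul, ← smul_assoc, ← MulOpposite.op_smul, ← sub_eq_zero,
        ← sub_smul, ← MulOpposite.op_sub]
      refine hN _ ?_ n
      rw [S.mem_M, map_sub, map_mul, S.proj_incl, map_smul, S.proj_incl]
      funext j
      by_cases hij : i = j
      · subst hij; simp
      · simp [Pi.single_eq_of_ne (Ne.symm hij)]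
    change b.repr _ a = b.repr _ a * _
    rw [h3, map_smul, Finsupp.smul_apply, smul_eq_mul, mul_comm]
  refine ⟨Module.finrank k N, fun a =>
    { toFun := fun n => RightRes.mk _ (Ideal.Quotient.mk S.M (S.str.incl (l a n)))
      map_add' := fun m n => ?_
      map_smul' := fun x n => ?_ }, fun a => ResM.toSpan S hN (b a), ?_⟩
  · have h3 : l a (m + n) = l a m + l a n := by
      funext i
      change b.repr _ a = b.repr _ a + b.repr _ a
      rw [smul_add, map_add, Finsupp.add_apply]
    rw [h3, map_add, map_add]
    rfl
  · rw [← op_unop x, hl, RingHom.id_apply, RightRes.op_smul_quot_mk]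
    congr 1
    rw [Ideal.Quotient.eq, S.mem_M]
    simp only [map_sub, map_mul, S.proj_incl, sub_self]
  · ext n
    rw [LinearMap.sum_apply, LinearMap.id_apply]
    have h3 : ∀ a, ((ResM.toSpan S hN (b a)) (RightRes.mk _ (Ideal.Quotient.mk S.M
        (S.str.incl (l a n))))) = ∑ i, l a n i • op (S.str.incl (Pi.single i 1)) • b a :=
      fun a => by rw [ResM.toSpan_mk, op_incl_smul]
    refine (Finset.sum_congr rfl fun a _ => h3 a).trans ?_
    rw [Finset.sum_comm]
    have h4 : ∀ i, ∑ a, l a n i • op (S.str.incl (Pi.single i 1)) • b a =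
        op (S.str.incl (Pi.single i 1)) • n := by
      intro i
      have h5 : ∀ a, l a n i • op (S.str.incl (Pi.single i 1)) • b a =
          op (S.str.incl (Pi.single i 1)) • l a n i • b a := fun a => by
        rw [← algebraMap_smul (S : Type t)ᵐᵒᵖ (l a n i) (b a), smul_smul,
          ← Algebra.commutes, ← smul_smul, algebraMap_smul]
      rw [Finset.sum_congr rfl fun a _ => h5 a, ← Finset.smul_sum]
      change _ • ∑ a, b.repr (op (S.str.incl (Pi.single i 1)) • n) a • b a = _
      rw [b.sum_repr, smul_smul, ← MulOpposite.op_mul, ← map_mul, ← Pi.single_mul, mul_one]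
    simp_rw [h4, ← opSmulHom_apply]
    rw [← map_sum, S.sum_incl_single, opSmulHom_apply, MulOpposite.op_one, one_smul]

end Retract

variable {k : Type uk} [Field k] {A : Type u} [Category.{v} A] [Abelian A] [Linear k A] {r : ℕ}
  {F : Fin r → A} {S : Art.{uk, t} k r}

namespace Deformation

variable (D : Deformation S F)

/-- Tested on each `F i ≅ S / M_i ⊗ X`, where `x` acts by a scalar because `S / M_i = k`; this is
where the condition on the `F i` in a deformation enters. -/
lemma isCompatible : IsCompatible D.ρ D.toSum := by
  intro x
  apply biproduct.hom_ext
  intro i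
  obtain ⟨φi, hφi⟩ := D.isDeformation.induces i
  have h1 : op x • RightRes.mk (Ideal.Quotient.mkₐ k (S.Mi i)) 1 =
      S.str.proj x i • RightRes.mk (Ideal.Quotient.mkₐ k (S.Mi i)) 1 := by
    rw [← algebraMap_smul (S : Type t)ᵐᵒᵖ (S.str.proj x i), MulOpposite.algebraMap_apply,
      RightRes.op_smul_quot_one, RightRes.op_smul_quot_one]
    exact congrArg _ (Ideal.Quotient.eq.2 (S.sub_algebraMap_mem_Mi x i))
  have h2 : D.toSum ≫ biproduct.π F i = tensorMk D.ρ (ResMi S i) (RightRes.mk _ 1) ≫ φi.hom := by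
    rw [toSum, Category.assoc, hφi, ← Category.assoc, tensorMk_map]
    rfl
  rw [Category.assoc, Category.assoc, diag_π, Linear.comp_smul, h2, ← Category.assoc,
    ← tensorMk_smul, h1, tensorMk_smul_of_isScalarTower, Linear.smul_comp]

lemma isSummand_tensor {N : Type t} [AddCommGroup N] [Module (S : Type t)ᵐᵒᵖ N]
    [Module k N] [IsScalarTower k (S : Type t)ᵐᵒᵖ N] [Module.FinitePresentation (S : Type t)ᵐᵒᵖ N]
    (hN : ∀ x ∈ S.M, ∀ n : N, op x • n = 0) : IsSummand (⨁ F) (tensor D.ρ N) := by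
  obtain ⟨d, s, p, h⟩ := exists_retract_resM S hN
  refine IsSummand.of_sum (J := Fin d) (fun _ => tensor D.ρ (ResM S))
    (fun _ => (IsSummand.self _).of_iso D.φ) (fun a => tensorMap D.ρ (s a))
    (fun a => tensorMap D.ρ (p a)) ?_
  simp_rw [tensorMap_comp]
  rw [← tensorMap_sum, h, tensorMap_id]

/-- A morphism `f : P ⟶ X` lifting a given `b : P ⟶ ⨁ F` induces a bijection from `N` to
`Hom(P, N ⊗ X)`. -/
def IsRepresented {P : A} (f : P ⟶ D.X) (N : Type t) [AddCommGroup N] [Module (S : Type t)ᵐᵒᵖ N]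
    [Module.FinitePresentation (S : Type t)ᵐᵒᵖ N] : Prop :=
  Function.Bijective fun n : N => f ≫ tensorMk D.ρ N n

section Represented

variable {P : A} {f : P ⟶ D.X}

/-- Under the hypotheses both `S / M` and `Hom(P, ⨁ F)` are copies of `k^r`. -/
lemma isRepresented_resM (hinj : ∀ c : Fin r → k, (f ≫ D.toSum) ≫ diag F c = 0 → c = 0)
    (hsurj : ∀ g : P ⟶ ⨁ F, ∃ c : Fin r → k, g = (f ≫ D.toSum) ≫ diag F c) :
    D.IsRepresented f (ResM S) := by
  have h1 : ∀ x : S, (f ≫ tensorMk D.ρ (ResM S) (RightRes.mk _ (Ideal.Quotient.mk S.M x))) ≫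
      D.φ.hom = (f ≫ D.toSum) ≫ diag F (S.str.proj x) := fun x => by
    rw [← RightRes.op_smul_quot_one, tensorMk_smul, Category.assoc, Category.assoc f,
      ← D.isCompatible, Category.assoc, toSum]
  constructor
  · intro m n hmn
    obtain ⟨x, rfl⟩ := RightRes.exists_mk S.M m
    obtain ⟨y, rfl⟩ := RightRes.exists_mk S.M n
    refine congrArg (RightRes.mk (Ideal.Quotient.mkₐ k S.M)) (Ideal.Quotient.eq.2 ?_)
    rw [S.mem_M]
    apply hinj
    rw [← h1, map_sub, ← cancel_mono D.φ.inv, Category.assoc, D.φ.hom_inv_id, Category.comp_id,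
      zero_comp]
    refine (congrArg (f ≫ ·) (map_sub (tensorMk D.ρ (ResM S)) (RightRes.mk _ _) (RightRes.mk _ _))).trans ?_
    rw [ Preadditive.comp_sub, sub_eq_zero]
    exact hmn
  · intro g
    obtain ⟨c, hc⟩ := hsurj (g ≫ D.φ.hom)
    refine ⟨RightRes.mk (Ideal.Quotient.mkₐ k S.M) (Ideal.Quotient.mk S.M (S.str.incl c)), ?_⟩
    rw [← cancel_mono D.φ.hom, hc]
    exact (h1 _).trans (by rw [S.proj_incl])

lemma isRepresented_of_retract (hM : D.IsRepresented f (ResM S)) {N : Type t} [AddCommGroup N]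
    [Module (S : Type t)ᵐᵒᵖ N]
    [Module k N] [IsScalarTower k (S : Type t)ᵐᵒᵖ N] [Module.FinitePresentation (S : Type t)ᵐᵒᵖ N]
    (hN : ∀ x ∈ S.M, ∀ n : N, op x • n = 0) : D.IsRepresented f N := by
  obtain ⟨d, s, p, h⟩ := exists_retract_resM S hN
  have h' : ∀ n, ∑ a, p a (s a n) = n := fun n => by
    have := LinearMap.congr_fun h n
    rwa [LinearMap.sum_apply] at this
  constructor
  · intro m n hmn
    rw [← h' m, ← h' n]
    refine Finset.sum_congr rfl fun a _ => congrArg _ (hM.1 ?_)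
    change f ≫ tensorMk D.ρ (ResM S) _ = f ≫ tensorMk D.ρ (ResM S) _
    rw [← tensorMk_map, ← tensorMk_map, ← Category.assoc, ← Category.assoc]
    exact congrArg (· ≫ tensorMap D.ρ (s a)) hmn
  · intro g
    choose y hy using fun a => hM.2 (g ≫ tensorMap D.ρ (s a))
    refine ⟨∑ a, p a (y a), ?_⟩
    change f ≫ tensorMk D.ρ N _ = g
    rw [map_sum, Preadditive.comp_sum]
    conv_rhs => rw [← Category.comp_id g, ← tensorMap_id, ← h, tensorMap_sum, Preadditive.comp_sum]
    refine Finset.sum_congr rfl fun a _ => ?_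
    rw [← tensorMk_map, ← tensorMap_comp, ← Category.assoc, ← Category.assoc, ← hy a]

/-- Flatness keeps the tensored sequence exact. No projectivity of `P` is needed for surjectivity:
an element `n₂` over `n₃` directly gives the lift `f ≫ (n₂ ⊗ -)`, and the error comes from `N₁`. -/
lemma isRepresented_of_exact {N₁ N₂ N₃ : Type t} [AddCommGroup N₁] [AddCommGroup N₂]
    [AddCommGroup N₃] [Module (S : Type t)ᵐᵒᵖ N₁] [Module (S : Type t)ᵐᵒᵖ N₂]
    [Module (S : Type t)ᵐᵒᵖ N₃] [Module.FinitePresentation (S : Type t)ᵐᵒᵖ N₁]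
    [Module.FinitePresentation (S : Type t)ᵐᵒᵖ N₂] [Module.FinitePresentation (S : Type t)ᵐᵒᵖ N₃]
    (i : N₁ →ₗ[(S : Type t)ᵐᵒᵖ] N₂) (q : N₂ →ₗ[(S : Type t)ᵐᵒᵖ] N₃) (hi : Function.Injective i)
    (h : Function.Exact i q) (hq : Function.Surjective q) (h₁ : D.IsRepresented f N₁)
    (h₃ : D.IsRepresented f N₃) : D.IsRepresented f N₂ := by
  have hS := D.isDeformation.flat N₁ N₂ N₃ i q hi h hq
  have hmono : Mono (tensorMap D.ρ i) := hS.mono_f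
  constructor
  · intro m n hmn
    have h1 : f ≫ tensorMk D.ρ N₂ (m - n) = 0 := by
      rw [map_sub, Preadditive.comp_sub, sub_eq_zero]; exact hmn
    have h2 : q (m - n) = 0 := by
      refine h₃.1 ?_
      change f ≫ tensorMk D.ρ N₃ _ = f ≫ tensorMk D.ρ N₃ 0
      rw [← tensorMk_map, ← Category.assoc, h1, zero_comp, map_zero, comp_zero]
    obtain ⟨l, hl⟩ := (h _).1 h2
    have h3 : l = 0 := by
      refine h₁.1 ?_
      change f ≫ tensorMk D.ρ N₁ _ = f ≫ tensorMk D.ρ N₁ 0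
      rw [← cancel_mono (tensorMap D.ρ i), Category.assoc, tensorMk_map, hl, h1, map_zero,
        comp_zero, zero_comp]
    rw [← sub_eq_zero, ← hl, h3, map_zero]
  · intro g
    obtain ⟨n₃, hn₃⟩ := h₃.2 (g ≫ tensorMap D.ρ q)
    obtain ⟨n₂, rfl⟩ := hq n₃
    have h1 : (g - f ≫ tensorMk D.ρ N₂ n₂) ≫ tensorMap D.ρ q = 0 := by
      rw [Preadditive.sub_comp, Category.assoc, tensorMk_map, ← hn₃, sub_self]
    obtain ⟨n₁, hn₁⟩ := h₁.2 (hS.exact.lift _ h1)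
    refine ⟨n₂ + i n₁, ?_⟩
    change f ≫ tensorMk D.ρ N₂ _ = g
    rw [map_add, Preadditive.comp_add, ← tensorMk_map, ← Category.assoc]
    have h2 : (f ≫ tensorMk D.ρ N₁ n₁) ≫ tensorMap D.ρ i = g - f ≫ tensorMk D.ρ N₂ n₂ := by
      rw [show f ≫ tensorMk D.ρ N₁ n₁ = _ from hn₁]
      exact hS.exact.lift_f _ h1
    rw [h2, add_sub_cancel]

end Represented

end Deformation

/-! ### The quotients `S / M ^ j ⊗ X` of a deformation -/

/-- `S / M ^ j` as a right `S`-module. -/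
abbrev ResPow (S : Art.{uk, t} k r) (j : ℕ) : Type t := RightRes (Ideal.Quotient.mkₐ k (S.M ^ j))

lemma pow_succ_M_le (S : Art.{uk, t} k r) (j : ℕ) : S.M ^ (j + 1) ≤ S.M ^ j :=
  Ideal.pow_le_pow_right j.le_succ

/-- The projection `S / M ^ (j + 1) → S / M ^ j`. -/
def resPowProj (S : Art.{uk, t} k r) (j : ℕ) :
    ResPow S (j + 1) →ₗ[(S : Type t)ᵐᵒᵖ] ResPow S j :=
  RightRes.map (Ideal.Quotient.factorₐ k (pow_succ_M_le S j)) rfl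

lemma resPowProj_mk (j : ℕ) (x : S) :
    resPowProj S j (RightRes.mk _ (Ideal.Quotient.mk _ x)) =
      RightRes.mk _ (Ideal.Quotient.mk _ x) := rfl

lemma resPowProj_surjective (j : ℕ) : Function.Surjective (resPowProj S j) := fun s => by
  obtain ⟨x, rfl⟩ := RightRes.exists_mk _ s
  exact ⟨_, resPowProj_mk j x⟩

lemma op_smul_ker_resPowProj (j : ℕ) (x : S) (hx : x ∈ S.M) (n : LinearMap.ker (resPowProj S j)) :
    op x • n = 0 := by
  obtain ⟨n, hn⟩ := n
  obtain ⟨y, rfl⟩ := RightRes.exists_mk _ n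
  rw [LinearMap.mem_ker, resPowProj_mk] at hn
  have hy : y ∈ S.M ^ j := Ideal.Quotient.eq_zero_iff_mem.1 hn
  apply Subtype.ext
  refine (RightRes.op_smul_quot_mk _ x y).trans ?_
  refine Ideal.Quotient.eq_zero_iff_mem.2 ?_
  rw [Submodule.pow_succ]
  exact Ideal.mul_mem_mul hy hx

instance (j : ℕ) :
    Module.FinitePresentation (S : Type t)ᵐᵒᵖ (LinearMap.ker (resPowProj S j)) :=
  Module.finitePresentation_of_finite _ _

lemma resPow_eq_zero (s : ResPow S 0) : s = 0 := by
  obtain ⟨x, rfl⟩ := RightRes.exists_mk _ s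
  refine Ideal.Quotient.eq_zero_iff_mem.2 ?_
  rw [Submodule.pow_zero, Ideal.one_eq_top]
  trivial

namespace Deformation

variable (D : Deformation S F)

lemma isRepresented_resPow {P : A} {f : P ⟶ D.X} (hM : D.IsRepresented f (ResM S)) (j : ℕ) :
    D.IsRepresented f (ResPow S j) := by
  induction j with
  | zero =>
    refine ⟨fun m n _ => by rw [resPow_eq_zero m, resPow_eq_zero n], fun g => ⟨0, ?_⟩⟩
    have : (𝟙 (tensor D.ρ (ResPow S 0))) = 0 := tensor_hom_ext _ fun n => by
      rw [resPow_eq_zero n, map_zero, zero_comp, zero_comp]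
    rw [← Category.comp_id g, this, comp_zero]
    change f ≫ tensorMk D.ρ (ResPow S 0) 0 = 0
    rw [map_zero, comp_zero]
  | succ j ih =>
    exact D.isRepresented_of_exact (LinearMap.ker (resPowProj S j)).subtype (resPowProj S j)
      Subtype.val_injective (LinearMap.exact_subtype_ker_map _) (resPowProj_surjective j)
      (D.isRepresented_of_retract hM (op_smul_ker_resPowProj j)) ih

lemma isIso_tensorMk_resPow {m : ℕ} (hm : S.M ^ m = ⊥) :
    IsIso (tensorMk D.ρ (ResPow S m) (RightRes.mk _ 1)) := by
  refine isIso_tensorMk _ _ ⟨fun x y hxy => ?_, fun s => ?_⟩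
  · simp only [RightRes.op_smul_quot_one] at hxy
    have := Ideal.Quotient.eq.1 hxy
    rw [hm] at this
    exact sub_eq_zero.1 this
  · obtain ⟨x, rfl⟩ := RightRes.exists_mk _ s
    exact ⟨x, RightRes.op_smul_quot_one _ x⟩

lemma tensorMk_resPow (j : ℕ) (x : S) :
    tensorMk D.ρ (ResPow S j) (RightRes.mk _ (Ideal.Quotient.mk _ x)) =
      (D.ρ x : D.X ⟶ D.X) ≫ tensorMk D.ρ (ResPow S j) (RightRes.mk _ 1) := by
  rw [← tensorMk_smul, RightRes.op_smul_quot_one]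

/-- For `M ^ m = 0` one has `X ≅ S / M ^ m ⊗ X`, so this is representability at the last stage. It
makes `Hom(P, X)` free of rank one over `S` on `f`, the source of both the ring homomorphisms and
the base change isomorphisms. -/
lemma action_bijective {P : A} {f : P ⟶ D.X} (hM : D.IsRepresented f (ResM S)) :
    Function.Bijective fun s : S => f ≫ (D.ρ s : D.X ⟶ D.X) := by
  obtain ⟨m, hm⟩ := S.str.nilp
  have h := D.isRepresented_resPow hM m
  have hiso := D.isIso_tensorMk_resPow hm
  constructor
  · intro x y hxy
    have h1 : RightRes.mk (Ideal.Quotient.mkₐ k (S.M ^ m)) (Ideal.Quotient.mk _ x) =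
        RightRes.mk _ (Ideal.Quotient.mk _ y) := by
      refine h.1 ?_
      change f ≫ tensorMk D.ρ (ResPow S m) _ = f ≫ tensorMk D.ρ (ResPow S m) _
      rw [tensorMk_resPow, tensorMk_resPow, ← Category.assoc, ← Category.assoc]
      exact congrArg (· ≫ tensorMk D.ρ (ResPow S m) (RightRes.mk _ 1)) hxy
    have h2 : x - y ∈ S.M ^ m := Ideal.Quotient.eq.1 h1
    rw [show S.M ^ m = ⊥ from hm] at h2
    exact sub_eq_zero.1 h2
  · intro g
    obtain ⟨s, hs⟩ := h.2 (g ≫ tensorMk D.ρ (ResPow S m) (RightRes.mk _ 1))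
    obtain ⟨x, rfl⟩ := RightRes.exists_mk _ s
    refine ⟨x, ?_⟩
    rw [← cancel_mono (tensorMk D.ρ (ResPow S m) (RightRes.mk _ 1)), ← hs]
    change _ = f ≫ tensorMk D.ρ (ResPow S m) _
    rw [tensorMk_resPow, Category.assoc]

/-- By flatness the kernel is `M ^ j / M ^ (j + 1) ⊗ X`, and a module annihilated by `M` is a
summand of a power of `S / M`. -/
lemma exists_shortExact_resPow (j : ℕ) :
    ∃ (K : A) (i : K ⟶ tensor D.ρ (ResPow S (j + 1))) (w : i ≫ tensorMap D.ρ (resPowProj S j) = 0),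
      (ShortComplex.mk i (tensorMap D.ρ (resPowProj S j)) w).ShortExact ∧ IsSummand (⨁ F) K :=
  ⟨_, _, _, D.isDeformation.flat _ _ _ (LinearMap.ker (resPowProj S j)).subtype (resPowProj S j)
    Subtype.val_injective (LinearMap.exact_subtype_ker_map _) (resPowProj_surjective j),
    D.isSummand_tensor (op_smul_ker_resPowProj j)⟩

lemma filt_resPow (j : ℕ) : Filt (⨁ F) j (tensor D.ρ (ResPow S j)) := by
  induction j with
  | zero =>
    refine .zero ((IsZero.iff_id_eq_zero _).2 (tensor_hom_ext _ fun n => ?_))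
    rw [resPow_eq_zero n, map_zero, zero_comp, zero_comp]
  | succ j ih =>
    obtain ⟨K, i, w, hS, hK⟩ := D.exists_shortExact_resPow j
    exact Filt.succ hS hK ih

lemma filt {m : ℕ} (hm : S.M ^ m = ⊥) : Filt (⨁ F) m D.X :=
  have := D.isIso_tensorMk_resPow hm
  (D.filt_resPow m).of_iso (asIso (tensorMk D.ρ (ResPow S m) (RightRes.mk _ 1))).symm

lemma exists_iso_of_eq_M (I : Ideal S) [I.IsTwoSided] (hI : I = S.M) :
    ∃ e : tensor D.ρ (RightRes (Ideal.Quotient.mkₐ k I)) ≅ ⨁ F,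
      tensorMk D.ρ (RightRes (Ideal.Quotient.mkₐ k I)) (RightRes.mk _ 1) ≫ e.hom = D.toSum := by
  subst hI
  exact ⟨D.φ, rfl⟩

end Deformation

end NCDef

/-! ### Deformations induced from a relatively projective tower -/

namespace NCDef

variable {k : Type uk} [Field k] {A : Type u} [Category.{v} A] [Abelian A] [Linear k A] {r : ℕ}
  {F : Fin r → A}

namespace Art

variable (R : Art.{uk, t} k r)

lemma incl_mul_single (c : Fin r → k) (i : Fin r) :
    R.str.incl c * R.str.incl (Pi.single i 1) = c i • R.str.incl (Pi.single i 1) := by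
  rw [← map_mul, ← map_smul]
  congr 1
  ext j
  by_cases hij : i = j
  · subst hij; simp
  · simp [Pi.single_eq_of_ne (Ne.symm hij)]

lemma single_mul_incl (c : Fin r → k) (i : Fin r) :
    R.str.incl (Pi.single i 1) * R.str.incl c = c i • R.str.incl (Pi.single i 1) := by
  rw [← map_mul, mul_comm, map_mul, incl_mul_single]

end Art

lemma diag_one : diag F (1 : Fin r → k) = 𝟙 (⨁ F) := biproduct.hom_ext _ _ fun i => by
  rw [diag_π, Category.id_comp, Pi.one_apply, one_smul]

section BaseChange

variable {R : Art.{uk, t} k r} {S : Art.{uk, t'} k r} {g : Art.Hom R S} {D₀ : Deformation R F}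
  {D : Deformation S F}

lemma IsBaseChange.exists_hom (hg : IsBaseChange g D₀ D) :
    ∃ f : D₀.X ⟶ D.X, f ≫ D.toSum = D₀.toSum ∧
      ∀ x, (D₀.ρ x : D₀.X ⟶ D₀.X) ≫ f = f ≫ (D.ρ (g.toAlgHom x) : D.X ⟶ D.X) := by
  obtain ⟨θ, h1, h2⟩ := hg
  refine ⟨tensorMk D₀.ρ (RightRes g.toAlgHom) (RightRes.mk _ 1) ≫ θ.hom, ?_, fun x => ?_⟩
  · rw [Category.assoc, h2]
  · have h3 : op x • RightRes.mk g.toAlgHom 1 =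
        RightRes.mulLeft g.toAlgHom (g.toAlgHom x) (RightRes.mk _ 1) := by
      rw [RightRes.op_smul_mk, one_mul]
      exact (mul_one (g.toAlgHom x)).symm
    rw [← Category.assoc, ← tensorMk_smul, h3, ← tensorMk_map, Category.assoc, h1,
      Category.assoc]

/-- By `hbij`, the right `R`-module `S` is `Hom(D₀.X, D.X)`, so `S ⊗ D₀.X` is the source of the
evaluation. -/
lemma isBaseChange_of_bijective [Module.FinitePresentation (R : Type t)ᵐᵒᵖ (HomMod D₀.ρ D.X)]
    (hev : IsIso (HomMod.ev D₀.ρ (X := D.X))) (f : D₀.X ⟶ D.X) (hf : f ≫ D.toSum = D₀.toSum)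
    (hfg : ∀ x, (D₀.ρ x : D₀.X ⟶ D₀.X) ≫ f = f ≫ (D.ρ (g.toAlgHom x) : D.X ⟶ D.X))
    (hbij : Function.Bijective fun s : S => f ≫ (D.ρ s : D.X ⟶ D.X)) :
    IsBaseChange g D₀ D := by
  have hmul : ∀ a c : S, (D.ρ (a * c) : D.X ⟶ D.X) = (D.ρ c : D.X ⟶ D.X) ≫ D.ρ a := fun a c => by
    rw [map_mul]; rfl
  let α : RightRes g.toAlgHom →+ (D₀.X ⟶ D.X) := AddMonoidHom.mk'
    (fun s => f ≫ (D.ρ s.val : D.X ⟶ D.X)) fun a c => by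
      rw [← Preadditive.comp_add]
      exact congrArg (f ≫ ·) (map_add D.ρ a.val c.val)
  have hα : ∀ (a : R) (s : RightRes g.toAlgHom), α (op a • s) = (D₀.ρ a : D₀.X ⟶ D₀.X) ≫ α s := by
    intro a s
    change f ≫ D.ρ (s.val * g.toAlgHom a) = D₀.ρ a ≫ f ≫ D.ρ s.val
    rw [hmul, ← Category.assoc, ← hfg, Category.assoc]
  have hiso := HomMod.isIso_tensorDesc D₀.ρ hev α hα hbij
  refine ⟨asIso (tensorDesc D₀.ρ α hα), fun s => tensor_hom_ext _ fun a => ?_, ?_⟩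
  · rw [asIso_hom, ← Category.assoc, tensorMk_map, tensorMk_desc, ← Category.assoc, tensorMk_desc]
    change f ≫ D.ρ (s * a.val) = (f ≫ D.ρ a.val) ≫ D.ρ s
    rw [hmul, Category.assoc]
  · rw [asIso_hom, ← Category.assoc, tensorMk_desc]
    change (f ≫ D.ρ 1) ≫ D.toSum = D₀.toSum
    rw [map_one, ← hf]
    congr 1
    exact Category.comp_id f

end BaseChange

/-! ### Mapping the tower to a given deformation -/

namespace IsProjTower

variable [HasExt.{w} A] {P : ℕ → A} {pr : ∀ n, P (n + 1) ⟶ P n} {b : ∀ n, P n ⟶ ⨁ F}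
  (h : IsProjTower.{w} (⨁ F) P pr b) (hF : IsSimpleCollection k F)
  {S : Art.{uk, t} k r} (D : Deformation S F) {n : ℕ}

-- Start from `X / M X ≅ ⨁ F` and lift successively to the quotients `X / M ^ (j + 1) X`. Each lift
-- starts from a quotient of length at most `n`, as `exists_lift` requires, and the last one reaches
-- `X`.
include h in
lemma exists_comp_toSum_eq (hm : S.M ^ (n + 1) = ⊥) : ∃ f : P n ⟶ D.X, f ≫ D.toSum = b n := by
  have key : ∀ j ≤ n, ∃ (β : tensor D.ρ (ResPow S (j + 1)) ⟶ ⨁ F)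
      (g : P n ⟶ tensor D.ρ (ResPow S (j + 1))),
      tensorMk D.ρ (ResPow S (j + 1)) (RightRes.mk _ 1) ≫ β = D.toSum ∧ g ≫ β = b n := by
    intro j hj
    induction j with
    | zero =>
      obtain ⟨e, he⟩ := D.exists_iso_of_eq_M (S.M ^ (0 + 1)) (Submodule.pow_one _)
      exact ⟨e.hom, b n ≫ e.inv, he, by rw [Category.assoc, e.inv_hom_id, Category.comp_id]⟩
    | succ j ih =>
      obtain ⟨β, g, hβ, hg⟩ := ih (by lia)
      obtain ⟨K, i, w, hS, hK⟩ := D.exists_shortExact_resPow (j + 1)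
      obtain ⟨g', hg'⟩ := h.exists_lift hS hK (D.filt_resPow (j + 1)) n hj g
      refine ⟨tensorMap D.ρ (resPowProj S (j + 1)) ≫ β, g', ?_, ?_⟩
      · rw [← Category.assoc, tensorMk_map]
        exact hβ
      · rw [← Category.assoc]
        exact (congrArg (· ≫ β) hg').trans hg
  obtain ⟨β, g, hβ, hg⟩ := key n le_rfl
  have := D.isIso_tensorMk_resPow hm
  refine ⟨g ≫ inv (tensorMk D.ρ (ResPow S (n + 1)) (RightRes.mk _ 1)), ?_⟩
  rw [← hβ, Category.assoc, IsIso.inv_hom_id_assoc, hg]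

variable {D}

include h hF in
lemma isRepresented_resM {f : P n ⟶ D.X} (hf : f ≫ D.toSum = b n) :
    D.IsRepresented f (ResM S) := by
  apply D.isRepresented_resM
  · intro c hc
    rw [hf] at hc
    exact h.base_diag_injective hF (by rw [hc, diag_zero, comp_zero])
  · intro g
    rw [hf]
    exact h.exists_eq_base_diag hF g

variable {R : Art.{uk, t'} k r} {ρ : R →ₐ[k] End (P n)} (hb : IsCompatible ρ (b n))

-- An arbitrary lift need not respect the idempotents, but `∑ e_i f e_i` does and still lifts `b n`.
-- Without this the ring homomorphism built from `f` would not commute with the inclusions of `k^r`.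
include hb in
omit [HasExt A] in
lemma exists_equivariant {f : P n ⟶ D.X} (hf : f ≫ D.toSum = b n) :
    ∃ f' : P n ⟶ D.X, f' ≫ D.toSum = b n ∧
      ∀ c, (ρ (R.str.incl c) : P n ⟶ P n) ≫ f' = f' ≫ (D.ρ (S.str.incl c) : D.X ⟶ D.X) := by
  have hD : ∀ a c : S, (D.ρ (c * a) : D.X ⟶ D.X) = (D.ρ a : D.X ⟶ D.X) ≫ D.ρ c := fun a c => by
    rw [map_mul]; rfl
  have hρ : ∀ a c : R, (ρ (c * a) : P n ⟶ P n) = (ρ a : P n ⟶ P n) ≫ ρ c := fun a c => by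
    rw [map_mul]; rfl
  have hDs : ∀ (c : k) (a : S), (D.ρ (c • a) : D.X ⟶ D.X) = c • (D.ρ a : D.X ⟶ D.X) :=
    fun c a => map_smul D.ρ c a
  have hρs : ∀ (c : k) (a : R), (ρ (c • a) : P n ⟶ P n) = c • (ρ a : P n ⟶ P n) :=
    fun c a => map_smul ρ c a
  refine ⟨∑ i, (ρ (R.str.incl (Pi.single i 1)) : P n ⟶ P n) ≫ f ≫
    (D.ρ (S.str.incl (Pi.single i 1)) : D.X ⟶ D.X), ?_, fun c => ?_⟩
  · have h1 : ∀ i, ((ρ (R.str.incl (Pi.single i 1)) : P n ⟶ P n) ≫ f ≫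
        (D.ρ (S.str.incl (Pi.single i 1)) : D.X ⟶ D.X)) ≫ D.toSum =
        (ρ (R.str.incl (Pi.single i 1)) : P n ⟶ P n) ≫ b n := fun i => by
      have h2 : b n ≫ diag F (Pi.single i (1 : k)) =
          (ρ (R.str.incl (Pi.single i 1)) : P n ⟶ P n) ≫ b n := by
        rw [hb, R.proj_incl]
      rw [Category.assoc, Category.assoc, D.isCompatible, S.proj_incl, ← Category.assoc f, hf, h2,
        ← Category.assoc, ← hρ, R.single_mul_incl, Pi.single_eq_same, one_smul]
    rw [Preadditive.sum_comp, Finset.sum_congr rfl fun i _ => h1 i, ← Preadditive.sum_comp]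
    have h3 : ∑ i, (ρ (R.str.incl (Pi.single i 1)) : P n ⟶ P n) = 𝟙 (P n) :=
      (map_sum ρ (fun i => R.str.incl (Pi.single i 1)) Finset.univ).symm.trans
        ((congrArg ρ R.sum_incl_single).trans (map_one ρ))
    rw [h3, Category.id_comp]
  · rw [Preadditive.comp_sum, Preadditive.sum_comp]
    refine Finset.sum_congr rfl fun i _ => ?_
    rw [← Category.assoc, ← hρ, R.single_mul_incl, hρs, Category.assoc, Category.assoc, ← hD,
      S.incl_mul_single, hDs, Linear.smul_comp, Linear.comp_smul, Linear.comp_smul]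

-- `g x` is the unique element of `S` with `f x = g(x) f`; uniqueness makes `g` an algebra
-- homomorphism.
include h hF hb in
lemma exists_artHom {f : P n ⟶ D.X} (hf : f ≫ D.toSum = b n)
    (hincl : ∀ c, (ρ (R.str.incl c) : P n ⟶ P n) ≫ f = f ≫ (D.ρ (S.str.incl c) : D.X ⟶ D.X)) :
    ∃ g : Art.Hom R S,
      ∀ x, (ρ x : P n ⟶ P n) ≫ f = f ≫ (D.ρ (g.toAlgHom x) : D.X ⟶ D.X) := by
  have hbij := D.action_bijective (h.isRepresented_resM hF hf)
  choose G hG using fun x : R => hbij.2 ((ρ x : P n ⟶ P n) ≫ f)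
  replace hG : ∀ x, f ≫ (D.ρ (G x) : D.X ⟶ D.X) = (ρ x : P n ⟶ P n) ≫ f := hG
  have huniq : ∀ x s, f ≫ (D.ρ s : D.X ⟶ D.X) = (ρ x : P n ⟶ P n) ≫ f → G x = s :=
    fun x s hs => hbij.1 ((hG x).trans hs.symm)
  have hGincl : ∀ c, G (R.str.incl c) = S.str.incl c := fun c => huniq _ _ (hincl c).symm
  let g : R →ₐ[k] S :=
    { toFun := G
      map_one' := huniq _ _ (by
        rw [map_one, map_one]; exact (Category.comp_id f).trans (Category.id_comp f).symm)
      map_mul' := fun x y => huniq _ _ (by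
        rw [map_mul, map_mul]
        change f ≫ D.ρ (G y) ≫ D.ρ (G x) = (ρ y ≫ ρ x) ≫ f
        rw [← Category.assoc, hG, Category.assoc, hG, Category.assoc])
      map_zero' := huniq _ _ (by
        rw [map_zero, map_zero]; exact comp_zero.trans zero_comp.symm)
      map_add' := fun x y => huniq _ _ (by
        rw [map_add, map_add]
        refine (Preadditive.comp_add _ _ _ _ _ _).trans ?_
        rw [hG, hG]
        exact (Preadditive.add_comp _ _ _ _ _ _).symm)
      commutes' := fun c => by
        rw [← R.str.incl.commutes, ← S.str.incl.commutes]; exact hGincl _ }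
  refine ⟨⟨g, AlgHom.ext hGincl, AlgHom.ext fun x => ?_⟩, fun x => (hG x).symm⟩
  apply h.base_diag_injective hF (n := n)
  change b n ≫ diag F (S.str.proj (G x)) = _
  rw [← hb, ← hf, Category.assoc, ← D.isCompatible, ← Category.assoc, hG, Category.assoc]

variable {φ : tensor ρ (ResM R) ≅ ⨁ F} {hD : IsDeformation R F (P n) ρ φ}
  (hφ : tensorMk ρ (ResM R) (RightRes.mk _ 1) ≫ φ.hom = b n)

include h hF hb hφ in
lemma isBaseChange (hρ : Function.Bijective ρ) {m : ℕ} (hX : Filt (⨁ F) m D.X) (hm : m ≤ n + 1)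
    {f : P n ⟶ D.X} (hf : f ≫ D.toSum = b n) {g : Art.Hom R S}
    (hfg : ∀ x, (ρ x : P n ⟶ P n) ≫ f = f ≫ (D.ρ (g.toAlgHom x) : D.X ⟶ D.X)) :
    IsBaseChange g (⟨P n, ρ, φ, hD⟩ : Deformation R F) D := by
  have := h.finitePresentation_homMod (ρ := ρ) hF hX
  exact isBaseChange_of_bijective (D₀ := ⟨P n, ρ, φ, hD⟩) (h.isIso_ev hF hb hρ hX hm) f
    (hf.trans hφ.symm) hfg (D.action_bijective (h.isRepresented_resM hF hf))

include h hF hb hφ in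
lemma exists_isBaseChange (hρ : Function.Bijective ρ) (hm : S.M ^ (n + 1) = ⊥) :
    ∃ g : Art.Hom R S, IsBaseChange g (⟨P n, ρ, φ, hD⟩ : Deformation R F) D := by
  obtain ⟨f₀, hf₀⟩ := h.exists_comp_toSum_eq D hm
  obtain ⟨f, hf, hincl⟩ := exists_equivariant hb hf₀
  obtain ⟨g, hg⟩ := h.exists_artHom hF hb hf hincl
  exact ⟨g, h.isBaseChange hF hb hφ hρ (D.filt hm) le_rfl hf hg⟩

-- The two base changes give lifts `f` and `f' = s f` with `s ∈ 1 + M`. Equivariance yields `s g(x)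
-- = g'(x) s`, so `g(x) - g'(x) = g'(x)(s - 1) - (s - 1) g(x)`, which lies in `M²`.
include h hF hφ in
lemma sub_mem_of_isBaseChange {g g' : Art.Hom R S}
    (hg : IsBaseChange g (⟨P n, ρ, φ, hD⟩ : Deformation R F) D)
    (hg' : IsBaseChange g' (⟨P n, ρ, φ, hD⟩ : Deformation R F) D) (x : R) (hx : x ∈ R.M) :
    g.toAlgHom x - g'.toAlgHom x ∈ S.M * S.M := by
  obtain ⟨f, hf, hfg⟩ := hg.exists_hom
  obtain ⟨f', hf', hfg'⟩ := hg'.exists_hom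
  replace hf : f ≫ D.toSum = b n := hf.trans hφ
  replace hf' : f' ≫ D.toSum = b n := hf'.trans hφ
  have hbij := D.action_bijective (h.isRepresented_resM hF hf)
  obtain ⟨s, hs⟩ := hbij.2 f'
  replace hs : f ≫ (D.ρ s : D.X ⟶ D.X) = f' := hs
  have hsM : s - 1 ∈ S.M := by
    rw [S.mem_M, map_sub, map_one, sub_eq_zero]
    apply h.base_diag_injective hF (n := n)
    refine Eq.trans ?_ (hf'.trans (by rw [diag_one, Category.comp_id]))
    rw [← hs, ← hf, Category.assoc, Category.assoc, D.isCompatible]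
  have hcomm : s * g.toAlgHom x = g'.toAlgHom x * s := by
    apply hbij.1
    change f ≫ D.ρ (s * g.toAlgHom x) = f ≫ D.ρ (g'.toAlgHom x * s)
    rw [map_mul, map_mul]
    change f ≫ D.ρ (g.toAlgHom x) ≫ D.ρ s = f ≫ D.ρ s ≫ D.ρ (g'.toAlgHom x)
    rw [← Category.assoc, ← Category.assoc, hs, ← hfg']
    refine (congrArg (· ≫ (D.ρ s : D.X ⟶ D.X)) (hfg x)).symm.trans ?_
    exact (Category.assoc _ _ _).trans (congrArg (_ ≫ ·) hs)
  have h1 : g.toAlgHom x - g'.toAlgHom x =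
      g'.toAlgHom x * (s - 1) - (s - 1) * g.toAlgHom x := by
    rw [mul_sub, sub_mul, hcomm, mul_one, one_mul, sub_sub_sub_cancel_left]
  rw [h1]
  exact sub_mem (Ideal.mul_mem_mul (g'.map_M hx) hsM) (Ideal.mul_mem_mul hsM (g.map_M hx))

end IsProjTower

end NCDef

/-! ### Tangent maps and versality -/

namespace NCDef

namespace Art.Hom

variable {k : Type uk} [Field k] {r : ℕ}

lemma cotangentMap_id (R : Art.{uk, t} k r) : (Hom.id R).cotangentMap = LinearMap.id := by
  apply Submodule.linearMap_qext
  ext x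
  rfl

lemma cotangentMap_comp {R S T : Art.{uk, t} k r} (f : Hom R S) (g : Hom S T) :
    (f.comp g).cotangentMap = g.cotangentMap.comp f.cotangentMap := by
  apply Submodule.linearMap_qext
  ext x
  rfl

variable {R : Art.{uk, t} k r} {S : Art.{uk, t'} k r}

lemma cotangentMap_congr {g g' : Hom R S}
    (h : ∀ x ∈ R.M, g.toAlgHom x - g'.toAlgHom x ∈ S.M * S.M) :
    g.cotangentMap = g'.cotangentMap := by
  apply Submodule.linearMap_qext
  ext x
  exact (Submodule.Quotient.eq _).2 (h x.1 x.2)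

lemma exists_mem_M_mul_M (g : Hom R S) (hg : Function.Surjective g.toAlgHom) {y : S}
    (hy : y ∈ S.M * S.M) : ∃ x ∈ R.M * R.M, g.toAlgHom x = y := by
  have hM : ∀ y ∈ S.M, ∃ x ∈ R.M, g.toAlgHom x = y := fun y hy => by
    obtain ⟨x, rfl⟩ := hg y
    refine ⟨x, ?_, rfl⟩
    rw [mem_M, ← g.proj_comp]
    exact hy
  refine Submodule.smul_induction_on hy ?_ ?_
  · intro a ha b hb
    obtain ⟨a', ha', rfl⟩ := hM a ha
    obtain ⟨b', hb', rfl⟩ := hM b hb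
    exact ⟨a' * b', Ideal.mul_mem_mul ha' hb', map_mul _ _ _⟩
  · rintro _ _ ⟨a, ha, rfl⟩ ⟨b, hb, rfl⟩
    exact ⟨a + b, add_mem ha hb, map_add _ _ _⟩

lemma cotangentMap_bijective (g : Hom R S) (hg : Function.Surjective g.toAlgHom)
    (hker : ∀ x, g.toAlgHom x = 0 → x ∈ R.M * R.M) : Function.Bijective g.cotangentMap := by
  constructor
  · rw [injective_iff_map_eq_zero]
    intro x hx
    obtain ⟨x, rfl⟩ := Submodule.Quotient.mk_surjective _ x
    have h1 : g.toAlgHom x.1 ∈ S.M * S.M := (Submodule.Quotient.mk_eq_zero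
      (((S.M * S.M).restrictScalars k).submoduleOf (S.M.restrictScalars k))).1 hx
    obtain ⟨y, hy, hxy⟩ := g.exists_mem_M_mul_M hg h1
    refine (Submodule.Quotient.mk_eq_zero _).2 ?_
    have h2 := hker (x.1 - y) (by rw [map_sub, hxy, sub_self])
    change x.1 ∈ R.M * R.M
    rw [← sub_add_cancel x.1 y]
    exact add_mem h2 hy
  · intro y
    obtain ⟨⟨y, hy⟩, rfl⟩ := Submodule.Quotient.mk_surjective _ y
    obtain ⟨x, rfl⟩ := hg y
    have hx : x ∈ R.M := by
      rw [mem_M, ← g.proj_comp]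
      exact hy
    exact ⟨Submodule.Quotient.mk ⟨x, hx⟩, rfl⟩

end Art.Hom

lemma transition_cotangentMap_bijective {k : Type uk} [Field k] {r : ℕ} {R : ℕ → Art.{uk, t} k r}
    (f : ∀ n, Art.Hom (R (n + 1)) (R n)) (n : ℕ)
    (hf : ∀ d, Function.Bijective (f (n + d)).cotangentMap) (d : ℕ) :
    Function.Bijective (transition f n d).cotangentMap := by
  induction d with
  | zero =>
    change Function.Bijective (Art.Hom.id (R n)).cotangentMap
    rw [Art.Hom.cotangentMap_id]
    exact Function.bijective_id
  | succ d ih =>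
    change Function.Bijective ((f (n + d)).comp (transition f n d)).cotangentMap
    rw [Art.Hom.cotangentMap_comp]
    exact ih.comp (hf d)

variable {k : Type uk} [Field k] {A : Type u} [Category.{v} A] [Abelian A] [Linear k A] {r : ℕ}
  {F : Fin r → A} [HasExt.{w} A]

/-- The quotient of `P (n + 1)` by `M²` has length 2, at most `n + 1`, so the projection to it
factors through `pr n` and is killed by `x`. Since `R / M²` embeds in the maps to this quotient, `x
∈ M²`. -/
lemma IsProjTower.mem_M_mul_M {P : ℕ → A} {pr : ∀ n, P (n + 1) ⟶ P n} {b : ∀ n, P n ⟶ ⨁ F}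
    (h : IsProjTower.{w} (⨁ F) P pr b) (hF : IsSimpleCollection k F) {R : Art.{uk, t} k r} {n : ℕ}
    {ρ : R →ₐ[k] End (P (n + 1))} {φ : tensor ρ (ResM R) ≅ ⨁ F}
    (hD : IsDeformation R F (P (n + 1)) ρ φ)
    (hφ : tensorMk ρ (ResM R) (RightRes.mk _ 1) ≫ φ.hom = b (n + 1)) (hn : 1 ≤ n) (x : R)
    (hx : (ρ x : P (n + 1) ⟶ P (n + 1)) ≫ pr n = 0) : x ∈ R.M * R.M := by
  let D : Deformation R F := ⟨P (n + 1), ρ, φ, hD⟩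
  have hrep := D.isRepresented_resPow
    (h.isRepresented_resM hF (D := D) (n := n + 1) (f := 𝟙 (P (n + 1)))
      ((Category.id_comp _).trans hφ)) 2
  obtain ⟨l, hl⟩ := h.exists_fac_of_filt (D.filt_resPow 2) n (by lia)
    (tensorMk ρ (ResPow R 2) (RightRes.mk _ 1))
  have h1 : tensorMk ρ (ResPow R 2) (RightRes.mk _ (Ideal.Quotient.mk _ x)) = 0 := by
    refine (D.tensorMk_resPow 2 x).trans ?_
    change (ρ x : P (n + 1) ⟶ P (n + 1)) ≫ tensorMk ρ (ResPow R 2) (RightRes.mk _ 1) = 0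
    rw [hl, ← Category.assoc, hx, zero_comp]
  have h2 : RightRes.mk (Ideal.Quotient.mkₐ k (R.M ^ 2)) (Ideal.Quotient.mk _ x) = 0 := by
    apply hrep.1
    change 𝟙 (P (n + 1)) ≫ tensorMk ρ (ResPow R 2) _ = 𝟙 (P (n + 1)) ≫ tensorMk ρ (ResPow R 2) 0
    rw [h1, map_zero]
  have h3 : x ∈ R.M ^ 2 := Ideal.Quotient.eq_zero_iff_mem.1 h2
  rwa [Submodule.pow_succ, Submodule.pow_one] at h3

namespace UniversalTower

variable (hF : IsSimpleCollection k F) (T : UniversalTower.{w} k F)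

lemma endTransition_mem (n : ℕ) (hn : 1 ≤ n)
    {φ : tensor (Art.taut (T.artStr hF (n + 1))) (ResM (Art.of (T.artStr hF (n + 1)))) ≅ ⨁ F}
    (hD : IsDeformation (Art.of (T.artStr hF (n + 1))) F (T.sum (n + 1))
      (Art.taut (T.artStr hF (n + 1))) φ)
    (hφ : tensorMk (Art.taut (T.artStr hF (n + 1))) (ResM (Art.of (T.artStr hF (n + 1))))
      (RightRes.mk _ 1) ≫ φ.hom = T.toBase (n + 1)) (x : Art.of (T.artStr hF (n + 1)))
    (hx : (T.endTransition hF n).toAlgHom x = 0) :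
    x ∈ (Art.of (T.artStr hF (n + 1))).M * (Art.of (T.artStr hF (n + 1))).M := by
  refine (T.isProjTower hF).mem_M_mul_M hF hD hφ hn x ?_
  refine (T.comp_proj hF n x).trans ?_
  rw [hx]
  exact comp_zero

lemma isVersal
    (φ : ∀ n, tensor (Art.taut (T.artStr hF n)) (ResM (Art.of (T.artStr hF n))) ≅ ⨁ F)
    (hD : ∀ n, IsDeformation (Art.of (T.artStr hF n)) F (T.sum n) (Art.taut (T.artStr hF n)) (φ n))
    (hφ : ∀ n, tensorMk (Art.taut (T.artStr hF n)) (ResM (Art.of (T.artStr hF n)))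
      (RightRes.mk _ 1) ≫ (φ n).hom = T.toBase n) :
    IsVersal.{v, u, uk, v, t} F (fun n => Art.of (T.artStr hF n))
      (fun n => ⟨T.sum n, Art.taut (T.artStr hF n), φ n, hD n⟩) (T.endTransition hF) where
  surjective := T.endTransition_surjective hF
  baseChange n := (T.isProjTower hF).isBaseChange hF (T.isCompatible hF (n + 1)) (hφ (n + 1))
    (T.taut_bijective hF (n + 1)) (D := ⟨T.sum n, Art.taut (T.artStr hF n), φ n, hD n⟩)
    ((T.isProjTower hF).filt n) (by lia) (f := T.proj n) (congrArg (T.proj n ≫ ·) (hφ n))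
    (T.comp_proj hF n)
  exists_hom S D' := by
    obtain ⟨m, hm⟩ := S.str.nilp
    -- Taking `m + 1` instead of `m` ensures a positive index; `M ^ (m + 2)` still vanishes.
    refine ⟨m + 1, m.succ_pos, (T.isProjTower hF).exists_isBaseChange hF
      (T.isCompatible hF (m + 1)) (hφ (m + 1)) (T.taut_bijective hF (m + 1)) ?_⟩
    exact le_bot_iff.1 ((Ideal.pow_le_pow_right (by lia)).trans hm.le)
  tangent := by
    -- Stage 1 is the first from which `endTransition_mem` puts the transition kernels inside `M²`.
    refine ⟨1, one_pos, transition_cotangentMap_bijective _ 1 fun d => ?_, ?_⟩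
    · exact Art.Hom.cotangentMap_bijective _ (T.endTransition_surjective hF (1 + d))
        (T.endTransition_mem hF (1 + d) (by lia) (hD _) (hφ _))
    · intro d S D' g g' hg hg'
      exact Art.Hom.cotangentMap_congr
        ((T.isProjTower hF).sub_mem_of_isBaseChange hF (hφ (1 + d)) hg hg')

end UniversalTower

end NCDef

end

theorem theorem4p8
    {k : Type uk} [Field k] {A : Type u} [Category.{v} A] [Abelian A] [Linear k A]
    [HasExt.{w} A] {r : ℕ} (hr : 0 < r) (F : Fin r → A)
    (hF : NCDef.IsSimpleCollection k F)
    (hExt : Module.Finite k (Abelian.Ext.{w} (⨁ F) (⨁ F) 1)) :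
    Nonempty (NCDef.UniversalTower.{w} k F) ∧
    ∀ T : NCDef.UniversalTower.{w} k F,
      -- the ring `R^{(n)} = End F^{(n)}` lies in `(Art_r)`, with its natural structure maps
      ∃ S : ∀ n, NCDef.ArtStr k r (End (T.sum n)),
        (∀ n i, (S n).incl (Pi.single i 1) = T.idem n i) ∧
        (∀ n (x : End (T.sum n)), x.asHom ≫ T.toBase n =
          T.toBase n ≫ biproduct.map fun i => (S n).proj x i • 𝟙 (F i)) ∧
      -- `F^{(n)}` with the natural isomorphism `φ^{(n)}` is a deformation over `R^{(n)}`
      ∃ (φ : ∀ n, NCDef.tensor (NCDef.Art.taut (S n)) (NCDef.ResM (NCDef.Art.of (S n))) ≅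
            ⨁ F)
        (hD : ∀ n, NCDef.IsDeformation (NCDef.Art.of (S n)) F (T.sum n)
            (NCDef.Art.taut (S n)) (φ n)),
        (∀ n, NCDef.tensorMk (NCDef.Art.taut (S n)) (NCDef.ResM (NCDef.Art.of (S n)))
            (NCDef.RightRes.mk _ 1) ≫ (φ n).hom = T.toBase n) ∧
      -- the sequence is versal, for the natural homomorphisms `R^{(n+1)} → R^{(n)}`
      ∃ f : ∀ n, NCDef.Art.Hom (NCDef.Art.of (S (n + 1))) (NCDef.Art.of (S n)),
        (∀ n (x : End (T.sum (n + 1))), x.asHom ≫ T.proj n =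
          T.proj n ≫ End.asHom ((f n).toAlgHom x : End (T.sum n))) ∧
        NCDef.IsVersal.{v, u, uk, v, t} F (fun n => NCDef.Art.of (S n))
          (fun n => ⟨T.sum n, NCDef.Art.taut (S n), φ n, hD n⟩) f := by
  refine ⟨NCDef.nonempty_universalTower hExt, fun T => ?_⟩
  choose φ hD hφ using fun n => (T.isProjTower hF).exists_isDeformation hF
    (T.isCompatible hF n) (T.taut_bijective hF n)
  exact ⟨T.artStr hF, T.artStr_incl_single hF, T.comp_toBase hF, φ, hD, hφ, T.endTransition hF,
    T.comp_proj hF, T.isVersal hF φ hD hφ⟩
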